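/- **Proposition (second variation for nonsmooth bodies).** Let $n\ge 1$, $p\in\mathbb R$, and let $\mathfrak m$ be a Radon (finite Borel) measure on $S^n\subset\mathbb R^{n+1}$, assumed to be a probability measure if $p=0$. For a convex body $K\subset\mathbb R^{n+1}$ (with nonempty interior) let $h_K$ be its support function, $V(h_K)$ its volume, and $S_{h_K}(\omega)=\mathcal H^n(\nu_K^{-1}(\omega))$ its surface area measure, where $\nu_K$ is the Gauss map. Put $$F(h)=\frac1p\log\int_{S^n}h^p\,d\mathfrak m-\frac1{n+1}\log V(h)\quad(p\neq0),\qquad F(h)=\int_{S^n}\log h\,d\mathfrak m-\frac1{n+1}\log V(h)\quad(p=0),$$ and call $h>0$ a critical point of $F$ if $$\frac{\int_{S^n}g\,h^{p-1}d\mathfrak m}{\int_{S^n}h^p\,d\mathfrak m}=\frac{\int_{S^n}g\,dS_h}{(n+1)V(h)}\qquad\text{for all } g\in C(S^n).$$ Let $h_t$, $t\in[a,1]$ with $a\le 0$ (for instance $a=0$ or $a=-1$), be support functions of convex bodies with nonempty interior such that $t\mapsto h_t\in C(S^n)$ is twice differentiable in the sup norm (that is, $(h_{t+s}-h_t)/s\to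 h_t'$ and $(h'_{t+s}-h'_t)/s\to h_t''$ uniformly on $S^n$ as $s\to0$, $t+s\in[a,1]$). Assume that $h_0>0$ is a critical point of $F$ and that $h_0'=h_0z$, where $z:S^n\to\mathbb R$ has bounded gradient (is Lipschitz) and is quasi-plurisubharmonic: extended to $(\mathbb R^{n+1}\setminus\{0\})\times\mathbb T^{n+1}$ (complex coordinates $x+\sqrt{-1}\,y$) homogeneously of degree $0$ in $x$ and constantly in $y$, it becomes plurisubharmonic locally after adding a smooth function. Then: 1. There is a unique finite Borel measure on $S^n$, denoted $H_0^{ij}z_iz_j\,dS_{h_0}$, that is the weak limit of the measures $U_k^{ij}(z_k)_i(z_k)_j\,dS$ (with $U_k$ the cofactor matrix of $H_k=\nabla^2h_k+h_k\mathrm{Id}$ and $dS$ the standard measure of $S^n$) along all sequences of smooth support functions $h_k\to h_0$ and smooth functions $z_k\to z$, both uniformly on $S^n$, such that the $z_k$ are uniformly quasi-plurisubharmonic (locally, one smooth function makes all the extended $z_k$ plurisubharmonic). 2. $t\mapsto F(h_t)$ is differentiable for $t\in[a,1]$ near $0$, its derivative is differentiable at $t=0$ (derivatives taken within $[a,1]$),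 and $$\frac{d^2}{dt^2}\Big|_{t=0}F(h_t)=\frac{p-1-n}{(n+1)V(h_0)}\int_{S^n}z^2h_0\,dS_{h_0}+\frac{n+1-p}{\big((n+1)V(h_0)\big)^2}\Big(\int_{S^n}h_0'\,dS_{h_0}\Big)^2+\frac1{(n+1)V(h_0)}\int_{S^n}H_0^{ij}z_iz_j\,h_0^2\,dS_{h_0}.$$ -/

import Mathlib

open MeasureTheory Filter Topology
open scoped ContDiff

noncomputable section

namespace NonsmoothVariation

/-- The Euclidean space `ℝⁿ⁺¹`. -/
abbrev Eucl (n : ℕ) : Type := EuclideanSpace ℝ (Fin (n + 1))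

/-- The unit sphere `Sⁿ ⊆ ℝⁿ⁺¹`. -/
abbrev Sph (n : ℕ) : Type := Metric.sphere (0 : Eucl n) 1

/-! ### Support functions, volume, surface area measure -/

/-- The support function `h_K(x) = max_{y ∈ K} ⟨x, y⟩` on `ℝⁿ⁺¹`. -/
def supportFn {n : ℕ} (K : ConvexBody (Eucl n)) (x : Eucl n) : ℝ :=
  sSup ((fun y : Eucl n => inner ℝ x y) '' (K : Set (Eucl n)))

theorem continuous_supportFn {n : ℕ} (K : ConvexBody (Eucl n)) : Continuous (supportFn K) :=
  K.isCompact.continuous_sSup (f := fun x y : Eucl n => (inner ℝ x y : ℝ))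
    (by
      change Continuous (fun q : Eucl n × Eucl n => (inner ℝ q.1 q.2 : ℝ))
      exact continuous_fst.inner continuous_snd)

/-- The support function as an element of `C(Sⁿ)` (with the sup norm). -/
def supportMap {n : ℕ} (K : ConvexBody (Eucl n)) : C(Sph n, ℝ) where
  toFun u := supportFn K u
  continuous_toFun := (continuous_supportFn K).comp continuous_subtype_val

/-- The volume of a convex body. -/
def vol {n : ℕ} (K : ConvexBody (Eucl n)) : ℝ :=
  (volume (K : Set (Eucl n))).toReal

/-- The unit vector `u` is an outer unit normal of `K` at the boundary point `y`. -/
def IsOuterNormal {n : ℕ} (K : ConvexBody (Eucl n)) (y : Eucl n) (u : Sph n) : Prop :=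
  inner ℝ y (u : Eucl n) = supportFn K u

/-- The boundary points with exactly one outer unit normal. -/
def regularBoundary {n : ℕ} (K : ConvexBody (Eucl n)) : Set (Eucl n) :=
  {y | y ∈ frontier (K : Set (Eucl n)) ∧ ∃! u : Sph n, IsOuterNormal K y u}

open Classical in
/-- The Gauss map: the outer unit normal at a regular boundary point (and an irrelevant value
elsewhere). -/
def gaussMap {n : ℕ} (K : ConvexBody (Eucl n)) (y : Eucl n) : Sph n :=
  if hy : y ∈ regularBoundary K then hy.2.choose else ⟨EuclideanSpace.single 0 1, by simp⟩

/-- The surface area measure `S_K(ω) = ℋⁿ(ν_K⁻¹(ω))`, where `ℋⁿ` is the `n`-dimensional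
Hausdorff measure, normalized to agree with Lebesgue measure on `n`-planes. -/
def surfaceAreaMeasure {n : ℕ} (K : ConvexBody (Eucl n)) : Measure (Sph n) :=
  ((Measure.euclideanHausdorffMeasure n : Measure (Eucl n)).restrict (regularBoundary K)).map
    (gaussMap K)

/-! ### The functional and its critical points -/

/-- `F(K) = (1/p) log ∫ h_K^p d𝔪 - (1/(n+1)) log V(K)`; for `p = 0` the first term is
`∫ log h_K d𝔪`. -/
def functionalF {n : ℕ} (p : ℝ) (m : Measure (Sph n)) (K : ConvexBody (Eucl n)) : ℝ :=
  (if p = 0 then ∫ u, Real.log (supportMap K u) ∂m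
    else 1 / p * Real.log (∫ u, supportMap K u ^ p ∂m))
  - 1 / ((n : ℝ) + 1) * Real.log (vol K)

/-- `K` is a critical point of `F`: the first variation vanishes in all directions
`g ∈ C(Sⁿ)`. -/
def IsCriticalPoint {n : ℕ} (p : ℝ) (m : Measure (Sph n)) (K : ConvexBody (Eucl n)) : Prop :=
  ∀ g : C(Sph n, ℝ),
    (∫ u, g u * supportMap K u ^ (p - 1) ∂m) / (∫ u, supportMap K u ^ p ∂m)
      = (∫ u, g u ∂(surfaceAreaMeasure K)) / (((n : ℝ) + 1) * vol K)

/-! ### Quasi-plurisubharmonic functions on the sphere -/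

/-- The extension of a function on `Sⁿ` to `ℝⁿ⁺¹ ∖ {0}`, homogeneous of degree `0`. -/
def homExt {n : ℕ} (z : Sph n → ℝ) (x : Eucl n) : ℝ :=
  if hx : x = 0 then 0 else z ⟨‖x‖⁻¹ • x, by simp [norm_smul, hx]⟩

/-- The real part `x` of a point `x + i y` of `ℂⁿ⁺¹`. -/
def rePart {n : ℕ} (w : Fin (n + 1) → ℂ) : Eucl n :=
  WithLp.toLp 2 (fun i => (w i).re)

/-- A real-valued function is plurisubharmonic on `Ω ⊆ ℂⁿ⁺¹`: it is upper semicontinuous and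
satisfies the sub-mean value inequality on every closed complex disc
`{a + ζ b : |ζ| ≤ 1} ⊆ Ω`. -/
def IsPSHOn {n : ℕ} (f : (Fin (n + 1) → ℂ) → ℝ) (Ω : Set (Fin (n + 1) → ℂ)) : Prop :=
  UpperSemicontinuousOn f Ω ∧
    ∀ a b : Fin (n + 1) → ℂ, (∀ ζ : ℂ, ‖ζ‖ ≤ 1 → a + ζ • b ∈ Ω) →
      CircleIntegrable (fun ζ : ℂ => f (a + ζ • b)) 0 1 ∧
      f a ≤ Real.circleAverage (fun ζ : ℂ => f (a + ζ • b)) 0 1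

/-- A family of functions on `Sⁿ` is (uniformly) quasi-plurisubharmonic: extended to be
homogeneous of degree `0` in `x` and constant in `y`, its members become plurisubharmonic after
adding, locally on `(ℝⁿ⁺¹ ∖ {0}) × 𝕋ⁿ⁺¹` with the complex coordinates `x + i y`, one common
smooth function. Being a local condition, it is expressed on the universal cover of the torus. -/
def IsQuasiPSHFamily {n : ℕ} {κ : Type} (ζ : κ → Sph n → ℝ) : Prop :=
  ∀ w : Fin (n + 1) → ℂ, rePart w ≠ 0 →
    ∃ Ω : Set (Fin (n + 1) → ℂ), IsOpen Ω ∧ w ∈ Ω ∧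
      ∃ φ : (Fin (n + 1) → ℂ) → ℝ, ContDiffOn ℝ ∞ φ Ω ∧
        ∀ k, IsPSHOn (fun v => homExt (ζ k) (rePart v) + φ v) Ω

/-- A quasi-plurisubharmonic function on `Sⁿ`: locally the sum with a smooth function is
plurisubharmonic. -/
def IsQuasiPSH {n : ℕ} (z : Sph n → ℝ) : Prop :=
  IsQuasiPSHFamily (fun _ : Unit => z)

/-! ### The measure `H^{ij} z_i z_j dS_K` -/

/-- The standard basis of `ℝⁿ⁺¹`. -/
def stdVec {n : ℕ} (i : Fin (n + 1)) : Eucl n := EuclideanSpace.single i 1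

/-- The Euclidean Hessian matrix. -/
def hessianMatrix {n : ℕ} (f : Eucl n → ℝ) (x : Eucl n) :
    Matrix (Fin (n + 1)) (Fin (n + 1)) ℝ :=
  Matrix.of fun i j => fderiv ℝ (fderiv ℝ f) x (stdVec i) (stdVec j)

/-- The Euclidean gradient, as a coordinate vector. -/
def gradVec {n : ℕ} (f : Eucl n → ℝ) (x : Eucl n) : Fin (n + 1) → ℝ :=
  fun i => fderiv ℝ f x (stdVec i)

/-- For a support function `h` that is smooth away from the origin, `x ∈ Sⁿ` and `z` smooth on
`Sⁿ`: the density `U^{ij} z_i z_j = H^{ij} z_i z_j det H` at `x`, where `U` is the cofactor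
matrix of `H = ∇²h + h Id` on the tangent space of `Sⁿ` at `x`. In `ℝⁿ⁺¹`, the matrix
`A = D²h + dr ⊗ dr` is block diagonal at `x`, equal to `H` on the tangent space and to `1` in the
radial direction, so that the cofactor matrix of `A` restricts to `U`; the gradient of the
`0`-homogeneous extension of `z` is the tangential gradient of `z`. -/
def gradDensity {n : ℕ} (L : ConvexBody (Eucl n)) (z : Sph n → ℝ) (x : Sph n) : ℝ :=
  gradVec (homExt z) x ⬝ᵥ
    (hessianMatrix (supportFn L) x +
      Matrix.vecMulVec (fun i => (x : Eucl n) i) (fun i => (x : Eucl n) i)).adjugate.mulVec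
      (gradVec (homExt z) x)

/-- The finite measure `μ` is the measure `H^{ij} z_i z_j dS_K = U^{ij} z_i z_j dS` of a possibly
nonsmooth body `K` and a quasi-plurisubharmonic `z`: it is the weak limit of the measures
`U_k^{ij} (z_k)_i (z_k)_j dS` along all smooth approximations, that is, bodies `L k` with smooth
support functions converging uniformly to the one of `K`, and uniformly quasi-plurisubharmonic
smooth functions `z_k` converging uniformly to `z`. Here `dS` is the standard measure of `Sⁿ`. -/
structure IsGradMeasure {n : ℕ} (K : ConvexBody (Eucl n)) (z : Sph n → ℝ)
    (μ : Measure (Sph n)) : Prop where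
  finite : IsFiniteMeasure μ
  weak_limit : ∀ (L : ℕ → ConvexBody (Eucl n)) (ζ : ℕ → Sph n → ℝ),
    (∀ k, ContDiffOn ℝ ∞ (supportFn (L k)) {0}ᶜ) →
    Tendsto (fun k => supportMap (L k)) atTop (𝓝 (supportMap K)) →
    (∀ k, ContDiffOn ℝ ∞ (homExt (ζ k)) {0}ᶜ) →
    TendstoUniformly ζ z atTop →
    IsQuasiPSHFamily ζ →
    ∀ φ : C(Sph n, ℝ),
      Tendsto
        (fun k => ∫ x, φ x * gradDensity (L k) (ζ k) x ∂((volume : Measure (Eucl n)).toSphere))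
        atTop (𝓝 (∫ x, φ x ∂μ))

end NonsmoothVariation

end

noncomputable section

namespace NonsmoothVariation

variable {n : ℕ}

/-! ### The gauge of a Wulff shape and its normal directions -/

/-! The volume is treated as a functional of positive functions h in C(Sⁿ), through the Wulff shape
of h. It is an integral over the sphere of the (n+1)-st power of the radial function, and
Aleksandrov's variational lemma (`hasDerivWithinAt_wvol`) differentiates it in every continuous
direction g. The derivative `firstVar h g` is jointly continuous in (h, g) (`tendsto_firstVar`) and
equals ∫ g dS_h when h is a support function (`integral_surfaceAreaMeasure`).

For smooth support functions `firstVar h g` is the integral of g det(D²h + u ⊗ u), so it is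
polynomial in s along h + s f. Written as Lagrange interpolation at finitely many nodes, this
survives uniform limits. The derivative `mixedVar h f g` of `firstVar` at h in the direction f is
therefore defined as a finite combination of values of `firstVar`, which makes it continuous without
any smoothness. For support functions it is symmetric in f and g, being a second derivative of the
volume (`mixedVar_comm`). Hence along a path h_t that is merely differentiable in the sup norm,
`firstVar h_t f` has derivative `mixedVar h_t f h_t'` whenever f is a support function
(`hasDerivWithinAt_firstVar`): symmetry puts the velocity, of which only continuity is known, into
the slot that accepts all continuous functions.

A plurisubharmonic function that depends only on the real part is convex. So a bounded, uniformly
quasi-plurisubharmonic family is uniformly semiconvex on the sphere (`exists_isSemiconvex`), and a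
large constant turns z, the square of z + C, and h (z + C) into support functions. The identity D²(f
g²) - 2 g D²(f g) + g² D²f = 2 f Dg ⊗ Dg, contracted with the cofactor matrix, then writes ∫ φ
U^{ij} z_i z_j dS in terms of `mixedVar` at support functions. This gives a weak limit independent
of the approximation, and Riesz representation turns it into a measure μ (`exists_gradMeasure`). The
same identity with f = h, together with symmetry, gives ∫ h² dμ = n ∫ z² h dS_h minus the second
variation of the volume in the direction h z.

The first derivative of F is explicit, and it is differentiated once more at 0. The first variation
is differentiated there by writing h₀' = h₀ z as a combination of support functions. The critical
point equation in the directions h z², h' and h'' replaces the integrals against 𝔪 by integrals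
against the surface area measure, and the h'' terms cancel. -/

instance : Nonempty (Sph n) := ⟨⟨EuclideanSpace.single 0 1, by simp⟩⟩

theorem norm_sph (u : Sph n) : ‖(u : Eucl n)‖ = 1 := by simp

theorem sph_ne_zero (u : Sph n) : (u : Eucl n) ≠ 0 := by
  intro h; have := norm_sph u; rw [h] at this; simp at this

/-- The gauge of the Wulff shape `{y | ∀ v, ⟨y, v⟩ ≤ h v}` of a positive function `h`. -/
def wgauge (h : C(Sph n, ℝ)) (x : Eucl n) : ℝ := ⨆ v : Sph n, inner ℝ x (v : Eucl n) / h v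

/-- An outer normal direction of the Wulff shape of `h` at the boundary point in direction `x`. -/
def normalDir (h : C(Sph n, ℝ)) (x : Eucl n) : Sph n :=
  Classical.epsilon fun v => ∀ w : Sph n,
    inner ℝ x (w : Eucl n) / h w ≤ inner ℝ x (v : Eucl n) / h v

section basics
variable {h : C(Sph n, ℝ)} (hh : ∀ v, 0 < h v)
include hh

theorem continuous_ratio (x : Eucl n) :
    Continuous fun v : Sph n => inner ℝ x (v : Eucl n) / h v :=
  (continuous_const.inner continuous_subtype_val).div h.continuous fun v => (hh v).ne'

theorem normalDir_spec (x : Eucl n) (w : Sph n) :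
    inner ℝ x (w : Eucl n) / h w ≤ inner ℝ x (normalDir h x : Eucl n) / h (normalDir h x) := by
  have : ∃ v : Sph n, ∀ w : Sph n,
      inner ℝ x (w : Eucl n) / h w ≤ inner ℝ x (v : Eucl n) / h v := by
    obtain ⟨v, -, hv⟩ := isCompact_univ.exists_isMaxOn Set.univ_nonempty
      (continuous_ratio hh x).continuousOn
    exact ⟨v, fun w => hv (Set.mem_univ w)⟩
  exact Classical.epsilon_spec this w

omit hh in
theorem wgauge_eq_of_isMax {x : Eucl n} {v : Sph n}
    (hv : ∀ w : Sph n, inner ℝ x (w : Eucl n) / h w ≤ inner ℝ x (v : Eucl n) / h v) :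
    wgauge h x = inner ℝ x (v : Eucl n) / h v :=
  le_antisymm (ciSup_le hv)
    (le_ciSup (f := fun v : Sph n => inner ℝ x (v : Eucl n) / h v)
      ⟨_, Set.forall_mem_range.2 hv⟩ v)

theorem wgauge_eq (x : Eucl n) :
    wgauge h x = inner ℝ x (normalDir h x : Eucl n) / h (normalDir h x) :=
  wgauge_eq_of_isMax (normalDir_spec hh x)

theorem le_wgauge (x : Eucl n) (v : Sph n) : inner ℝ x (v : Eucl n) / h v ≤ wgauge h x := by
  rw [wgauge_eq hh]; exact normalDir_spec hh x v

theorem wgauge_smul {t : ℝ} (ht : 0 ≤ t) (x : Eucl n) : wgauge h (t • x) = t * wgauge h x := by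
  rw [wgauge_eq hh x, wgauge_eq_of_isMax (v := normalDir h x)]
  · rw [inner_smul_left, mul_div_assoc]; rfl
  · intro w
    simp only [inner_smul_left, mul_div_assoc]
    exact mul_le_mul_of_nonneg_left (normalDir_spec hh x w) (by simpa using ht)

theorem wgauge_le_one_iff (x : Eucl n) :
    wgauge h x ≤ 1 ↔ ∀ v : Sph n, inner ℝ x (v : Eucl n) ≤ h v := by
  constructor
  · intro H v
    have := (le_wgauge hh x v).trans H
    rwa [div_le_one (hh v)] at this
  · intro H
    rw [wgauge_eq hh, div_le_one (hh _)]
    exact H _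

/-- Every maximizing direction v yields the subgradient v / h v of the gauge at x, because it
remains a competitor in the supremum at y. -/
theorem wgauge_sub_le_of_eq {x : Eucl n} {v : Sph n}
    (hv : inner ℝ x (v : Eucl n) / h v = wgauge h x) (y : Eucl n) :
    wgauge h x - wgauge h y ≤ inner ℝ (x - y) (v : Eucl n) / h v := by
  have := le_wgauge hh y v
  rw [← hv, inner_sub_left, sub_div]
  linarith

theorem wgauge_sub_le (x y : Eucl n) :
    wgauge h x - wgauge h y ≤ inner ℝ (x - y) (normalDir h x : Eucl n) / h (normalDir h x) :=
  wgauge_sub_le_of_eq hh (wgauge_eq hh x).symm y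

theorem exists_pos_le : ∃ c : ℝ, 0 < c ∧ ∀ v, c ≤ h v := by
  obtain ⟨v, -, hv⟩ := isCompact_univ.exists_isMinOn (Set.univ_nonempty (α := Sph n))
    h.continuous.continuousOn
  exact ⟨h v, hh v, fun w => hv (Set.mem_univ w)⟩

theorem norm_pos_of_pos : 0 < ‖h‖ := by
  obtain ⟨v⟩ := (inferInstance : Nonempty (Sph n))
  exact (hh v).trans_le ((le_abs_self _).trans (h.norm_coe_le_norm v))

theorem norm_div_le_wgauge (x : Eucl n) : ‖x‖ / ‖h‖ ≤ wgauge h x := by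
  by_cases hx : x = 0
  · have : wgauge h x = 0 := by rw [wgauge_eq hh, hx]; simp
    rw [this, hx]; simp
  · have hx' : 0 < ‖x‖ := norm_pos_iff.2 hx
    let v : Sph n := ⟨‖x‖⁻¹ • x, by simp [norm_smul, hx]⟩
    have h1 := le_wgauge hh x v
    have h2 : inner ℝ x (v : Eucl n) = ‖x‖ := by
      change inner ℝ x (‖x‖⁻¹ • x) = ‖x‖
      rw [inner_smul_right, real_inner_self_eq_norm_sq]; field_simp
    rw [h2] at h1
    refine le_trans ?_ h1
    exact div_le_div_of_nonneg_left hx'.le (hh v) ((le_abs_self _).trans (h.norm_coe_le_norm v))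

theorem wgauge_nonneg (x : Eucl n) : 0 ≤ wgauge h x :=
  le_trans (by positivity) (norm_div_le_wgauge hh x)

theorem wgauge_pos {x : Eucl n} (hx : x ≠ 0) : 0 < wgauge h x :=
  lt_of_lt_of_le (div_pos (norm_pos_iff.2 hx) (norm_pos_of_pos hh)) (norm_div_le_wgauge hh x)

theorem wgauge_sub_le_norm {c : ℝ} (hc : 0 < c) (hch : ∀ v, c ≤ h v) (x y : Eucl n) :
    wgauge h x - wgauge h y ≤ c⁻¹ * ‖x - y‖ := by
  refine (wgauge_sub_le hh x y).trans ?_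
  have h1 : inner ℝ (x - y) (normalDir h x : Eucl n) ≤ ‖x - y‖ := by
    have := real_inner_le_norm (x - y) (normalDir h x : Eucl n)
    rwa [norm_sph, mul_one] at this
  rw [inv_mul_eq_div]
  exact div_le_div₀ (norm_nonneg _) h1 hc (hch _)

theorem lipschitz_wgauge : ∃ C, LipschitzWith C (wgauge h) := by
  obtain ⟨c, hc, hch⟩ := exists_pos_le hh
  refine ⟨⟨c⁻¹, by positivity⟩, LipschitzWith.of_le_add_mul _ fun x y => ?_⟩
  have := wgauge_sub_le_norm hh hc hch x y
  rw [dist_eq_norm]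
  change wgauge h x ≤ wgauge h y + c⁻¹ * _
  linarith

theorem continuous_wgauge : Continuous (wgauge h) :=
  (lipschitz_wgauge hh).choose_spec.continuous

/-- Where the gauge is differentiable, its gradient determines the normal direction. -/
theorem eq_normalDir_of_differentiableAt {x : Eucl n} (hx : DifferentiableAt ℝ (wgauge h) x)
    {v : Sph n} (hv : inner ℝ x (v : Eucl n) / h v = wgauge h x) : v = normalDir h x := by
  have key : ∀ v : Sph n, inner ℝ x (v : Eucl n) / h v = wgauge h x →
      ∀ y, fderiv ℝ (wgauge h) x y = inner ℝ y (v : Eucl n) / h v := by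
    intro v hv y
    -- The difference between the gauge and the linear function ⟨·, v⟩ / h v is nonnegative and
    -- vanishes at x, so its differential there is zero.
    have hmin : IsLocalMin (fun y => wgauge h y - inner ℝ y ((h v)⁻¹ • (v : Eucl n))) x := by
      refine Filter.Eventually.of_forall fun y => ?_
      simp only [inner_smul_right, inv_mul_eq_div, hv, sub_self]
      exact sub_nonneg.2 (le_wgauge hh y v)
    have hd : HasFDerivAt (fun y : Eucl n => inner ℝ y ((h v)⁻¹ • (v : Eucl n)))
        (innerSL ℝ ((h v)⁻¹ • (v : Eucl n))) x := by
      have := (innerSL ℝ ((h v)⁻¹ • (v : Eucl n))).hasFDerivAt (x := x)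
      refine this.congr_of_eventuallyEq (Filter.Eventually.of_forall fun y => ?_)
      exact real_inner_comm _ _
    have h0 := hmin.hasFDerivAt_eq_zero (hx.hasFDerivAt.sub hd)
    have h1 := congrArg (fun L => L y) h0
    simp only [_root_.sub_apply, innerSL_apply_apply, _root_.zero_apply,
      inner_smul_left, sub_eq_zero] at h1
    rw [h1, real_inner_comm, div_eq_inv_mul]; rfl
  have k1 := key v hv
  have k2 := key (normalDir h x) (wgauge_eq hh x).symm
  have h3 : (h v)⁻¹ • (v : Eucl n) = (h (normalDir h x))⁻¹ • (normalDir h x : Eucl n) := by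
    refine ext_inner_left ℝ fun y => ?_
    rw [inner_smul_right, inner_smul_right, inv_mul_eq_div, inv_mul_eq_div, ← k1, ← k2]
  have h4 : (h v)⁻¹ = (h (normalDir h x))⁻¹ := by
    have := congrArg norm h3
    rwa [norm_smul, norm_smul, norm_sph, norm_sph, mul_one, mul_one, Real.norm_of_nonneg,
      Real.norm_of_nonneg] at this
    · exact (inv_pos.2 (hh _)).le
    · exact (inv_pos.2 (hh _)).le
  rw [h4] at h3
  exact Subtype.ext (smul_right_injective _ (inv_pos.2 (hh _)).ne' h3)

end basics

/-- In polar coordinates Lebesgue measure is a product, so by Fubini almost every ray carries a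
point where p holds, and `hs` moves it along the ray to the sphere. -/
theorem ae_sphere_of_ae {p : Eucl n → Prop} (hp : ∀ᵐ x, p x)
    (hs : ∀ t : ℝ, 0 < t → ∀ x, p (t • x) → p x) :
    ∀ᵐ u : Sph n ∂((volume : Measure (Eucl n)).toSphere), p u := by
  have h1 : ∀ᵐ x : ({0}ᶜ : Set (Eucl n)) ∂((volume : Measure (Eucl n)).comap (↑)), p x :=
    (MeasurableEmbedding.subtype_coe (measurableSet_singleton _).compl).ae_map_iff.1
      (by
        rw [(MeasurableEmbedding.subtype_coe (measurableSet_singleton _).compl).map_comap]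
        exact ae_restrict_of_ae hp)
  have mp := (volume : Measure (Eucl n)).measurePreserving_homeomorphUnitSphereProd
  have h2 := (mp.symm (homeomorphUnitSphereProd (Eucl n)).toMeasurableEquiv).quasiMeasurePreserving.ae
    h1
  have h3 := Measure.ae_ae_of_ae_prod h2
  filter_upwards [h3] with u hu
  have : (ae (Measure.volumeIoiPow (Module.finrank ℝ (Eucl n) - 1))).NeBot := by
    rw [ae_neBot]
    intro h0
    have := Measure.volumeIoiPow_apply_Iio (Module.finrank ℝ (Eucl n) - 1) ⟨1, Set.mem_Ioi.2 one_pos⟩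
    rw [h0] at this
    simp only [Measure.coe_zero, Pi.zero_apply, one_pow] at this
    have h5 := ENNReal.ofReal_eq_zero.1 this.symm
    have : (0:ℝ) < 1 / (((Module.finrank ℝ (Eucl n) - 1 : ℕ) : ℝ) + 1) := by positivity
    linarith
  obtain ⟨r, hr⟩ := hu.exists
  exact hs r r.2 u hr

theorem differentiableAt_wgauge_smul {h : C(Sph n, ℝ)} (hh : ∀ v, 0 < h v) (t : ℝ) (ht : 0 < t)
    (x : Eucl n) (hx : DifferentiableAt ℝ (wgauge h) (t • x)) :
    DifferentiableAt ℝ (wgauge h) x := by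
  have : wgauge h = fun x => t⁻¹ * wgauge h (t • x) := by
    funext x
    rw [wgauge_smul hh ht.le]; field_simp
  rw [this]
  refine DifferentiableAt.const_mul ?_ _
  exact DifferentiableAt.comp (g := wgauge h) (f := fun x => t • x) x hx
    (differentiableAt_id.const_smul t)

theorem ae_differentiableAt_wgauge {h : C(Sph n, ℝ)} (hh : ∀ v, 0 < h v) :
    ∀ᵐ u : Sph n ∂((volume : Measure (Eucl n)).toSphere), DifferentiableAt ℝ (wgauge h) u :=
  ae_sphere_of_ae (lipschitz_wgauge hh).choose_spec.ae_differentiableAt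
    (differentiableAt_wgauge_smul hh)

/-- A closed graph argument: cluster points of maximizers are maximizers of the limit problem, and
on the compact sphere a unique possible cluster point is a limit. -/
theorem tendsto_normalDir {ι : Type*} {l : Filter ι} {hs : ι → C(Sph n, ℝ)} {h : C(Sph n, ℝ)}
    (hh : ∀ v, 0 < h v) (hpos : ∀ᶠ i in l, ∀ v, 0 < hs i v) (H : Tendsto hs l (𝓝 h))
    {xs : ι → Eucl n} {x : Eucl n} (hx : Tendsto xs l (𝓝 x))
    (hu : ∀ v : Sph n, inner ℝ x (v : Eucl n) / h v = wgauge h x → v = normalDir h x) :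
    Tendsto (fun i => normalDir (hs i) (xs i)) l (𝓝 (normalDir h x)) := by
  refine tendsto_nhds_of_unique_mapClusterPt fun y hy => ?_
  refine hu y (wgauge_eq_of_isMax fun w => ?_).symm
  obtain ⟨U, hU, hUy⟩ := mapClusterPt_iff_ultrafilter.1 hy
  have HU := H.mono_left hU
  have xU := hx.mono_left hU
  have ev : ∀ {v : ι → Sph n} {y}, Tendsto v U (𝓝 y) →
      Tendsto (fun i => inner ℝ (xs i) (v i : Eucl n) / hs i (v i)) U
        (𝓝 (inner ℝ x (y : Eucl n) / h y)) := by
    intro v y hv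
    refine Tendsto.div ?_ ?_ (hh y).ne'
    · exact xU.inner ((continuous_subtype_val.tendsto y).comp hv)
    · exact (continuous_eval.tendsto (h, y)).comp (HU.prodMk_nhds hv)
  refine le_of_tendsto_of_tendsto (ev tendsto_const_nhds) (ev hUy) ?_
  filter_upwards [hU hpos] with i hi
  exact normalDir_spec hi (xs i) w

/-- A choice function has no measurability for free. On the measurable set where the gauge is
differentiable the normal is unique, hence continuous, and this set has full measure by Rademacher's
theorem. -/
theorem aemeasurable_normalDir {h : C(Sph n, ℝ)} (hh : ∀ v, 0 < h v) :
    AEMeasurable (fun u : Sph n => normalDir h u) ((volume : Measure (Eucl n)).toSphere) := by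
  set D : Set (Sph n) := {u | DifferentiableAt ℝ (wgauge h) u} with hD
  have hDm : MeasurableSet D :=
    (measurableSet_of_differentiableAt ℝ (wgauge h)).preimage measurable_subtype_coe
  have hc : ContinuousOn (fun u : Sph n => normalDir h u) D := by
    intro u hu
    exact tendsto_normalDir hh (Filter.Eventually.of_forall fun _ => hh) tendsto_const_nhds
      ((continuous_subtype_val.tendsto u).mono_left nhdsWithin_le_nhds)
      fun _ => eq_normalDir_of_differentiableAt hh hu
  have := hc.aemeasurable hDm (μ := (volume : Measure (Eucl n)).toSphere)
  rwa [Measure.restrict_eq_self_of_ae_mem (s := D) (ae_differentiableAt_wgauge hh)] at this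

/-! ### The first variation of the volume of a Wulff shape -/

/-- The volume of the Wulff shape of `h`. -/
def wvol (h : C(Sph n, ℝ)) : ℝ :=
  ((n : ℝ) + 1)⁻¹ * ∫ u : Sph n, (wgauge h u)⁻¹ ^ (n + 1) ∂((volume : Measure (Eucl n)).toSphere)

/-- The first variation of the volume of the Wulff shape of `h` in the direction `g`. -/
def firstVar (h g : C(Sph n, ℝ)) : ℝ :=
  ∫ u : Sph n, (wgauge h u)⁻¹ ^ (n + 1) * (g (normalDir h u) / h (normalDir h u))
    ∂((volume : Measure (Eucl n)).toSphere)

theorem eventually_pos {ι : Type*} {l : Filter ι} {hs : ι → C(Sph n, ℝ)} {h : C(Sph n, ℝ)}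
    (H : Tendsto hs l (𝓝 h)) {c : ℝ} (hc : ∀ v, c < h v) : ∀ᶠ i in l, ∀ v, c < hs i v := by
  obtain ⟨d, hd, hdh⟩ := exists_pos_le (h := h - ContinuousMap.const _ c) (by simpa using hc)
  have := (Metric.tendsto_nhds.1 H) d hd
  filter_upwards [this] with i hi v
  have h1 := (ContinuousMap.dist_apply_le_dist (f := hs i) (g := h) v).trans_lt hi
  have h2 := hdh v
  simp only [ContinuousMap.sub_apply, ContinuousMap.const_apply] at h2
  rw [Real.dist_eq, abs_lt] at h1
  linarith

section
variable {h : C(Sph n, ℝ)} (hh : ∀ v, 0 < h v)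
include hh

theorem wgauge_inv_pow_le (u : Sph n) : (wgauge h u)⁻¹ ^ (n + 1) ≤ ‖h‖ ^ (n + 1) := by
  have h1 := norm_div_le_wgauge hh (u : Eucl n)
  rw [norm_sph] at h1
  refine pow_le_pow_left₀ (inv_nonneg.2 (wgauge_nonneg hh _)) ?_ _
  rw [inv_le_comm₀ (wgauge_pos hh (sph_ne_zero u)) (norm_pos_of_pos hh)]
  simpa using h1

theorem continuous_wgauge_inv_pow : Continuous fun u : Sph n => (wgauge h u)⁻¹ ^ (n + 1) :=
  (((continuous_wgauge hh).comp continuous_subtype_val).inv₀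
    fun u => (wgauge_pos hh (sph_ne_zero u)).ne').pow _

theorem aestronglyMeasurable_firstVar (g : C(Sph n, ℝ)) :
    AEStronglyMeasurable (fun u : Sph n => (wgauge h u)⁻¹ ^ (n + 1) *
      (g (normalDir h u) / h (normalDir h u))) ((volume : Measure (Eucl n)).toSphere) := by
  refine (continuous_wgauge_inv_pow hh).aestronglyMeasurable.mul ?_
  have : Continuous fun v => g v / h v := g.continuous.div h.continuous fun v => (hh v).ne'
  exact (this.measurable.comp_aemeasurable (aemeasurable_normalDir hh)).aestronglyMeasurable

theorem norm_firstVar_integrand_le {c C G : ℝ} (hc : 0 < c) (hch : ∀ v, c ≤ h v) (hC : ‖h‖ ≤ C)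
    {g : C(Sph n, ℝ)} (hG : ‖g‖ ≤ G) (u : Sph n) :
    ‖(wgauge h u)⁻¹ ^ (n + 1) * (g (normalDir h u) / h (normalDir h u))‖
      ≤ C ^ (n + 1) * (G / c) := by
  have h0 : 0 ≤ (wgauge h (u : Eucl n))⁻¹ ^ (n + 1) := by
    have := wgauge_nonneg hh (u : Eucl n); positivity
  rw [norm_mul, norm_div, Real.norm_of_nonneg h0, Real.norm_of_nonneg (hh _).le]
  refine mul_le_mul ?_ ?_ (by have := (hh (normalDir h u)).le; positivity)
    (by have := (norm_nonneg h).trans hC; positivity)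
  · exact (wgauge_inv_pow_le hh u).trans (pow_le_pow_left₀ (norm_nonneg _) hC _)
  · exact div_le_div₀ ((norm_nonneg _).trans hG) ((g.norm_coe_le_norm _).trans hG) hc (hch _)

theorem integrable_firstVar (g : C(Sph n, ℝ)) :
    Integrable (fun u : Sph n => (wgauge h u)⁻¹ ^ (n + 1) *
      (g (normalDir h u) / h (normalDir h u))) ((volume : Measure (Eucl n)).toSphere) := by
  obtain ⟨c, hc, hch⟩ := exists_pos_le hh
  exact Integrable.of_bound (aestronglyMeasurable_firstVar hh g) _
    (Filter.Eventually.of_forall (norm_firstVar_integrand_le hh hc hch le_rfl le_rfl))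

theorem firstVar_add (f g : C(Sph n, ℝ)) : firstVar h (f + g) = firstVar h f + firstVar h g := by
  rw [firstVar, firstVar, firstVar, ← integral_add (integrable_firstVar hh f)
    (integrable_firstVar hh g)]
  congr 1; funext u
  simp only [ContinuousMap.add_apply]; ring

theorem firstVar_self : firstVar h h = ((n : ℝ) + 1) * wvol h := by
  rw [firstVar, wvol, ← mul_assoc, mul_inv_cancel₀ (by positivity), one_mul]
  congr 1; funext u
  rw [div_self (hh _).ne', mul_one]

theorem wvol_pos : 0 < wvol h := by
  refine mul_pos (by positivity) ?_
  refine (integral_pos_iff_support_of_nonneg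
    (fun u => pow_nonneg (inv_nonneg.2 (wgauge_nonneg hh _)) _) ?_).2 ?_
  · exact Integrable.of_bound (continuous_wgauge_inv_pow hh).aestronglyMeasurable (‖h‖ ^ (n + 1))
      (Filter.Eventually.of_forall fun u => by
        rw [Real.norm_of_nonneg (pow_nonneg (inv_nonneg.2 (wgauge_nonneg hh _)) _)]
        exact wgauge_inv_pow_le hh u)
  · have : Function.support (fun u : Sph n => (wgauge h u)⁻¹ ^ (n + 1)) = Set.univ := by
      refine Set.eq_univ_of_forall fun u => ?_
      exact (pow_pos (inv_pos.2 (wgauge_pos hh (sph_ne_zero u))) _).ne'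
    rw [this]
    exact Measure.measure_univ_pos.2 (Measure.toSphere_ne_zero _)

end

theorem firstVar_smul (h : C(Sph n, ℝ)) (c : ℝ) (g : C(Sph n, ℝ)) :
    firstVar h (c • g) = c * firstVar h g := by
  rw [firstVar, firstVar, ← integral_const_mul]
  congr 1; funext u
  simp only [ContinuousMap.smul_apply, smul_eq_mul]; ring

/-- For support functions this is weak continuity of the surface area measure, with varying test
functions. The integrands converge wherever the limit gauge is differentiable, and a positive lower
bound of h dominates them. -/
theorem tendsto_firstVar {ι : Type*} {l : Filter ι} [l.IsCountablyGenerated]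
    {hs gs : ι → C(Sph n, ℝ)} {h g : C(Sph n, ℝ)} (hh : ∀ v, 0 < h v)
    (H : Tendsto hs l (𝓝 h)) (G : Tendsto gs l (𝓝 g)) :
    Tendsto (fun i => firstVar (hs i) (gs i)) l (𝓝 (firstVar h g)) := by
  obtain ⟨c, hc, hch⟩ := exists_pos_le hh
  have e1 : ∀ᶠ i in l, ∀ v, c / 2 < hs i v :=
    eventually_pos H fun v => (half_lt_self hc).trans_le (hch v)
  have e1' : ∀ᶠ i in l, ∀ v, 0 < hs i v := e1.mono fun i hi v => (half_pos hc).trans (hi v)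
  have e2 : ∀ᶠ i in l, ‖hs i‖ ≤ ‖h‖ + 1 :=
    (H.norm.eventually (eventually_lt_nhds (lt_add_one _))).mono fun i hi => hi.le
  have e3 : ∀ᶠ i in l, ‖gs i‖ ≤ ‖g‖ + 1 :=
    (G.norm.eventually (eventually_lt_nhds (lt_add_one _))).mono fun i hi => hi.le
  refine tendsto_integral_filter_of_dominated_convergence
    (fun _ => (‖h‖ + 1) ^ (n + 1) * ((‖g‖ + 1) / (c / 2))) ?_ ?_ (integrable_const _) ?_
  · filter_upwards [e1'] with i hi using aestronglyMeasurable_firstVar hi (gs i)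
  · filter_upwards [e1, e1', e2, e3] with i h1 h1' h2 h3
    exact Filter.Eventually.of_forall
      (norm_firstVar_integrand_le h1' (half_pos hc) (fun v => (h1 v).le) h2 h3)
  · filter_upwards [ae_differentiableAt_wgauge hh] with u hu
    have hN := tendsto_normalDir hh e1' H tendsto_const_nhds
      fun _ => eq_normalDir_of_differentiableAt hh hu
    have hH := (continuous_eval.tendsto (h, _)).comp (H.prodMk_nhds hN)
    have hG := (continuous_eval.tendsto (g, _)).comp (G.prodMk_nhds hN)
    refine Tendsto.mul ?_ (hG.div hH (hh _).ne')
    refine Tendsto.pow (Tendsto.inv₀ ?_ (wgauge_pos hh (sph_ne_zero u)).ne') _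
    -- The gauge is evaluated at its own maximizer, so its convergence follows from that of the
    -- normals.
    rw [wgauge_eq hh]
    refine Tendsto.congr' (f₁ := fun i => inner ℝ (u : Eucl n) (normalDir (hs i) u : Eucl n) /
      hs i (normalDir (hs i) u)) ?_ ?_
    · filter_upwards [e1'] with i hi using (wgauge_eq hi _).symm
    · exact (tendsto_const_nhds.inner ((continuous_subtype_val.tendsto _).comp hN)).div hH
        (hh _).ne'

/-! ### Polar coordinates -/

/-- The direction `x / ‖x‖` of a vector (and an irrelevant value at the origin). -/
def dir (x : Eucl n) : Sph n :=
  ⟨if x = 0 then EuclideanSpace.single 0 1 else ‖x‖⁻¹ • x, by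
    split_ifs with hx
    · simp
    · simp [norm_smul, hx]⟩

theorem coe_dir {x : Eucl n} (hx : x ≠ 0) : (dir x : Eucl n) = ‖x‖⁻¹ • x := by
  simp [dir, hx]

theorem measurable_dir : Measurable (dir : Eucl n → Sph n) := by
  refine Measurable.subtype_mk ?_
  exact Measurable.ite (measurableSet_singleton 0) measurable_const
    (measurable_norm.inv.smul measurable_id)

theorem dir_smul {r : ℝ} (hr : 0 < r) (u : Sph n) : dir (r • (u : Eucl n)) = u := by
  have h0 : r • (u : Eucl n) ≠ 0 := smul_ne_zero hr.ne' (sph_ne_zero u)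
  refine Subtype.ext ?_
  rw [coe_dir h0, norm_smul, norm_sph, mul_one, Real.norm_of_nonneg hr.le, smul_smul,
    inv_mul_cancel₀ hr.ne', one_smul]

theorem dir_smul_pos {r : ℝ} (hr : 0 < r) {x : Eucl n} (hx : x ≠ 0) : dir (r • x) = dir x := by
  have h2 : r • x = (r * ‖x‖) • (dir x : Eucl n) := by
    rw [coe_dir hx, smul_smul, mul_assoc, mul_inv_cancel₀ (norm_ne_zero_iff.2 hx), mul_one]
  rw [h2, dir_smul (mul_pos hr (norm_pos_iff.2 hx))]

theorem norm_smul_dir (x : Eucl n) : ‖x‖ • (dir x : Eucl n) = x := by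
  by_cases hx : x = 0
  · simp [hx]
  · rw [coe_dir hx, smul_smul, mul_inv_cancel₀ (norm_ne_zero_iff.2 hx), one_smul]

theorem volume_eq_lintegral_polar {s : Set (Eucl n)} (hs : MeasurableSet s) :
    volume s = ∫⁻ u : Sph n, Measure.volumeIoiPow n {r | (r : ℝ) • (u : Eucl n) ∈ s}
      ∂((volume : Measure (Eucl n)).toSphere) := by
  have mp := (volume : Measure (Eucl n)).measurePreserving_homeomorphUnitSphereProd
  have mps := mp.symm (homeomorphUnitSphereProd (Eucl n)).toMeasurableEquiv
  have h1 : volume s = ((volume : Measure (Eucl n)).comap (Subtype.val : ({0}ᶜ : Set (Eucl n)) → Eucl n))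
      (Subtype.val ⁻¹' s) := by
    rw [(MeasurableEmbedding.subtype_coe (measurableSet_singleton _).compl).comap_apply,
      Subtype.image_preimage_coe, Set.inter_comm, ← Set.sdiff_eq,
      measure_sdiff_null (measure_singleton _)]
  have hm : MeasurableSet ((Subtype.val : ({0}ᶜ : Set (Eucl n)) → Eucl n) ⁻¹' s) :=
    hs.preimage measurable_subtype_coe
  rw [h1, ← mps.measure_preimage hm.nullMeasurableSet,
    Measure.prod_apply (hm.preimage mps.measurable)]
  have : Module.finrank ℝ (Eucl n) - 1 = n := by simp
  rw [this]
  rfl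

theorem volumeIoiPow_Iic (m : ℕ) (x : Set.Ioi (0 : ℝ)) :
    Measure.volumeIoiPow m (Set.Iic x) = ENNReal.ofReal (x.1 ^ (m + 1) / (m + 1)) := by
  have h0 : Measure.volumeIoiPow m {x} = 0 := by
    refine withDensity_absolutelyContinuous _ _ ?_
    rw [(MeasurableEmbedding.subtype_coe measurableSet_Ioi).comap_apply, Set.image_singleton]
    exact measure_singleton _
  rw [← Measure.volumeIoiPow_apply_Iio, ← Set.Iio_union_right]
  exact measure_congr (union_ae_eq_left_of_ae_eq_empty (ae_eq_empty.2 h0))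

/-- The ray in direction u meets the Wulff shape in radii up to the reciprocal of the gauge, and
integrating rⁿ dr there gives the density. -/
theorem map_dir_restrict {h : C(Sph n, ℝ)} (hh : ∀ v, 0 < h v) :
    ((volume : Measure (Eucl n)).restrict {x | wgauge h x ≤ 1}).map dir =
      ((volume : Measure (Eucl n)).toSphere).withDensity
        fun u => ENNReal.ofReal ((wgauge h u)⁻¹ ^ (n + 1) / (n + 1)) := by
  have hC : MeasurableSet {x | wgauge h x ≤ 1} :=
    (isClosed_le (continuous_wgauge hh) continuous_const).measurableSet
  refine Measure.ext fun D hω => ?_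
  rw [Measure.map_apply measurable_dir hω, Measure.restrict_apply (measurable_dir hω),
    volume_eq_lintegral_polar ((measurable_dir hω).inter hC), withDensity_apply _ hω,
    ← lintegral_indicator hω]
  refine lintegral_congr fun u => ?_
  have hg : 0 < wgauge h (u : Eucl n) := wgauge_pos hh (sph_ne_zero u)
  by_cases hu : u ∈ D
  · rw [Set.indicator_of_mem hu, ← volumeIoiPow_Iic n ⟨(wgauge h u)⁻¹, inv_pos.2 hg⟩]
    congr 1
    ext ⟨r, hr : 0 < r⟩
    simp only [Set.mem_ofPred_eq, Set.mem_inter_iff, Set.mem_preimage, dir_smul hr, hu, true_and,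
      Set.mem_Iic, wgauge_smul hh hr.le]
    rw [← le_div_iff₀ hg, one_div]
    rfl
  · rw [Set.indicator_of_notMem hu]
    convert measure_empty (μ := Measure.volumeIoiPow n)
    ext ⟨r, hr : 0 < r⟩
    simp [dir_smul hr, hu]

theorem integral_dir {h : C(Sph n, ℝ)} (hh : ∀ v, 0 < h v) {f : Sph n → ℝ}
    (hf : AEStronglyMeasurable f ((volume : Measure (Eucl n)).toSphere)) :
    ∫ x in {x : Eucl n | wgauge h x ≤ 1}, f (dir x) =
      ((n : ℝ) + 1)⁻¹ * ∫ u, (wgauge h u)⁻¹ ^ (n + 1) * f u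
        ∂((volume : Measure (Eucl n)).toSphere) := by
  have hmap := map_dir_restrict hh
  have hf' : AEStronglyMeasurable f
      (((volume : Measure (Eucl n)).restrict {x | wgauge h x ≤ 1}).map dir) := by
    rw [hmap]; exact hf.mono_ac (withDensity_absolutelyContinuous _ _)
  rw [← integral_map measurable_dir.aemeasurable hf', hmap,
    integral_withDensity_eq_integral_toReal_smul, ← integral_const_mul]
  · refine integral_congr_ae (Filter.Eventually.of_forall fun u => ?_)
    have hg : 0 < wgauge h (u : Eucl n) := wgauge_pos hh (sph_ne_zero u)
    simp only [smul_eq_mul]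
    rw [ENNReal.toReal_ofReal (by positivity)]
    field_simp
  · exact (((continuous_wgauge_inv_pow hh).div_const _).measurable).ennreal_ofReal
  · exact Filter.Eventually.of_forall fun u => ENNReal.ofReal_lt_top

/-! ### Convex bodies with the origin in the interior -/

theorem inner_le_supportFn (K : ConvexBody (Eucl n)) {y : Eucl n} (hy : y ∈ K) (x : Eucl n) :
    inner ℝ x y ≤ supportFn K x :=
  le_csSup ((K.isCompact.image (continuous_const.inner continuous_id)).bddAbove)
    (Set.mem_image_of_mem _ hy)

theorem exists_eq_supportFn (K : ConvexBody (Eucl n)) (x : Eucl n) :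
    ∃ y ∈ K, inner ℝ x y = supportFn K x :=
  (K.isCompact.image (continuous_const.inner continuous_id)).sSup_mem
    (K.nonempty.image _)

theorem supportFn_le {K : ConvexBody (Eucl n)} {x : Eucl n} {c : ℝ}
    (h : ∀ y ∈ K, inner ℝ x y ≤ c) : supportFn K x ≤ c := by
  obtain ⟨y, hy, h1⟩ := exists_eq_supportFn K x
  exact h1 ▸ h y hy

theorem supportFn_smul (K : ConvexBody (Eucl n)) {t : ℝ} (ht : 0 ≤ t) (x : Eucl n) :
    supportFn K (t • x) = t * supportFn K x := by
  refine le_antisymm (supportFn_le fun y hy => ?_) ?_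
  · rw [inner_smul_left]
    exact mul_le_mul_of_nonneg_left (inner_le_supportFn K hy x) ht
  · obtain ⟨y, hy, h1⟩ := exists_eq_supportFn K x
    have := inner_le_supportFn K hy (t • x)
    rw [inner_smul_left, h1] at this
    exact this

theorem supportFn_eq (K : ConvexBody (Eucl n)) (x : Eucl n) :
    supportFn K x = ‖x‖ * supportMap K (dir x) := by
  conv_lhs => rw [← norm_smul_dir x]
  rw [supportFn_smul K (norm_nonneg x)]; rfl

theorem mem_iff_forall_inner_le (K : ConvexBody (Eucl n)) (x : Eucl n) :
    x ∈ K ↔ ∀ v : Sph n, inner ℝ x (v : Eucl n) ≤ supportMap K v := by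
  constructor
  · intro hx v
    rw [real_inner_comm]
    exact inner_le_supportFn K hx v
  · intro H
    by_contra hx
    obtain ⟨f, s, hf1, hf2⟩ := geometric_hahn_banach_closed_point K.convex K.isClosed hx
    set p : Eucl n := (InnerProductSpace.toDual ℝ (Eucl n)).symm f with hp
    have hfp : ∀ y, f y = inner ℝ p y := fun y => by
      rw [hp, InnerProductSpace.toDual_symm_apply]
    have hle : inner ℝ p x ≤ supportFn K p := by
      have h1 := H (dir p)
      rw [supportFn_eq]
      have h2 : inner ℝ p x = ‖p‖ * inner ℝ x (dir p : Eucl n) := by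
        conv_lhs => rw [← norm_smul_dir p]
        rw [inner_smul_left, real_inner_comm]; rfl
      rw [h2]
      exact mul_le_mul_of_nonneg_left h1 (norm_nonneg _)
    obtain ⟨y, hy, h1⟩ := exists_eq_supportFn K p
    have h2 := hf1 y hy
    rw [hfp] at h2 hf2
    linarith

theorem coe_eq_wgauge {K : ConvexBody (Eucl n)} (hK : ∀ v, 0 < supportMap K v) :
    (K : Set (Eucl n)) = {x | wgauge (supportMap K) x ≤ 1} := by
  ext x
  rw [Set.mem_ofPred_eq, wgauge_le_one_iff hK]
  exact mem_iff_forall_inner_le K x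

theorem vol_eq_wvol {K : ConvexBody (Eucl n)} (hK : ∀ v, 0 < supportMap K v) :
    vol K = wvol (supportMap K) := by
  have h1 := integral_dir hK (f := fun _ => 1) aestronglyMeasurable_const
  rw [vol, coe_eq_wgauge hK, wvol]
  simp only [mul_one, integral_const, smul_eq_mul] at h1
  rw [← h1]
  simp [Measure.real]

/-! ### Aleksandrov's variational lemma -/

theorem coe_ringInverse {h : C(Sph n, ℝ)} (hh : ∀ v, 0 < h v) (v : Sph n) :
    Ring.inverse h v = (h v)⁻¹ := by
  have hu : IsUnit h := (ContinuousMap.isUnit_iff_forall_ne_zero _).2 fun v => (hh v).ne'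
  have := congrArg (fun f : C(Sph n, ℝ) => f v) (Ring.mul_inverse_cancel h hu)
  simp only [ContinuousMap.mul_apply, ContinuousMap.one_apply] at this
  exact eq_inv_of_mul_eq_one_right this

/-- The normal v of the shape of h at u is only a competitor in the supremum for the gauge of l, so
the radial function of l is at most l v / h v times that of h. Take powers and integrate.
`Ring.inverse` keeps the test function in C(Sⁿ), where it can be differentiated in the sup norm. -/
theorem wvol_sub_le {h l : C(Sph n, ℝ)} (hh : ∀ v, 0 < h v) (hl : ∀ v, 0 < l v) :
    wvol l - wvol h ≤ ((n : ℝ) + 1)⁻¹ *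
      firstVar h (h * ((l * Ring.inverse h) ^ (n + 1) - 1)) := by
  have I : ∀ {h : C(Sph n, ℝ)}, (∀ v, 0 < h v) → Integrable (fun u : Sph n =>
      (wgauge h u)⁻¹ ^ (n + 1)) ((volume : Measure (Eucl n)).toSphere) := fun {h} hh =>
    (integrable_firstVar hh h).congr (Filter.Eventually.of_forall fun u => by
      simp only []
      rw [div_self (hh _).ne', mul_one])
  rw [wvol, wvol, ← mul_sub, ← integral_sub (I hl) (I hh)]
  refine mul_le_mul_of_nonneg_left ?_ (by positivity)
  refine integral_mono ((I hl).sub (I hh)) (integrable_firstVar hh _) fun u => ?_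
  set v := normalDir h (u : Eucl n) with hv
  have g1 : 0 < wgauge h (u : Eucl n) := wgauge_pos hh (sph_ne_zero u)
  have g2 : 0 < wgauge l (u : Eucl n) := wgauge_pos hl (sph_ne_zero u)
  have e1 : wgauge h (u : Eucl n) * h v = inner ℝ (u : Eucl n) (v : Eucl n) := by
    rw [wgauge_eq hh, div_mul_cancel₀ _ (hh _).ne']
  have e2 : wgauge h (u : Eucl n) * h v ≤ wgauge l (u : Eucl n) * l v := by
    have := le_wgauge hl (u : Eucl n) v
    rwa [div_le_iff₀ (hl v), ← e1] at this
  have e3 : (wgauge l (u : Eucl n))⁻¹ ≤ (wgauge h (u : Eucl n))⁻¹ * (l v * (h v)⁻¹) := by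
    rw [← div_eq_mul_inv, ← div_eq_inv_mul, div_div, inv_le_iff_one_le_mul₀ g2, mul_comm,
      ← mul_div_assoc, one_le_div (mul_pos (hh v) g1)]
    linarith
  have e4 := pow_le_pow_left₀ (inv_pos.2 g2).le e3 (n + 1)
  simp only [ContinuousMap.mul_apply, ContinuousMap.sub_apply, ContinuousMap.pow_apply,
    ContinuousMap.one_apply, coe_ringInverse hh]
  rw [mul_div_cancel_left₀ _ (hh v).ne', mul_sub, mul_one, ← mul_pow]
  linarith

/-- Aleksandrov's lemma; H need not consist of support functions. `wvol_sub_le` and its version with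
exchanged roles enclose the difference quotient of the volume between values of `firstVar` at H t
and at H τ, and continuity of `firstVar` gives both the same limit. -/
theorem hasDerivWithinAt_wvol {H : ℝ → C(Sph n, ℝ)} {H' : C(Sph n, ℝ)} {s : Set ℝ} {t : ℝ}
    (hd : HasDerivWithinAt H H' s t) (hpos : ∀ v, 0 < H t v) :
    HasDerivWithinAt (fun τ => wvol (H τ)) (firstVar (H t) H') s t := by
  have hu : IsUnit (H t) := (ContinuousMap.isUnit_iff_forall_ne_zero _).2 fun v => (hpos v).ne'
  have hinv : H t * Ring.inverse (H t) = 1 := Ring.mul_inverse_cancel _ hu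
  have hN : ((n : ℝ) + 1) ≠ 0 := by positivity
  have tH : Tendsto H (𝓝[s \ {t}] t) (𝓝 (H t)) :=
    hd.continuousWithinAt.mono_left (nhdsWithin_mono _ Set.sdiff_subset)
  have ev : ∀ᶠ τ in 𝓝[s \ {t}] t, ∀ v, 0 < H τ v := eventually_pos tH hpos
  have scal : ((n : ℝ) + 1) • H' = ((n + 1 : ℕ) : C(Sph n, ℝ)) * H' := by
    ext v; simp
  have du : HasDerivWithinAt (fun τ => H t * ((H τ * Ring.inverse (H t)) ^ (n + 1) - 1))
      (((n : ℝ) + 1) • H') s t := by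
    have := (((hd.mul_const (Ring.inverse (H t))).pow (n + 1)).sub_const 1).const_mul (H t)
    refine this.congr_deriv ?_
    rw [hinv, one_pow, mul_one, scal]
    linear_combination (((n + 1 : ℕ) : C(Sph n, ℝ)) * H') * hinv
  have dl : HasDerivWithinAt (fun τ => H τ * ((H t * Ring.inverse (H τ)) ^ (n + 1) - 1))
      (-(((n : ℝ) + 1) • H')) s t := by
    obtain ⟨U, hU⟩ := hu
    have d1 : HasDerivWithinAt (fun τ => Ring.inverse (H τ)) _ s t :=
      HasFDerivAt.comp_hasDerivWithinAt t (l := Ring.inverse) (hU ▸ hasFDerivAt_ringInverse U) hd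
    have := hd.mul (((d1.const_mul (H t)).pow (n + 1)).sub_const 1)
    refine this.congr_deriv ?_
    have hU' : ((U⁻¹ : (C(Sph n, ℝ))ˣ) : C(Sph n, ℝ)) = Ring.inverse (H t) := by
      rw [← hU, Ring.inverse_unit]
    simp only [_root_.neg_apply, ContinuousLinearMap.mulLeftRight_apply, hU',
      Pi.pow_apply, hinv, one_pow, sub_self, scal]
    linear_combination (-((n + 1 : ℕ) : C(Sph n, ℝ)) * H' * (H t * Ring.inverse (H t) + 1)) * hinv
  rw [hasDerivWithinAt_iff_tendsto_slope] at du dl ⊢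
  set a : ℝ → ℝ := fun τ => ((n : ℝ) + 1)⁻¹ * firstVar (H t)
    (slope (fun τ => H t * ((H τ * Ring.inverse (H t)) ^ (n + 1) - 1)) t τ) with ha
  set b : ℝ → ℝ := fun τ => -(((n : ℝ) + 1)⁻¹ * firstVar (H τ)
    (slope (fun τ => H τ * ((H t * Ring.inverse (H τ)) ^ (n + 1) - 1)) t τ)) with hb
  have ta : Tendsto a (𝓝[s \ {t}] t) (𝓝 (firstVar (H t) H')) := by
    have := (tendsto_firstVar hpos tendsto_const_nhds du).const_mul ((n : ℝ) + 1)⁻¹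
    rwa [firstVar_smul, inv_mul_cancel_left₀ hN] at this
  have tb : Tendsto b (𝓝[s \ {t}] t) (𝓝 (firstVar (H t) H')) := by
    have := ((tendsto_firstVar hpos tH dl).const_mul ((n : ℝ) + 1)⁻¹).neg
    rwa [← smul_neg, firstVar_smul, inv_mul_cancel_left₀ hN,
      show -H' = (-1 : ℝ) • H' by simp, firstVar_smul, neg_one_mul, neg_neg] at this
  -- The sign of τ - t decides which of a and b is the upper bound, hence the minimum and the
  -- maximum.
  have tmin := ta.min tb
  have tmax := ta.max tb
  rw [min_self] at tmin
  rw [max_self] at tmax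
  have key : ∀ᶠ τ in 𝓝[s \ {t}] t, min (a τ) (b τ) ≤ slope (fun τ => wvol (H τ)) t τ ∧
      slope (fun τ => wvol (H τ)) t τ ≤ max (a τ) (b τ) := by
    filter_upwards [ev, self_mem_nhdsWithin] with τ hτ hne
    have hne : τ ≠ t := hne.2
    have u1 := wvol_sub_le hpos hτ
    have u2 := wvol_sub_le hτ hpos
    have z1 : H t * ((H t * Ring.inverse (H t)) ^ (n + 1) - 1) = 0 := by
      rw [hinv, one_pow, sub_self, mul_zero]
    simp only [ha, hb, slope, vsub_eq_sub, z1, sub_zero, firstVar_smul, smul_eq_mul]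
    set A := firstVar (H t) (H t * ((H τ * Ring.inverse (H t)) ^ (n + 1) - 1))
    set B := firstVar (H τ) (H τ * ((H t * Ring.inverse (H τ)) ^ (n + 1) - 1))
    have ea : ((n : ℝ) + 1)⁻¹ * ((τ - t)⁻¹ * A) = (τ - t)⁻¹ * (((n : ℝ) + 1)⁻¹ * A) := by ring
    have eb : -(((n : ℝ) + 1)⁻¹ * ((τ - t)⁻¹ * B)) = (τ - t)⁻¹ * -(((n : ℝ) + 1)⁻¹ * B) := by ring
    rw [ea, eb]
    rcases lt_or_gt_of_ne hne with h | h
    · have h' : (τ - t)⁻¹ ≤ 0 := (inv_lt_zero.2 (sub_neg.2 h)).le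
      exact ⟨(min_le_left _ _).trans (mul_le_mul_of_nonpos_left u1 h'),
        (mul_le_mul_of_nonpos_left (by linarith) h').trans (le_max_right _ _)⟩
    · have h' : 0 ≤ (τ - t)⁻¹ := (inv_pos.2 (sub_pos.2 h)).le
      exact ⟨(min_le_right _ _).trans (mul_le_mul_of_nonneg_left (by linarith) h'),
        (mul_le_mul_of_nonneg_left u1 h').trans (le_max_left _ _)⟩
  exact tendsto_of_tendsto_of_tendsto_of_le_of_le' tmin tmax
    (key.mono fun _ h => h.1) (key.mono fun _ h => h.2)

/-! ### Hausdorff measures and Lipschitz maps -/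

section hausdorff
open scoped NNReal ENNReal
variable {X Y : Type*} [MetricSpace X] [MeasurableSpace X] [BorelSpace X]
  [MetricSpace Y] [MeasurableSpace Y] [BorelSpace Y]

theorem LipschitzOnWith.euclideanHausdorffMeasure_image_le {C : ℝ≥0} {f : X → Y} {s : Set X}
    (hf : LipschitzOnWith C f s) (d : ℕ) :
    (Measure.euclideanHausdorffMeasure d : Measure Y) (f '' s) ≤
      (C : ℝ≥0∞) ^ d * (Measure.euclideanHausdorffMeasure d : Measure X) s := by
  have := hf.hausdorffMeasure_image_le (d := d) (by positivity)
  rw [Measure.euclideanHausdorffMeasure_def, Measure.euclideanHausdorffMeasure_def,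
    Measure.smul_apply, Measure.smul_apply, ENNReal.smul_def, ENNReal.smul_def, smul_eq_mul,
    smul_eq_mul, mul_left_comm]
  rw [ENNReal.rpow_natCast] at this
  gcongr

theorem euclideanHausdorffMeasure_le_of_le_dist {f : X → Y} {s : Set X} {C : ℝ≥0}
    (hf : ∀ x ∈ s, ∀ y ∈ s, dist x y ≤ C * dist (f x) (f y)) (d : ℕ) :
    (Measure.euclideanHausdorffMeasure d : Measure X) s ≤
      (C : ℝ≥0∞) ^ d * (Measure.euclideanHausdorffMeasure d : Measure Y) (f '' s) := by
  rcases s.eq_empty_or_nonempty with rfl | ⟨x0, hx0⟩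
  · simp
  have : Nonempty X := ⟨x0⟩
  have hinj : Set.InjOn f s := fun x hx y hy hxy => by
    have := hf x hx y hy
    rw [hxy, dist_self, mul_zero] at this
    exact dist_le_zero.1 this
  have hL : LipschitzOnWith C (Function.invFunOn f s) (f '' s) := by
    refine LipschitzOnWith.of_dist_le_mul ?_
    rintro _ ⟨x, hx, rfl⟩ _ ⟨y, hy, rfl⟩
    rw [hinj.leftInvOn_invFunOn hx, hinj.leftInvOn_invFunOn hy]
    exact hf x hx y hy
  have := LipschitzOnWith.euclideanHausdorffMeasure_image_le hL d
  rwa [hinj.leftInvOn_invFunOn.image_image] at this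

end hausdorff

/-! ### The volume of cones over flat sets -/

-- Slice by the hyperplanes ⟨x, v⟩ = s: the slice is (s / c) F, with measure (s / c)ⁿ times that of
-- F, and the integral over (0, c] gives c / (n + 1).
open scoped Pointwise in
theorem volume_flat_cone (v : Sph n) {c : ℝ} (hc : 0 < c) {F : Set (Eucl n)} (hF : MeasurableSet F)
    (hFc : ∀ x ∈ F, inner ℝ x (v : Eucl n) = c) :
    ((n : ENNReal) + 1) * volume {x : Eucl n | 0 < inner ℝ x (v : Eucl n) ∧
        inner ℝ x (v : Eucl n) ≤ c ∧ (c / inner ℝ x (v : Eucl n)) • x ∈ F} =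
      ENNReal.ofReal c * (Measure.euclideanHausdorffMeasure n : Measure (Eucl n)) F := by
  set T : Set (Eucl n) := {x : Eucl n | 0 < inner ℝ x (v : Eucl n) ∧
        inner ℝ x (v : Eucl n) ≤ c ∧ (c / inner ℝ x (v : Eucl n)) • x ∈ F} with hT
  have hi : Continuous fun x : Eucl n => inner ℝ x (v : Eucl n) :=
    continuous_id.inner continuous_const
  have hTm : MeasurableSet T := by
    refine (measurableSet_lt measurable_const hi.measurable).inter
      ((measurableSet_le hi.measurable measurable_const).inter ?_)
    exact hF.preimage ((measurable_const.div hi.measurable).smul measurable_id)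
  have h1 := EuclideanGeometry.euclideanHausdorffMeasure_eq_lintegral (0 : Eucl n)
    (sph_ne_zero v) hTm
  have hfr : Module.finrank ℝ (Eucl n) = n + 1 := by simp
  rw [hfr, EuclideanSpace.euclideanHausdorffMeasure_eq_volume, Nat.add_sub_cancel] at h1
  have hv1 : ‖(v : Eucl n)‖ₑ = 1 := by rw [← ofReal_norm, norm_sph, ENNReal.ofReal_one]
  have hvv : inner ℝ (v : Eucl n) (v : Eucl n) = 1 := by
    rw [real_inner_self_eq_norm_sq, norm_sph, one_pow]
  have hmem : ∀ (s : ℝ) (x : Eucl n), x ∈ AffineSubspace.mk' (s • (v : Eucl n) +ᵥ (0 : Eucl n))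
      (Submodule.span ℝ {(v : Eucl n)})ᗮ ↔ inner ℝ x (v : Eucl n) = s := by
    intro s x
    rw [AffineSubspace.mem_mk', Submodule.mem_orthogonal_singleton_iff_inner_left]
    simp only [vadd_eq_add, add_zero, vsub_eq_sub, inner_sub_left, inner_smul_left, hvv]
    simp [sub_eq_zero]
  have h2 : ∀ s : ℝ, (Measure.euclideanHausdorffMeasure n : Measure (Eucl n))
      (T ∩ AffineSubspace.mk' (s • (v : Eucl n) +ᵥ (0 : Eucl n))
        (Submodule.span ℝ {(v : Eucl n)})ᗮ) =
      (Set.Ioc 0 c).indicator (fun s => ENNReal.ofReal ((s / c) ^ n)) s *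
        (Measure.euclideanHausdorffMeasure n : Measure (Eucl n)) F := by
    intro s
    by_cases hs : s ∈ Set.Ioc 0 c
    · have hsc : s / c ≠ 0 := (div_pos hs.1 hc).ne'
      rw [Set.indicator_of_mem hs]
      have : T ∩ AffineSubspace.mk' (s • (v : Eucl n) +ᵥ (0 : Eucl n))
        (Submodule.span ℝ {(v : Eucl n)})ᗮ = (s / c) • F := by
        ext x
        rw [Set.mem_inter_iff, SetLike.mem_coe, hmem, Set.mem_smul_set_iff_inv_smul_mem₀ hsc,
          inv_div]
        constructor
        · rintro ⟨⟨-, -, h3⟩, h4⟩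
          rwa [h4] at h3
        · intro h3
          have h4 := hFc _ h3
          rw [inner_smul_left] at h4
          simp only [conj_trivial] at h4
          have h5 : inner ℝ x (v : Eucl n) = s := by
            have := hs.1.ne'
            field_simp at h4
            linarith
          exact ⟨⟨h5 ▸ hs.1, h5 ▸ hs.2, by rwa [h5]⟩, h5⟩
      rw [this, Measure.euclideanHausdorffMeasure_smul₀ n hsc, ENNReal.smul_def, smul_eq_mul]
      congr 1
      rw [ENNReal.ofReal_pow (div_pos hs.1 hc).le, ENNReal.coe_pow]
      congr 1
      rw [← Real.enorm_of_nonneg (div_pos hs.1 hc).le]; rfl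
    · rw [Set.indicator_of_notMem hs, zero_mul]
      convert measure_empty (μ := (Measure.euclideanHausdorffMeasure n : Measure (Eucl n)))
      ext x
      rw [Set.mem_inter_iff, SetLike.mem_coe, hmem]
      simp only [Set.mem_empty_iff_false, iff_false, not_and]
      rintro ⟨h3, h4, -⟩ h5
      exact hs (h5 ▸ ⟨h3, h4⟩)
  rw [hv1, one_mul, lintegral_congr h2, lintegral_mul_const _ (by
    refine Measurable.indicator ?_ measurableSet_Ioc
    exact ((measurable_id.div_const c).pow_const n).ennreal_ofReal),
    lintegral_indicator measurableSet_Ioc, ← ofReal_integral_eq_lintegral_ofReal] at h1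
  · rw [h1, ← mul_assoc]
    congr 1
    rw [← intervalIntegral.integral_of_le hc.le]
    have : ∫ s in (0 : ℝ)..c, (s / c) ^ n = c / (n + 1) := by
      rw [intervalIntegral.integral_comp_div (fun s => s ^ n) hc.ne']
      simp [hc.ne', div_eq_mul_inv]
    rw [this, show ((n : ENNReal) + 1) = ENNReal.ofReal ((n : ℝ) + 1) by
      rw [ENNReal.ofReal_add (by positivity) zero_le_one]; simp, ← ENNReal.ofReal_mul (by positivity)]
    congr 1
    field_simp
  · have : Continuous fun s : ℝ => (s / c) ^ n := by fun_prop
    exact (this.integrableOn_Icc).mono_set Set.Ioc_subset_Icc_self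
  · filter_upwards [ae_restrict_mem measurableSet_Ioc] with s hs
    have := hs.1
    positivity

/-! ### Cone measure and surface area measure -/

/-- The boundary points of the Wulff shape of `h` with a unique normal direction. -/
def regSet (h : C(Sph n, ℝ)) : Set (Eucl n) :=
  {y | wgauge h y = 1 ∧ ∀ v : Sph n, inner ℝ y (v : Eucl n) / h v = wgauge h y →
    v = normalDir h y}

/-- The radial projection to the boundary of the Wulff shape of `h`. -/
def radial (h : C(Sph n, ℝ)) (x : Eucl n) : Eucl n := (wgauge h x)⁻¹ • x

/-- The map, linear on rays, that takes boundary points of the Wulff shape of `h` to the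
hyperplane supporting it in direction `v` by orthogonal projection. -/
def flatMap (h : C(Sph n, ℝ)) (v : Sph n) (x : Eucl n) : Eucl n :=
  x + (h v * wgauge h x - inner ℝ x (v : Eucl n)) • (v : Eucl n)

/-- The points of `regSet h` whose normal is nearly parallel to `v`. -/
def nearSet (h : C(Sph n, ℝ)) (v : Sph n) (τ : ℝ) : Set (Eucl n) :=
  {y ∈ regSet h | ‖(h v / h (normalDir h y)) • (normalDir h y : Eucl n) - v‖ ≤ τ}

/-- The cone measure of the Wulff shape of `h`, on its boundary. -/
def coneMeasure (h : C(Sph n, ℝ)) : Measure (Eucl n) :=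
  (((n : ENNReal) + 1) • (volume : Measure (Eucl n)).restrict {x | wgauge h x ≤ 1}).map (radial h)

section
variable {h : C(Sph n, ℝ)} (hh : ∀ v, 0 < h v)
include hh

theorem wgauge_zero : wgauge h 0 = 0 := by rw [wgauge_eq hh]; simp

theorem radial_smul {t : ℝ} (ht : 0 < t) (x : Eucl n) : radial h (t • x) = radial h x := by
  rw [radial, radial, wgauge_smul hh ht.le, smul_smul, mul_inv_rev, mul_assoc,
    inv_mul_cancel₀ ht.ne', mul_one]

theorem measurable_radial : Measurable (radial h) :=
  (continuous_wgauge hh).measurable.inv.smul measurable_id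

theorem continuousOn_normalDir_regSet : ContinuousOn (normalDir h) (regSet h) := fun _ hy =>
  tendsto_normalDir hh (Filter.Eventually.of_forall fun _ => hh) tendsto_const_nhds
    (tendsto_id.mono_left nhdsWithin_le_nhds) hy.2

/-- The boundary points with several normals form a countable union of compact sets: for each k, the
points with two normals at distance at least 1 / (k + 1). -/
theorem measurableSet_regSet : MeasurableSet (regSet h) := by
  have hr : Continuous fun p : Eucl n × Sph n => inner ℝ p.1 (p.2 : Eucl n) / h p.2 :=
    (continuous_fst.inner (continuous_subtype_val.comp continuous_snd)).div
      (h.continuous.comp continuous_snd) fun p => (hh _).ne'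
  have hγ := continuous_wgauge hh
  let T : ℕ → Set (Eucl n × (Sph n × Sph n)) := fun k => {p | wgauge h p.1 = 1 ∧
    inner ℝ p.1 (p.2.1 : Eucl n) / h p.2.1 = 1 ∧ inner ℝ p.1 (p.2.2 : Eucl n) / h p.2.2 = 1 ∧
    1 / ((k : ℝ) + 1) ≤ dist p.2.1 p.2.2}
  have hT : ∀ k, IsCompact (T k) := by
    intro k
    refine ((isCompact_closedBall (0 : Eucl n) ‖h‖).prod isCompact_univ).of_isClosed_subset ?_ ?_
    · refine (isClosed_eq (hγ.comp continuous_fst) continuous_const).inter ?_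
      refine (isClosed_eq (hr.comp (continuous_fst.prodMk (continuous_fst.comp continuous_snd)))
        continuous_const).inter ?_
      refine (isClosed_eq (hr.comp (continuous_fst.prodMk (continuous_snd.comp continuous_snd)))
        continuous_const).inter ?_
      exact isClosed_le continuous_const ((continuous_fst.comp continuous_snd).dist
        (continuous_snd.comp continuous_snd))
    · rintro p ⟨h1, -⟩
      refine ⟨?_, Set.mem_univ _⟩
      have := norm_div_le_wgauge hh p.1
      rw [h1, div_le_one (norm_pos_of_pos hh)] at this
      simpa using this
  have : regSet h = {y | wgauge h y = 1} \ ⋃ k, Prod.fst '' (T k) := by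
    ext y
    constructor
    · rintro ⟨h1, h2⟩
      refine ⟨h1, ?_⟩
      simp only [Set.mem_iUnion, Set.mem_image, not_exists, not_and]
      rintro k p ⟨-, h3, h4, h5⟩ rfl
      rw [h1] at h2
      rw [h2 _ h3, h2 _ h4, dist_self] at h5
      have : (0 : ℝ) < 1 / ((k : ℝ) + 1) := by positivity
      linarith
    · rintro ⟨h1 : wgauge h y = 1, h2⟩
      refine ⟨h1, fun v hv => ?_⟩
      by_contra hne
      obtain ⟨k, hk⟩ := exists_nat_one_div_lt (dist_pos.2 hne)
      refine h2 (Set.mem_iUnion.2 ⟨k, (y, (v, normalDir h y)), ⟨h1, ?_, ?_, hk.le⟩, rfl⟩)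
      · exact hv.trans h1
      · exact (wgauge_eq hh y).symm.trans h1
  rw [this]
  refine (measurableSet_eq_fun hγ.measurable measurable_const).diff (MeasurableSet.iUnion fun k => ?_)
  exact ((hT k).image continuous_fst).isClosed.measurableSet

theorem measurableSet_nearSet (v : Sph n) (τ : ℝ) : MeasurableSet (nearSet h v τ) := by
  have hm := measurableSet_regSet hh
  have hc := continuousOn_normalDir_regSet hh
  have hf : ContinuousOn (fun y => ‖(h v / h (normalDir h y)) • (normalDir h y : Eucl n) - v‖)
      (regSet h) :=
    ((((continuousOn_const.div (h.continuous.comp_continuousOn hc) fun y _ => (hh _).ne').smul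
      (continuous_subtype_val.comp_continuousOn hc))).sub continuousOn_const).norm
  obtain ⟨t, ht, h2⟩ := continuousOn_iff_isClosed.1 hf _ (isClosed_Iic (a := τ))
  have : nearSet h v τ = t ∩ regSet h := by
    rw [← h2]; ext y; exact and_comm
  rw [this]
  exact ht.measurableSet.inter hm

theorem flatMap_smul {t : ℝ} (ht : 0 ≤ t) (v : Sph n) (x : Eucl n) :
    flatMap h v (t • x) = t • flatMap h v x := by
  simp only [flatMap, wgauge_smul hh ht, inner_smul_left, conj_trivial, smul_add, smul_smul]
  congr 2; ring

omit hh in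
theorem inner_flatMap (v : Sph n) (x : Eucl n) :
    inner ℝ (flatMap h v x) (v : Eucl n) = h v * wgauge h x := by
  rw [flatMap, inner_add_left, inner_smul_left, real_inner_self_eq_norm_sq, norm_sph]
  simp

theorem continuous_flatMap (v : Sph n) : Continuous (flatMap h v) :=
  continuous_id.add (((continuous_const.mul (continuous_wgauge hh)).sub
    (continuous_id.inner continuous_const)).smul continuous_const)

theorem exists_normal_of_radial_mem {v : Sph n} {τ : ℝ} {x : Eucl n}
    (hx : radial h x ∈ nearSet h v τ) : ∃ w : Sph n,
      inner ℝ x (w : Eucl n) / h w = wgauge h x ∧ ‖(h v / h w) • (w : Eucl n) - v‖ ≤ τ := by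
  refine ⟨_, ?_, hx.2⟩
  have hx0 : x ≠ 0 := by
    rintro rfl
    have := hx.1.1
    rw [radial, smul_zero, wgauge_zero hh] at this
    exact zero_ne_one this
  have hg := wgauge_pos hh hx0
  have h1 := (wgauge_eq hh (radial h x)).symm
  rw [hx.1.1] at h1
  nth_rewrite 1 [radial] at h1
  rw [inner_smul_left, conj_trivial] at h1
  field_simp at h1 ⊢
  exact h1

/-- `flatMap h v` differs from the identity by the scalar function h v · gauge - ⟨·, v⟩ times v. At
points over `nearSet` this convex function has a subgradient of norm at most τ, and the subgradient
inequalities at x and at y bound its increment from both sides. -/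
theorem norm_flatMap_sub_sub_le {v : Sph n} {τ : ℝ} {x y : Eucl n}
    (hx : radial h x ∈ nearSet h v τ) (hy : radial h y ∈ nearSet h v τ) :
    ‖(flatMap h v x - flatMap h v y) - (x - y)‖ ≤ τ * ‖x - y‖ := by
  have key : ∀ {x y : Eucl n}, radial h x ∈ nearSet h v τ →
      h v * (wgauge h x - wgauge h y) - inner ℝ (x - y) (v : Eucl n) ≤ τ * ‖x - y‖ := by
    intro x y hx
    obtain ⟨w, hw1, hw2⟩ := exists_normal_of_radial_mem hh hx
    have h1 := mul_le_mul_of_nonneg_left (wgauge_sub_le_of_eq hh hw1 y) (hh v).le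
    have h2 : h v * (inner ℝ (x - y) (w : Eucl n) / h w) - inner ℝ (x - y) (v : Eucl n) =
        inner ℝ (x - y) ((h v / h w) • (w : Eucl n) - v) := by
      rw [inner_sub_right, inner_smul_right]; ring
    have h3 := (real_inner_le_norm (x - y) ((h v / h w) • (w : Eucl n) - v)).trans
      (mul_le_mul_of_nonneg_left hw2 (norm_nonneg _))
    linarith
  have e : (flatMap h v x - flatMap h v y) - (x - y) =
      (h v * (wgauge h x - wgauge h y) - inner ℝ (x - y) (v : Eucl n)) • (v : Eucl n) := by
    simp only [flatMap, inner_sub_left]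
    module
  rw [e, norm_smul, norm_sph, mul_one, Real.norm_eq_abs, abs_le]
  refine ⟨?_, key hx⟩
  have := key (x := y) (y := x) hy
  rw [norm_sub_rev y x, ← neg_sub x y, inner_neg_left] at this
  linarith

omit hh in
theorem radial_eq_self {y : Eucl n} (hy : wgauge h y = 1) : radial h y = y := by
  rw [radial, hy, inv_one, one_smul]

-- Flattening distorts distances by factors between 1 - τ and 1 + τ, both on D and on the cone over
-- D, and sends this cone to a flat one, where volume and base are related exactly. Comparing
-- volumes costs the power n + 1, comparing bases the power n, and replacing the support value by h
-- v one more factor.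
open scoped NNReal ENNReal in
theorem coneMeasure_le_and_ge {v : Sph n} {τ : ℝ} (hτ0 : 0 < τ) (hτ1 : τ < 1) {D : Set (Eucl n)}
    (hD : MeasurableSet D) (hDs : D ⊆ nearSet h v τ) :
    coneMeasure h D ≤ ENNReal.ofReal (((1 + τ) / (1 - τ)) ^ (n + 1)) *
        ∫⁻ y in D, ENNReal.ofReal (h (normalDir h y)) ∂Measure.euclideanHausdorffMeasure n ∧
      ∫⁻ y in D, ENNReal.ofReal (h (normalDir h y)) ∂Measure.euclideanHausdorffMeasure n ≤
        ENNReal.ofReal (((1 + τ) / (1 - τ)) ^ (n + 1)) * coneMeasure h D := by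
  set μH : Measure (Eucl n) := Measure.euclideanHausdorffMeasure n with hμH
  have hγc := continuous_wgauge hh
  set T : Set (Eucl n) := {x | radial h x ∈ D ∧ wgauge h x ≤ 1} with hT
  have hTm : MeasurableSet T := (measurable_radial hh hD).inter
    (measurableSet_le hγc.measurable measurable_const)
  have hcone : coneMeasure h D = ((n : ℝ≥0∞) + 1) * volume T := by
    rw [coneMeasure, Measure.map_apply (measurable_radial hh) hD, Measure.smul_apply, smul_eq_mul,
      Measure.restrict_apply (measurable_radial hh hD)]
    rfl
  have hD1 : ∀ y ∈ D, wgauge h y = 1 := fun y hy => (hDs hy).1.1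
  have hDrad : ∀ y ∈ D, radial h y ∈ D := fun y hy => by
    rw [radial_eq_self (hD1 y hy)]; exact hy
  -- two-sided distance estimates
  have up : ∀ {x y : Eucl n}, radial h x ∈ D → radial h y ∈ D →
      dist (flatMap h v x) (flatMap h v y) ≤ (1 + τ) * dist x y := by
    intro x y hx hy
    have h1 := norm_flatMap_sub_sub_le hh (hDs hx) (hDs hy)
    have h2 := norm_add_le ((flatMap h v x - flatMap h v y) - (x - y)) (x - y)
    rw [sub_add_cancel] at h2
    rw [dist_eq_norm, dist_eq_norm]
    linarith
  have lo : ∀ {x y : Eucl n}, radial h x ∈ D → radial h y ∈ D →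
      dist x y ≤ (1 - τ)⁻¹ * dist (flatMap h v x) (flatMap h v y) := by
    intro x y hx hy
    have h1 := norm_flatMap_sub_sub_le hh (hDs hx) (hDs hy)
    have h2 := norm_sub_le (flatMap h v x - flatMap h v y)
      ((flatMap h v x - flatMap h v y) - (x - y))
    rw [sub_sub_cancel] at h2
    rw [dist_eq_norm, dist_eq_norm, inv_mul_eq_div, le_div_iff₀ (by linarith)]
    linarith
  set a : ℝ≥0 := ⟨1 + τ, by linarith⟩ with ha
  set b : ℝ≥0 := ⟨(1 - τ)⁻¹, by rw [inv_nonneg]; linarith⟩ with hb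
  have hinj : Set.InjOn (flatMap h v) D := by
    intro x hx y hy hxy
    have := lo (hDrad x hx) (hDrad y hy)
    rw [hxy, dist_self, mul_zero] at this
    exact dist_le_zero.1 this
  have hFm : MeasurableSet (flatMap h v '' D) :=
    hD.image_of_continuousOn_injOn (continuous_flatMap hh v).continuousOn hinj
  have hflat := volume_flat_cone v (hh v) hFm (by
    rintro _ ⟨y, hy, rfl⟩
    rw [inner_flatMap, hD1 y hy, mul_one])
  -- By homogeneity of the flattening map, the image of the cone over D is the flat cone over the
  -- image of D.
  have himg : {x : Eucl n | 0 < inner ℝ x (v : Eucl n) ∧ inner ℝ x (v : Eucl n) ≤ h v ∧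
      (h v / inner ℝ x (v : Eucl n)) • x ∈ flatMap h v '' D} = flatMap h v '' T := by
    ext x
    constructor
    · rintro ⟨h1, h2, y, hy, h3⟩
      set s := inner ℝ x (v : Eucl n) / h v with hs
      have hs0 : 0 < s := div_pos h1 (hh v)
      refine ⟨s • y, ⟨?_, ?_⟩, ?_⟩
      · rw [radial_smul hh hs0]; exact hDrad y hy
      · rw [wgauge_smul hh hs0.le, hD1 y hy, mul_one]
        exact (div_le_one (hh v)).2 h2
      · rw [flatMap_smul hh hs0.le, h3, smul_smul, hs, div_mul_div_cancel₀ (hh v).ne',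
          div_self h1.ne', one_smul]
    · rintro ⟨x, ⟨h1, h2⟩, rfl⟩
      have hx0 : x ≠ 0 := by
        rintro rfl
        have := hD1 _ h1
        rw [radial, smul_zero, wgauge_zero hh] at this
        exact zero_ne_one this
      have hg := wgauge_pos hh hx0
      refine ⟨?_, ?_, radial h x, h1, ?_⟩
      · rw [inner_flatMap]; exact mul_pos (hh v) hg
      · rw [inner_flatMap]; exact mul_le_of_le_one_right (hh v).le h2
      · rw [inner_flatMap, radial, flatMap_smul hh (inv_nonneg.2 hg.le)]
        congr 1
        have := (hh v).ne'
        field_simp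
  rw [himg] at hflat
  have vE : (Measure.euclideanHausdorffMeasure (n + 1) : Measure (Eucl n)) = volume :=
    EuclideanSpace.euclideanHausdorffMeasure_eq_volume (n + 1)
  have v1 : volume (flatMap h v '' T) ≤ (a : ℝ≥0∞) ^ (n + 1) * volume T := by
    have := LipschitzOnWith.euclideanHausdorffMeasure_image_le (C := a) (f := flatMap h v) (s := T)
      (LipschitzOnWith.of_dist_le_mul fun x hx y hy => up hx.1 hy.1) (n + 1)
    rwa [vE] at this
  have v2 : volume T ≤ (b : ℝ≥0∞) ^ (n + 1) * volume (flatMap h v '' T) := by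
    have := euclideanHausdorffMeasure_le_of_le_dist (C := b) (f := flatMap h v) (s := T)
      (fun x hx y hy => lo hx.1 hy.1) (n + 1)
    rwa [vE] at this
  have v3 : μH (flatMap h v '' D) ≤ (a : ℝ≥0∞) ^ n * μH D :=
    LipschitzOnWith.euclideanHausdorffMeasure_image_le (C := a) (f := flatMap h v) (s := D)
      (LipschitzOnWith.of_dist_le_mul fun x hx y hy => up (hDrad x hx) (hDrad y hy)) n
  have v4 : μH D ≤ (b : ℝ≥0∞) ^ n * μH (flatMap h v '' D) :=
    euclideanHausdorffMeasure_le_of_le_dist (C := b) (f := flatMap h v) (s := D)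
      (fun x hx y hy => lo (hDrad x hx) (hDrad y hy)) n
  -- comparison of the density with the constant `h v`
  have hden : ∀ y ∈ D, (1 - τ) * h (normalDir h y) ≤ h v ∧ h v ≤ (1 + τ) * h (normalDir h y) := by
    intro y hy
    have h1 := (hDs hy).2
    have h2 := (abs_norm_sub_norm_le _ _).trans h1
    rw [norm_smul, norm_sph, norm_sph, mul_one, Real.norm_of_nonneg
      (div_pos (hh _) (hh _)).le, abs_le] at h2
    have h3 := hh (normalDir h y)
    constructor
    · have : 1 - τ ≤ h v / h (normalDir h y) := by linarith [h2.1]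
      rwa [le_div_iff₀ h3] at this
    · have : h v / h (normalDir h y) ≤ 1 + τ := by linarith [h2.2]
      rwa [div_le_iff₀ h3] at this
  have aE : (a : ℝ≥0∞) = ENNReal.ofReal (1 + τ) := (ENNReal.ofReal_eq_coe_nnreal a.2).symm
  have bE : (b : ℝ≥0∞) = ENNReal.ofReal (1 - τ)⁻¹ := (ENNReal.ofReal_eq_coe_nnreal b.2).symm
  have h1τ : 0 < 1 - τ := by linarith
  set I : ℝ≥0∞ := ∫⁻ y in D, ENNReal.ofReal (h (normalDir h y)) ∂μH with hI
  have i1 : ENNReal.ofReal (h v) * μH D ≤ (a : ℝ≥0∞) * I := by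
    rw [← setLIntegral_const, hI, ← lintegral_const_mul' _ _ ENNReal.coe_ne_top]
    refine setLIntegral_mono' hD fun y hy => ?_
    rw [aE, ← ENNReal.ofReal_mul (by linarith)]
    exact ENNReal.ofReal_le_ofReal (hden y hy).2
  have i2 : I ≤ (b : ℝ≥0∞) * (ENNReal.ofReal (h v) * μH D) := by
    rw [← setLIntegral_const, hI, ← lintegral_const_mul' _ _ ENNReal.coe_ne_top]
    refine setLIntegral_mono' hD fun y hy => ?_
    rw [bE, ← ENNReal.ofReal_mul (by positivity)]
    refine ENNReal.ofReal_le_ofReal ?_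
    rw [inv_mul_eq_div, le_div_iff₀ h1τ, mul_comm]
    exact (hden y hy).1
  have θE : ENNReal.ofReal (((1 + τ) / (1 - τ)) ^ (n + 1)) =
      (a : ℝ≥0∞) ^ (n + 1) * (b : ℝ≥0∞) ^ (n + 1) := by
    rw [aE, bE, ← mul_pow, ← ENNReal.ofReal_mul (by linarith), ← div_eq_mul_inv,
      ENNReal.ofReal_pow (by positivity)]
  rw [hcone, θE]
  constructor
  · calc ((n : ℝ≥0∞) + 1) * volume T
        ≤ ((n : ℝ≥0∞) + 1) * ((b : ℝ≥0∞) ^ (n + 1) * volume (flatMap h v '' T)) := by gcongr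
      _ = (b : ℝ≥0∞) ^ (n + 1) * (ENNReal.ofReal (h v) * μH (flatMap h v '' D)) := by
          rw [mul_left_comm, hflat]
      _ ≤ (b : ℝ≥0∞) ^ (n + 1) * (ENNReal.ofReal (h v) * ((a : ℝ≥0∞) ^ n * μH D)) := by gcongr
      _ = (b : ℝ≥0∞) ^ (n + 1) * ((a : ℝ≥0∞) ^ n * (ENNReal.ofReal (h v) * μH D)) := by
          rw [mul_left_comm (ENNReal.ofReal (h v))]
      _ ≤ (b : ℝ≥0∞) ^ (n + 1) * ((a : ℝ≥0∞) ^ n * ((a : ℝ≥0∞) * I)) := by gcongr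
      _ = _ := by ring
  · calc I ≤ (b : ℝ≥0∞) * (ENNReal.ofReal (h v) * μH D) := i2
      _ ≤ (b : ℝ≥0∞) * (ENNReal.ofReal (h v) * ((b : ℝ≥0∞) ^ n * μH (flatMap h v '' D))) := by
          gcongr
      _ = (b : ℝ≥0∞) ^ (n + 1) * (ENNReal.ofReal (h v) * μH (flatMap h v '' D)) := by ring
      _ = (b : ℝ≥0∞) ^ (n + 1) * (((n : ℝ≥0∞) + 1) * volume (flatMap h v '' T)) := by rw [hflat]
      _ ≤ (b : ℝ≥0∞) ^ (n + 1) * (((n : ℝ≥0∞) + 1) * ((a : ℝ≥0∞) ^ (n + 1) * volume T)) := by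
          gcongr
      _ = _ := by ring

end

/-! ### Cone measure equals surface measure weighted by the support function -/

section
variable {h : C(Sph n, ℝ)} (hh : ∀ v, 0 < h v)
include hh

theorem iUnion_nearSet {τ : ℝ} (hτ : 0 < τ) :
    ⋃ i, nearSet h (TopologicalSpace.denseSeq (Sph n) i) τ = regSet h := by
  refine Set.Subset.antisymm (Set.iUnion_subset fun i y hy => hy.1) fun y hy => ?_
  set w := normalDir h y with hw
  have hc : Continuous fun v : Sph n => ‖(h v / h w) • (w : Eucl n) - v‖ :=
    (((h.continuous.div_const _).smul continuous_const).sub continuous_subtype_val).norm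
  have h0 : ‖(h w / h w) • (w : Eucl n) - w‖ < τ := by
    rw [div_self (hh w).ne', one_smul, sub_self, norm_zero]; exact hτ
  obtain ⟨v, hv1, i, rfl⟩ := (TopologicalSpace.denseRange_denseSeq (Sph n)).inter_open_nonempty _
    (isOpen_lt hc continuous_const) ⟨w, h0⟩
  exact Set.mem_iUnion.2 ⟨i, hy, le_of_lt hv1⟩

/-- The surface measure, weighted by the support function and restricted to regular points. -/
def weightedSurface (h : C(Sph n, ℝ)) : Measure (Eucl n) :=
  ((Measure.euclideanHausdorffMeasure n : Measure (Eucl n)).restrict (regSet h)).withDensity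
    fun y => ENNReal.ofReal (h (normalDir h y))

omit hh in
theorem weightedSurface_apply {D : Set (Eucl n)} (hD : MeasurableSet D) (hDr : D ⊆ regSet h) :
    weightedSurface h D =
      ∫⁻ y in D, ENNReal.ofReal (h (normalDir h y)) ∂Measure.euclideanHausdorffMeasure n := by
  rw [weightedSurface, withDensity_apply _ hD, Measure.restrict_restrict hD,
    Set.inter_eq_self_of_subset_left hDr]

/-- Cut D into countably many pieces on which the normal is almost constant, add up the two-sided
estimates, and let τ tend to 0. -/
theorem coneMeasure_eq_weightedSurface {D : Set (Eucl n)} (hD : MeasurableSet D)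
    (hDr : D ⊆ regSet h) : coneMeasure h D = weightedSurface h D := by
  have key : ∀ τ : ℝ, 0 < τ → τ < 1 →
      coneMeasure h D ≤ ENNReal.ofReal (((1 + τ) / (1 - τ)) ^ (n + 1)) * weightedSurface h D ∧
      weightedSurface h D ≤ ENNReal.ofReal (((1 + τ) / (1 - τ)) ^ (n + 1)) * coneMeasure h D := by
    intro τ h0 h1
    set A : ℕ → Set (Eucl n) := fun i => nearSet h (TopologicalSpace.denseSeq (Sph n) i) τ with hA
    have hAm : ∀ i, MeasurableSet (disjointed A i) :=
      fun i => MeasurableSet.disjointed (fun i => measurableSet_nearSet hh _ _) i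
    have hU : ⋃ i, D ∩ disjointed A i = D := by
      rw [← Set.inter_iUnion, iUnion_disjointed, iUnion_nearSet hh h0,
        Set.inter_eq_self_of_subset_left hDr]
    have hdis : Pairwise fun i j => Disjoint (D ∩ disjointed A i) (D ∩ disjointed A j) :=
      fun i j hij => (disjoint_disjointed A hij).mono Set.inter_subset_right Set.inter_subset_right
    have sum : ∀ μ : Measure (Eucl n), μ D = ∑' i, μ (D ∩ disjointed A i) := fun μ => by
      conv_lhs => rw [← hU]
      exact measure_iUnion hdis fun i => hD.inter (hAm i)
    have piece := fun i => coneMeasure_le_and_ge hh (v := TopologicalSpace.denseSeq (Sph n) i) h0 h1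
      (hD.inter (hAm i)) (Set.inter_subset_right.trans (disjointed_subset A i))
    have piece' : ∀ i, weightedSurface h (D ∩ disjointed A i) = _ := fun i =>
      weightedSurface_apply (hD.inter (hAm i)) (Set.inter_subset_left.trans hDr)
    rw [sum (coneMeasure h), sum (weightedSurface h), ← ENNReal.tsum_mul_left,
      ← ENNReal.tsum_mul_left]
    constructor
    · exact ENNReal.tsum_le_tsum fun i => by rw [piece' i]; exact (piece i).1
    · exact ENNReal.tsum_le_tsum fun i => by rw [piece' i]; exact (piece i).2
  have lim : Tendsto (fun τ : ℝ => ENNReal.ofReal (((1 + τ) / (1 - τ)) ^ (n + 1))) (𝓝[>] 0)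
      (𝓝 1) := by
    have hc : ContinuousAt (fun τ : ℝ => ((1 + τ) / (1 - τ)) ^ (n + 1)) 0 := by
      refine ContinuousAt.pow (ContinuousAt.div (by fun_prop) (by fun_prop) (by simp)) _
    have := (ENNReal.continuous_ofReal.tendsto _).comp (hc.tendsto.mono_left (nhdsWithin_le_nhds (s := Set.Ioi 0)))
    simpa [Function.comp_def] using this
  have ev : ∀ᶠ τ : ℝ in 𝓝[>] 0, 0 < τ ∧ τ < 1 := Ioo_mem_nhdsGT one_pos
  refine le_antisymm ?_ ?_
  · have := ENNReal.Tendsto.mul_const (b := weightedSurface h D) lim (Or.inl one_ne_zero)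
    rw [one_mul] at this
    exact ge_of_tendsto this (ev.mono fun τ hτ => (key τ hτ.1 hτ.2).1)
  · have := ENNReal.Tendsto.mul_const (b := coneMeasure h D) lim (Or.inl one_ne_zero)
    rw [one_mul] at this
    exact ge_of_tendsto this (ev.mono fun τ hτ => (key τ hτ.1 hτ.2).2)

theorem eq_normalDir_smul_of_differentiableAt {x : Eucl n}
    (hx : DifferentiableAt ℝ (wgauge h) x) {t : ℝ} (ht : 0 < t) {v : Sph n}
    (hv : inner ℝ (t • x) (v : Eucl n) / h v = wgauge h (t • x)) : v = normalDir h x := by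
  refine eq_normalDir_of_differentiableAt hh hx ?_
  rw [wgauge_smul hh ht.le, inner_smul_left, mul_div_assoc] at hv
  exact mul_left_cancel₀ ht.ne' hv

theorem normalDir_smul {x : Eucl n} (hx : DifferentiableAt ℝ (wgauge h) x) {t : ℝ} (ht : 0 < t) :
    normalDir h (t • x) = normalDir h x :=
  eq_normalDir_smul_of_differentiableAt hh hx ht (wgauge_eq hh _).symm

theorem radial_mem_regSet {x : Eucl n} (hx0 : x ≠ 0) (hx : DifferentiableAt ℝ (wgauge h) x) :
    radial h x ∈ regSet h := by
  have hg := wgauge_pos hh hx0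
  refine ⟨?_, fun v hv => ?_⟩
  · rw [radial, wgauge_smul hh (inv_pos.2 hg).le, inv_mul_cancel₀ hg.ne']
  · rw [radial, normalDir_smul hh hx (inv_pos.2 hg)]
    exact eq_normalDir_smul_of_differentiableAt hh hx (inv_pos.2 hg) hv

theorem ae_ne_zero_and_differentiableAt :
    ∀ᵐ x : Eucl n, x ≠ 0 ∧ DifferentiableAt ℝ (wgauge h) x :=
  (Measure.ae_ne volume (0 : Eucl n)).and (lipschitz_wgauge hh).choose_spec.ae_differentiableAt

/-- Both measures live on the regular points. For the cone measure this is Rademacher's theorem for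
the gauge, since radial projection sends differentiability points to regular boundary points. -/
theorem coneMeasure_eq : coneMeasure h = weightedSurface h := by
  have hR := measurableSet_regSet hh
  have h0 : coneMeasure h (regSet h)ᶜ = 0 := by
    rw [coneMeasure, Measure.map_apply (measurable_radial hh) hR.compl, Measure.smul_apply,
      smul_eq_mul]
    refine mul_eq_zero_of_right _ (measure_eq_zero_iff_ae_notMem.2 ?_)
    filter_upwards [ae_restrict_of_ae (ae_ne_zero_and_differentiableAt hh)] with x hx h'
    exact h' (radial_mem_regSet hh hx.1 hx.2)
  have h1 : weightedSurface h (regSet h)ᶜ = 0 :=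
    withDensity_absolutelyContinuous _ _ (by
      rw [Measure.restrict_apply hR.compl, Set.compl_inter_self, measure_empty])
  refine Measure.ext fun D hD => ?_
  rw [← measure_inter_add_sdiff D hR, ← measure_inter_add_sdiff D hR,
    coneMeasure_eq_weightedSurface hh (hD.inter hR) Set.inter_subset_right,
    measure_mono_null (Set.sdiff_subset_compl D _) h0, measure_mono_null (Set.sdiff_subset_compl D _) h1]

theorem aemeasurable_normalDir_regSet : AEMeasurable (normalDir h)
    ((Measure.euclideanHausdorffMeasure n : Measure (Eucl n)).restrict (regSet h)) :=
  (continuousOn_normalDir_regSet hh).aemeasurable (measurableSet_regSet hh)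

/-- The integrand of `firstVar` carries the factor 1 / h(ν), which cancels the density h(ν) of the
cone measure with respect to surface measure. -/
theorem firstVar_eq_integral_regSet (g : C(Sph n, ℝ)) :
    firstVar h g = ∫ y in regSet h, g (normalDir h y) ∂Measure.euclideanHausdorffMeasure n := by
  have hN : ((n : ℝ) + 1) ≠ 0 := by positivity
  have hq : Continuous fun v => g v / h v := g.continuous.div h.continuous fun v => (hh v).ne'
  have hα := aemeasurable_normalDir_regSet hh
  have e1 := integral_dir hh (f := fun u => g (normalDir h u) / h (normalDir h u))
    (hq.measurable.comp_aemeasurable (aemeasurable_normalDir hh)).aestronglyMeasurable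
  rw [eq_inv_mul_iff_mul_eq₀ hN] at e1
  rw [firstVar, ← e1]
  have e2 : ∫ x in {x : Eucl n | wgauge h x ≤ 1}, g (normalDir h (dir x : Eucl n)) /
      h (normalDir h (dir x : Eucl n)) = ∫ x in {x : Eucl n | wgauge h x ≤ 1},
        g (normalDir h (radial h x)) / h (normalDir h (radial h x)) := by
    refine integral_congr_ae ?_
    filter_upwards [ae_restrict_of_ae (ae_ne_zero_and_differentiableAt hh)] with x hx
    rw [coe_dir hx.1, normalDir_smul hh hx.2 (inv_pos.2 (norm_pos_iff.2 hx.1)), radial,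
      normalDir_smul hh hx.2 (inv_pos.2 (wgauge_pos hh hx.1))]
  have hac : coneMeasure h ≪
      (Measure.euclideanHausdorffMeasure n : Measure (Eucl n)).restrict (regSet h) := by
    rw [coneMeasure_eq hh]; exact withDensity_absolutelyContinuous _ _
  have e3 : ∫ y, g (normalDir h y) / h (normalDir h y) ∂coneMeasure h = ((n : ℝ) + 1) *
      ∫ x in {x : Eucl n | wgauge h x ≤ 1},
        g (normalDir h (radial h x)) / h (normalDir h (radial h x)) := by
    rw [coneMeasure, integral_map (measurable_radial hh).aemeasurable, integral_smul_measure]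
    · rw [smul_eq_mul, ENNReal.toReal_add (by simp) (by simp)]; simp
    · exact (hq.measurable.comp_aemeasurable (hα.mono_ac hac)).aestronglyMeasurable
  rw [e2, ← e3, coneMeasure_eq hh, weightedSurface,
    integral_withDensity_eq_integral_toReal_smul₀]
  · refine integral_congr_ae (Filter.Eventually.of_forall fun y => ?_)
    simp only [smul_eq_mul]
    rw [ENNReal.toReal_ofReal (hh _).le, mul_div_cancel₀ _ (hh _).ne']
  · exact (h.continuous.measurable.comp_aemeasurable hα).ennreal_ofReal
  · exact Filter.Eventually.of_forall fun _ => ENNReal.ofReal_lt_top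

end

/-! ### The surface area measure as first variation of the volume -/

section bodies
variable {K : ConvexBody (Eucl n)} (hK : ∀ v, 0 < supportMap K v)
include hK

theorem frontier_eq : frontier (K : Set (Eucl n)) = {x | wgauge (supportMap K) x = 1} := by
  have hc := continuous_wgauge hK
  rw [coe_eq_wgauge hK]
  refine Set.Subset.antisymm (frontier_le_subset_eq hc continuous_const) fun x hx => ?_
  refine ⟨subset_closure (le_of_eq hx), fun hi => ?_⟩
  have h1 : Tendsto (fun t : ℝ => t • x) (𝓝[>] 1) (𝓝 x) := by
    have : Continuous fun t : ℝ => t • x := by fun_prop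
    simpa using (this.tendsto 1).mono_left nhdsWithin_le_nhds
  obtain ⟨t, ht, ht1⟩ := ((h1.eventually (mem_interior_iff_mem_nhds.1 hi)).and
    self_mem_nhdsWithin).exists
  have ht1 : 1 < t := ht1
  have hx : wgauge (supportMap K) x = 1 := hx
  change wgauge (supportMap K) (t • x) ≤ 1 at ht
  rw [wgauge_smul hK (by linarith), hx] at ht
  linarith

theorem isOuterNormal_iff {y : Eucl n} (hy : wgauge (supportMap K) y = 1) (u : Sph n) :
    IsOuterNormal K y u ↔ inner ℝ y (u : Eucl n) / supportMap K u = wgauge (supportMap K) y := by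
  rw [hy, div_eq_one_iff_eq (hK u).ne']; rfl

theorem regularBoundary_eq : regularBoundary K = regSet (supportMap K) := by
  ext y
  rw [regularBoundary, frontier_eq hK]
  constructor
  · rintro ⟨h1, u, h2, h3⟩
    refine ⟨h1, fun v hv => ?_⟩
    rw [h3 v ((isOuterNormal_iff hK h1 v).2 hv),
      h3 _ ((isOuterNormal_iff hK h1 _).2 (wgauge_eq hK y).symm)]
  · rintro ⟨h1, h2⟩
    exact ⟨h1, normalDir _ y, (isOuterNormal_iff hK h1 _).2 (wgauge_eq hK y).symm,
      fun v hv => h2 v ((isOuterNormal_iff hK h1 v).1 hv)⟩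

theorem gaussMap_eq {y : Eucl n} (hy : y ∈ regularBoundary K) :
    gaussMap K y = normalDir (supportMap K) y := by
  have h1 : wgauge (supportMap K) y = 1 := by rw [regularBoundary_eq hK] at hy; exact hy.1
  rw [gaussMap, dif_pos hy]
  have h2 := hy.2.choose_spec
  exact (h2.2 _ ((isOuterNormal_iff hK h1 _).2 (wgauge_eq hK y).symm)).symm

/-- The surface area measure represents the first variation of the volume. -/
theorem integral_surfaceAreaMeasure (g : C(Sph n, ℝ)) :
    ∫ u, g u ∂(surfaceAreaMeasure K) = firstVar (supportMap K) g := by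
  have hR := measurableSet_regSet hK
  have e : gaussMap K =ᵐ[(Measure.euclideanHausdorffMeasure n : Measure (Eucl n)).restrict
      (regularBoundary K)] normalDir (supportMap K) := by
    rw [regularBoundary_eq hK]
    filter_upwards [ae_restrict_mem hR] with y hy
    exact gaussMap_eq hK (by rwa [regularBoundary_eq hK])
  rw [surfaceAreaMeasure, Measure.map_congr e, regularBoundary_eq hK,
    integral_map (aemeasurable_normalDir_regSet hK) g.continuous.aestronglyMeasurable,
    firstVar_eq_integral_regSet hK]

end bodies

/-! ### Homogeneous functions, smooth away from the origin -/

/-- Smooth away from the origin. -/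
abbrev SmoothOff (f : Eucl n → ℝ) : Prop := ContDiffOn ℝ ∞ f {0}ᶜ

section smooth
variable {f : Eucl n → ℝ}

theorem SmoothOff.contDiffAt (hf : SmoothOff f) {x : Eucl n} (hx : x ≠ 0) : ContDiffAt ℝ ∞ f x :=
  ContDiffOn.contDiffAt hf (isOpen_compl_singleton.mem_nhds hx)

theorem SmoothOff.differentiableAt (hf : SmoothOff f) {x : Eucl n} (hx : x ≠ 0) :
    DifferentiableAt ℝ f x := (hf.contDiffAt hx).differentiableAt (by simp)

theorem SmoothOff.contDiffAt_fderiv (hf : SmoothOff f) {x : Eucl n} (hx : x ≠ 0) :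
    ContDiffAt ℝ ∞ (fderiv ℝ f) x := (hf.contDiffAt hx).fderiv_right (by simp)

theorem SmoothOff.differentiableAt_fderiv (hf : SmoothOff f) {x : Eucl n} (hx : x ≠ 0) :
    DifferentiableAt ℝ (fderiv ℝ f) x := (hf.contDiffAt_fderiv hx).differentiableAt (by simp)

theorem SmoothOff.fderiv_fderiv_comm (hf : SmoothOff f) {x : Eucl n} (hx : x ≠ 0) (v w : Eucl n) :
    fderiv ℝ (fderiv ℝ f) x v w = fderiv ℝ (fderiv ℝ f) x w v :=
  ((hf.contDiffAt hx).isSymmSndFDerivAt (by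
    rw [minSmoothness_of_isRCLikeNormedField]; exact ENat.LEInfty.out)) v w

theorem SmoothOff.continuous_hessianMatrix (hf : SmoothOff f) :
    Continuous fun u : Sph n => hessianMatrix f u := by
  refine continuous_matrix fun i j => ?_
  refine continuous_iff_continuousAt.2 fun u => ?_
  have h1 : ContinuousAt (fderiv ℝ (fderiv ℝ f)) (u : Eucl n) :=
    ((hf.contDiffAt_fderiv (sph_ne_zero u)).fderiv_right (m := ∞) (by simp)).continuousAt
  have h2 := h1.comp (f := fun u : Sph n => (u : Eucl n)) continuous_subtype_val.continuousAt
  exact (h2.clm_apply continuousAt_const).clm_apply continuousAt_const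

theorem SmoothOff.continuous_gradVec (hf : SmoothOff f) :
    Continuous fun u : Sph n => gradVec f u := by
  refine continuous_pi fun i => ?_
  refine continuous_iff_continuousAt.2 fun u => ?_
  have h1 : ContinuousAt (fderiv ℝ f) (u : Eucl n) :=
    (hf.contDiffAt_fderiv (sph_ne_zero u)).continuousAt
  have h2 := h1.comp (f := fun u : Sph n => (u : Eucl n)) continuous_subtype_val.continuousAt
  exact h2.clm_apply continuousAt_const

theorem sum_smul_stdVec (v : Eucl n) : ∑ i, v i • stdVec i = v := by
  have := (EuclideanSpace.basisFun (Fin (n + 1)) ℝ).sum_repr v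
  simpa [stdVec] using this

theorem SmoothOff.hessianMatrix_mulVec (v : Eucl n) (x : Eucl n) (i : Fin (n + 1)) :
    (hessianMatrix f x).mulVec v i = fderiv ℝ (fderiv ℝ f) x (stdVec i) v := by
  conv_rhs => rw [← sum_smul_stdVec v]
  simp [Matrix.mulVec, dotProduct, hessianMatrix, mul_comm]

theorem dotProduct_hessianMatrix_mulVec (v w : Eucl n) (x : Eucl n) :
    (w : Fin (n + 1) → ℝ) ⬝ᵥ (hessianMatrix f x).mulVec v = fderiv ℝ (fderiv ℝ f) x w v := by
  conv_rhs => rw [← sum_smul_stdVec w]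
  simp [dotProduct, SmoothOff.hessianMatrix_mulVec]

theorem SmoothOff.hessianMatrix_transpose (hf : SmoothOff f) {x : Eucl n} (hx : x ≠ 0) :
    (hessianMatrix f x).transpose = hessianMatrix f x := by
  ext i j
  exact hf.fderiv_fderiv_comm hx _ _

section homogeneous
variable (hom : ∀ t : ℝ, 0 < t → ∀ x, f (t • x) = t * f x)
include hom

theorem fderiv_smul_of_homogeneous {t : ℝ} (ht : 0 < t) (x : Eucl n) :
    fderiv ℝ f (t • x) = fderiv ℝ f x := by
  have h1 := fderiv_comp_smul (𝕜 := ℝ) (f := f) (x := x) t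
  have h2 : (fun y => f (t • y)) = t • f := by
    funext y; exact hom t ht y
  rw [h2, fderiv_const_smul_field] at h1
  exact (smul_right_injective _ ht.ne' h1).symm

theorem fderiv_fderiv_smul_of_homogeneous {t : ℝ} (ht : 0 < t) (x : Eucl n) :
    t • fderiv ℝ (fderiv ℝ f) (t • x) = fderiv ℝ (fderiv ℝ f) x := by
  have h1 := fderiv_comp_smul (𝕜 := ℝ) (f := fderiv ℝ f) (x := x) t
  have h2 : (fun y => fderiv ℝ f (t • y)) = fderiv ℝ f := by
    funext y; exact fderiv_smul_of_homogeneous hom ht y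
  rw [h2] at h1
  exact h1.symm

theorem SmoothOff.fderiv_self (hf : SmoothOff f) {x : Eucl n} (hx : x ≠ 0) :
    fderiv ℝ f x x = f x := by
  have h1 : HasDerivAt (fun t : ℝ => f (t • x)) (fderiv ℝ f x x) 1 := by
    have h2 : HasDerivAt (fun t : ℝ => t • x) x 1 := by
      simpa using (hasDerivAt_id (1 : ℝ)).smul_const x
    have h3 : HasFDerivAt f (fderiv ℝ f x) ((1 : ℝ) • x) := by
      rw [one_smul]; exact (hf.differentiableAt hx).hasFDerivAt
    exact h3.comp_hasDerivAt (1 : ℝ) h2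
  have h4 : HasDerivAt (fun t : ℝ => f (t • x)) (f x) 1 := by
    have : HasDerivAt (fun t : ℝ => t * f x) (f x) 1 := by
      simpa using (hasDerivAt_id (1 : ℝ)).mul_const (f x)
    refine this.congr_of_eventuallyEq ?_
    filter_upwards [eventually_gt_nhds (zero_lt_one (α := ℝ))] with t ht using hom t ht x
  exact h1.unique h4

theorem SmoothOff.fderiv_fderiv_self (hf : SmoothOff f) {x : Eucl n} (hx : x ≠ 0) :
    fderiv ℝ (fderiv ℝ f) x x = 0 := by
  have h1 : HasDerivAt (fun t : ℝ => fderiv ℝ f (t • x)) (fderiv ℝ (fderiv ℝ f) x x) 1 := by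
    have h2 : HasDerivAt (fun t : ℝ => t • x) x 1 := by
      simpa using (hasDerivAt_id (1 : ℝ)).smul_const x
    have h3 : HasFDerivAt (fderiv ℝ f) (fderiv ℝ (fderiv ℝ f) x) ((1 : ℝ) • x) := by
      rw [one_smul]; exact (hf.differentiableAt_fderiv hx).hasFDerivAt
    exact h3.comp_hasDerivAt (1 : ℝ) h2
  have h4 : HasDerivAt (fun t : ℝ => fderiv ℝ f (t • x)) 0 1 := by
    refine (hasDerivAt_const (1 : ℝ) (fderiv ℝ f x)).congr_of_eventuallyEq ?_
    filter_upwards [eventually_gt_nhds (zero_lt_one (α := ℝ))] with t ht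
      using fderiv_smul_of_homogeneous hom ht x
  exact h1.unique h4

theorem SmoothOff.hessianMatrix_mulVec_self (hf : SmoothOff f) {x : Eucl n} (hx : x ≠ 0) :
    (hessianMatrix f x).mulVec x = 0 := by
  funext i
  rw [SmoothOff.hessianMatrix_mulVec, hf.fderiv_fderiv_comm hx, hf.fderiv_fderiv_self hom hx]; rfl

end homogeneous
end smooth

/-- The matrix `A + x ⊗ x`. -/
def addRadial (A : Matrix (Fin (n + 1)) (Fin (n + 1)) ℝ) (x : Eucl n) :
    Matrix (Fin (n + 1)) (Fin (n + 1)) ℝ := A + Matrix.vecMulVec (fun i => x i) (fun i => x i)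

theorem dotProduct_sph (u : Sph n) : (u : Eucl n) ⬝ᵥ (u : Eucl n) = (1 : ℝ) := by
  have h := real_inner_self_eq_norm_sq (u : Eucl n)
  rw [norm_sph, one_pow, PiLp.inner_apply] at h
  simpa [dotProduct, sq] using h

/-- Since A is symmetric and kills u, the row vector u is fixed by A + u ⊗ u. So A + p ⊗ u is the
product of 1 + (p - u) ⊗ u and A + u ⊗ u, and the first factor is a rank one perturbation of the
identity. -/
theorem det_add_vecMulVec {A : Matrix (Fin (n + 1)) (Fin (n + 1)) ℝ} (hA : A.transpose = A)
    (u : Sph n) (hu : A.mulVec (u : Eucl n) = 0) (p : Fin (n + 1) → ℝ) :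
    (A + Matrix.vecMulVec p (u : Eucl n)).det = (p ⬝ᵥ (u : Eucl n)) * (addRadial A u).det := by
  have e1 : Matrix.vecMul (u : Eucl n) (addRadial A (u : Eucl n)) = (u : Eucl n) := by
    rw [addRadial, Matrix.vecMul_add, ← Matrix.mulVec_transpose, hA, hu, zero_add,
      Matrix.vecMul_vecMulVec, dotProduct_sph, one_smul]
  have e2 : A + Matrix.vecMulVec p (u : Eucl n) =
      (1 + Matrix.vecMulVec (p - (u : Eucl n).ofLp) (u : Eucl n)) * addRadial A (u : Eucl n) := by
    rw [add_mul, one_mul, Matrix.vecMulVec_mul, e1, addRadial, Matrix.sub_vecMulVec]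
    change _ = A + Matrix.vecMulVec (u : Eucl n) (u : Eucl n) + _
    abel
  rw [e2, Matrix.det_mul, Matrix.vecMulVec_eq Unit,
    Matrix.det_one_add_replicateCol_mul_replicateRow, dotProduct_sub, dotProduct_sph, dotProduct_comm]
  ring

/-! ### Smooth support functions -/

section support
variable {K : ConvexBody (Eucl n)} (hK : SmoothOff (supportFn K))
include hK

omit hK in
theorem supportFn_homogeneous (K : ConvexBody (Eucl n)) :
    ∀ t : ℝ, 0 < t → ∀ x, supportFn K (t • x) = t * supportFn K x :=
  fun _ ht x => supportFn_smul K ht.le x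

/-- The linear function ⟨·, y⟩ lies below the support function and touches it at x. -/
theorem gradient_supportFn_eq {x : Eucl n} (hx : x ≠ 0) {y : Eucl n} (hy : y ∈ K)
    (hxy : inner ℝ x y = supportFn K x) : gradient (supportFn K) x = y := by
  have hmin : IsLocalMin (fun w => supportFn K w - inner ℝ w y) x :=
    Filter.Eventually.of_forall fun w => by
      simp only [hxy, sub_self]
      exact sub_nonneg.2 (inner_le_supportFn K hy w)
  have hd : HasFDerivAt (fun w : Eucl n => inner ℝ w y) (innerSL ℝ y) x := by
    refine ((innerSL ℝ y).hasFDerivAt (x := x)).congr_of_eventuallyEq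
      (Filter.Eventually.of_forall fun w => ?_)
    exact real_inner_comm _ _
  have h0 := hmin.hasFDerivAt_eq_zero ((hK.differentiableAt hx).hasFDerivAt.sub hd)
  refine ext_inner_right ℝ fun v => ?_
  rw [inner_gradient_left, sub_eq_zero.1 h0]; rfl

theorem gradient_supportFn_mem {x : Eucl n} (hx : x ≠ 0) :
    gradient (supportFn K) x ∈ K ∧ inner ℝ x (gradient (supportFn K) x) = supportFn K x := by
  obtain ⟨y, hy, hxy⟩ := exists_eq_supportFn K x
  rw [gradient_supportFn_eq hK hx hy hxy]
  exact ⟨hy, hxy⟩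

/-- Monotonicity of the gradient: the gradients at x and at x + t v are points of K that maximize
their respective linear functions, and adding the two inequalities bounds the difference quotient
below by 0. -/
theorem hessian_supportFn_nonneg {x : Eucl n} (hx : x ≠ 0) (v : Eucl n) :
    0 ≤ fderiv ℝ (fderiv ℝ (supportFn K)) x v v := by
  set f := supportFn K with hf
  have hline : HasDerivAt (fun t : ℝ => x + t • v) v 0 := by
    simpa using ((hasDerivAt_id (0 : ℝ)).smul_const v).const_add x
  have h1 : HasDerivAt (fun t : ℝ => fderiv ℝ f (x + t • v) v)
      (fderiv ℝ (fderiv ℝ f) x v v) 0 := by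
    have h3 : HasFDerivAt (fderiv ℝ f) (fderiv ℝ (fderiv ℝ f) x) (x + (0 : ℝ) • v) := by
      rw [zero_smul, add_zero]; exact (hK.differentiableAt_fderiv hx).hasFDerivAt
    have h4 := h3.comp_hasDerivAt (0 : ℝ) hline
    simpa using h4.clm_apply (hasDerivAt_const (0 : ℝ) v)
  have h2 := (hasDerivAt_iff_tendsto_slope.1 h1).mono_left
    (nhdsWithin_mono (0 : ℝ) (t := {0}ᶜ) (s := Set.Ioi 0) fun t (ht : 0 < t) => ht.ne')
  refine ge_of_tendsto h2 ?_
  have hne : ∀ᶠ t : ℝ in 𝓝[>] 0, x + t • v ≠ 0 := by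
    have : Tendsto (fun t : ℝ => x + t • v) (𝓝 0) (𝓝 x) := by
      simpa using hline.continuousAt.tendsto
    exact (this.mono_left nhdsWithin_le_nhds).eventually_ne hx
  filter_upwards [hne, self_mem_nhdsWithin] with t ht (ht0 : 0 < t)
  rw [slope_def_field, sub_zero, zero_smul, add_zero]
  refine div_nonneg ?_ ht0.le
  obtain ⟨m1, e1⟩ := gradient_supportFn_mem hK hx
  obtain ⟨m2, e2⟩ := gradient_supportFn_mem hK ht
  have i1 := inner_le_supportFn K m1 (x + t • v)
  have i2 := inner_le_supportFn K m2 x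
  rw [← e2] at i1
  rw [← e1] at i2
  rw [← inner_gradient_left, ← inner_gradient_left, ← inner_sub_left]
  simp only [inner_add_left, inner_smul_left, conj_trivial] at i1
  have : 0 ≤ t * inner ℝ (gradient f (x + t • v) - gradient f x) v := by
    rw [inner_sub_left, real_inner_comm v, real_inner_comm v]
    nlinarith
  exact nonneg_of_mul_nonneg_right this ht0

theorem posSemidef_hessian (u : Sph n) :
    (hessianMatrix (supportFn K) (u : Eucl n)).PosSemidef := by
  refine Matrix.PosSemidef.of_dotProduct_mulVec_nonneg ?_ fun v => ?_
  · rw [Matrix.IsHermitian, Matrix.conjTranspose_eq_transpose_of_trivial]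
    exact hK.hessianMatrix_transpose (sph_ne_zero u)
  · have := dotProduct_hessianMatrix_mulVec (f := supportFn K) (WithLp.toLp 2 v) (WithLp.toLp 2 v)
      (u : Eucl n)
    simp only [star_trivial]
    exact this ▸ hessian_supportFn_nonneg hK (sph_ne_zero u) _

theorem posSemidef_addRadial_hessian (u : Sph n) :
    (addRadial (hessianMatrix (supportFn K) (u : Eucl n)) u).PosSemidef := by
  refine (posSemidef_hessian hK u).add ?_
  have := Matrix.posSemidef_vecMulVec_self_star (R := ℝ) (fun i => (u : Eucl n) i)
  simpa using this

end support

/-! ### The change of variables x ↦ ‖x‖ ∇h(x) -/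

theorem hasFDerivAt_norm_of_ne_zero {x : Eucl n} (hx : x ≠ 0) :
    HasFDerivAt (fun y : Eucl n => ‖y‖) (‖x‖⁻¹ • innerSL ℝ x) x := by
  have h1 := (hasStrictFDerivAt_norm_sq x).hasFDerivAt.sqrt (pow_ne_zero 2 (norm_ne_zero_iff.2 hx))
  simp only [Real.sqrt_sq (norm_nonneg _)] at h1
  refine h1.congr_fderiv ?_
  ext v
  simp only [FunLike.coe_smul, Pi.smul_apply, smul_eq_mul, innerSL_apply_apply]
  have := norm_ne_zero_iff.2 hx
  rw [nsmul_eq_mul]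
  field_simp
  simp

theorem det_toLpLin (M : Matrix (Fin (n + 1)) (Fin (n + 1)) ℝ) :
    (LinearMap.toContinuousLinearMap (Matrix.toLpLin 2 2 M : Eucl n →ₗ[ℝ] Eucl n)).det = M.det := by
  rw [ContinuousLinearMap.det, LinearMap.coe_toContinuousLinearMap, Matrix.toLpLin_eq_toLin,
    LinearMap.det_toLin]

theorem gradient_apply (f : Eucl n → ℝ) (x : Eucl n) (i : Fin (n + 1)) :
    gradient f x i = gradVec f x i := by
  have h : inner ℝ (gradient f x) (stdVec i) = fderiv ℝ f x (stdVec i) := inner_gradient_left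
  rw [stdVec, EuclideanSpace.inner_single_right] at h
  simpa [gradVec, stdVec] using h

theorem gradVec_dotProduct (f : Eucl n → ℝ) (x v : Eucl n) :
    gradVec f x ⬝ᵥ v = fderiv ℝ f x v := by
  have h : fderiv ℝ f x (∑ i, v i • stdVec i) = gradVec f x ⬝ᵥ v := by
    rw [map_sum]
    simp [dotProduct, gradVec, mul_comm]
  rw [← h, sum_smul_stdVec]

/-- The Jacobian matrix of `x ↦ ‖x‖ ∇f(x)`. -/
def normalJacobian (f : Eucl n → ℝ) (x : Eucl n) : Matrix (Fin (n + 1)) (Fin (n + 1)) ℝ :=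
  ‖x‖ • hessianMatrix f x + Matrix.vecMulVec (gradVec f x) (dir x : Eucl n)

theorem hasFDerivAt_norm_smul_gradient {f : Eucl n → ℝ} (hf : SmoothOff f) {x : Eucl n}
    (hx : x ≠ 0) (s : Set (Eucl n)) : HasFDerivWithinAt (fun y => ‖y‖ • gradient f y)
      (LinearMap.toContinuousLinearMap
        (Matrix.toLpLin 2 2 (normalJacobian f x) : Eucl n →ₗ[ℝ] Eucl n)) s x := by
  rw [hasFDerivWithinAt_euclidean]
  intro i
  have h1 : HasFDerivAt (fun y => ‖y‖ * fderiv ℝ f y (stdVec i)) _ x :=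
    (hasFDerivAt_norm_of_ne_zero hx).mul
      ((hf.differentiableAt_fderiv hx).hasFDerivAt.clm_apply (hasFDerivAt_const (stdVec i) x))
  have h2 : (fun y => (‖y‖ • gradient f y) i) = fun y => ‖y‖ * fderiv ℝ f y (stdVec i) := by
    funext y
    simp [gradient_apply, gradVec]
  rw [h2]
  refine (h1.congr_fderiv ?_).hasFDerivWithinAt
  ext v
  have e3 : (Matrix.toLpLin 2 2 (normalJacobian f x) v) i =
      ‖x‖ * (hessianMatrix f x).mulVec v i + gradVec f x i * ((dir x : Eucl n) ⬝ᵥ v) := by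
    rw [Matrix.ofLp_toLpLin, Matrix.toLin'_apply, normalJacobian, Matrix.add_mulVec,
      Matrix.smul_mulVec, Matrix.vecMulVec_mulVec]
    simp [mul_comm]
  have e4 : (dir x : Eucl n) ⬝ᵥ v = ‖x‖⁻¹ * inner ℝ x v := by
    rw [coe_dir hx, PiLp.inner_apply]
    simp only [dotProduct, PiLp.smul_apply, smul_eq_mul, Finset.mul_sum]
    refine Finset.sum_congr rfl fun i _ => ?_
    simp only [RCLike.inner_apply, conj_trivial]
    ring
  change _ = (Matrix.toLpLin 2 2 (normalJacobian f x) v) i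
  rw [e3, e4, SmoothOff.hessianMatrix_mulVec, hf.fderiv_fderiv_comm hx]
  simp [gradVec]

/-- By Euler's relations D²f kills the radial direction and ∇f(u) · u = f(u), so the rank one
formula applies with p = ∇f(u). Homogeneity moves the point from x to the sphere. -/
theorem det_normalJacobian {f : Eucl n → ℝ} (hf : SmoothOff f)
    (hom : ∀ t : ℝ, 0 < t → ∀ x, f (t • x) = t * f x) {x : Eucl n} (hx : x ≠ 0) :
    (normalJacobian f x).det =
      f (dir x : Eucl n) * (addRadial (hessianMatrix f (dir x : Eucl n)) (dir x)).det := by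
  have hpos : 0 < ‖x‖ := norm_pos_iff.2 hx
  have e1 : ‖x‖ • hessianMatrix f x = hessianMatrix f (dir x : Eucl n) := by
    ext i j
    have := fderiv_fderiv_smul_of_homogeneous hom hpos (dir x : Eucl n)
    rw [norm_smul_dir] at this
    simp only [Matrix.smul_apply, hessianMatrix, Matrix.of_apply, ← this]
    rfl
  have e2 : gradVec f x = gradVec f (dir x : Eucl n) := by
    have := fderiv_smul_of_homogeneous hom hpos (dir x : Eucl n)
    rw [norm_smul_dir] at this
    funext i
    simp only [gradVec, this]
  have e3 : gradVec f (dir x : Eucl n) ⬝ᵥ (dir x : Eucl n) = f (dir x : Eucl n) := by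
    rw [gradVec_dotProduct, hf.fderiv_self hom (sph_ne_zero (dir x))]
  rw [normalJacobian, e1, e2, det_add_vecMulVec (hf.hessianMatrix_transpose (sph_ne_zero _)) _
    (hf.hessianMatrix_mulVec_self hom (sph_ne_zero _)), e3]

/-- This makes the unit ball a Wulff shape, so that `integral_dir` applies to both sides of the
change of variables. -/
theorem wgauge_one (x : Eucl n) : wgauge (1 : C(Sph n, ℝ)) x = ‖x‖ := by
  have hh : ∀ v : Sph n, 0 < (1 : C(Sph n, ℝ)) v := fun v => one_pos
  refine le_antisymm ?_ ?_
  · rw [wgauge_eq hh, ContinuousMap.one_apply, div_one]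
    simpa [norm_sph] using real_inner_le_norm x (normalDir 1 x : Eucl n)
  · simpa using norm_div_le_wgauge hh x

section
variable {K : ConvexBody (Eucl n)}

/-- The map x ↦ ‖x‖ ∇h(x) takes the punctured unit ball onto the punctured body and the direction u
to the boundary point with normal u. Its Jacobian is h(u) det(D²h + u ⊗ u), and h(u) cancels the
denominator in `firstVar`. Injectivity is where unique normals enter; smoothness of h alone does not
exclude corners. -/
theorem firstVar_eq_integral_det_of_unique (hpos : ∀ v, 0 < supportMap K v)
    (hK : SmoothOff (supportFn K)) (huniq : ∀ y ∈ K, ∀ u v : Sph n,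
      inner ℝ y (u : Eucl n) = supportMap K u → inner ℝ y (v : Eucl n) = supportMap K v → u = v)
    (g : C(Sph n, ℝ)) :
    firstVar (supportMap K) g = ∫ u : Sph n,
      g u * (addRadial (hessianMatrix (supportFn K) u) u).det
        ∂((volume : Measure (Eucl n)).toSphere) := by
  set h := supportMap K with hh
  set f := supportFn K with hf
  have hom := supportFn_homogeneous K
  have hN : ((n : ℝ) + 1) ≠ 0 := by positivity
  set Φ : Eucl n → Eucl n := fun x => ‖x‖ • gradient f x with hΦ
  have hy0 : ∀ {y : Eucl n}, y ≠ 0 → (wgauge h y)⁻¹ • y ∈ K := fun {y} hy => by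
    have hg := wgauge_pos hpos hy
    have : (wgauge h y)⁻¹ • y ∈ (K : Set (Eucl n)) := by
      rw [coe_eq_wgauge hpos]
      exact (by rw [Set.mem_ofPred_eq, wgauge_smul hpos (inv_pos.2 hg).le, inv_mul_cancel₀ hg.ne'])
    exact this
  have huq : ∀ {y : Eucl n} {u : Sph n}, y ≠ 0 → inner ℝ y (u : Eucl n) / h u = wgauge h y →
      u = normalDir h y := by
    intro y u hy hu
    have hg := wgauge_pos hpos hy
    have key : ∀ w : Sph n, inner ℝ y (w : Eucl n) / h w = wgauge h y →
        inner ℝ ((wgauge h y)⁻¹ • y) (w : Eucl n) = h w := by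
      intro w hw
      rw [inner_smul_left, conj_trivial, ← hw]
      have h1 := (hpos w).ne'
      have h2 : inner ℝ y (w : Eucl n) ≠ 0 := by
        intro h0; rw [h0, zero_div] at hw; exact hg.ne hw
      field_simp
    exact huniq _ (hy0 hy) u _ (key u hu) (key _ (wgauge_eq hpos y).symm)
  have hgrad : ∀ {x : Eucl n}, x ≠ 0 → wgauge h (gradient f x) = 1 ∧
      inner ℝ (gradient f x) (dir x : Eucl n) / h (dir x) = 1 := by
    intro x hx
    obtain ⟨m1, -⟩ := gradient_supportFn_mem hK hx
    have e2 : inner ℝ (gradient f x) (dir x : Eucl n) = h (dir x) := by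
      have h1 : inner ℝ (gradient f x) x = ‖x‖ * h (dir x) := by
        rw [real_inner_comm, (gradient_supportFn_mem hK hx).2]; exact supportFn_eq K x
      rw [coe_dir hx, inner_smul_right, h1, inv_mul_cancel_left₀ (norm_ne_zero_iff.2 hx)]
    have e3 : inner ℝ (gradient f x) (dir x : Eucl n) / h (dir x) = 1 := by
      rw [e2, div_self (hpos _).ne']
    refine ⟨le_antisymm ?_ (e3 ▸ le_wgauge hpos _ _), e3⟩
    have : gradient f x ∈ (K : Set (Eucl n)) := m1
    rw [coe_eq_wgauge hpos] at this
    exact this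
  have hgrad0 : ∀ {x : Eucl n}, x ≠ 0 → gradient f x ≠ 0 := fun {x} hx h0 => by
    have := (hgrad hx).1
    rw [h0, wgauge_zero hpos] at this
    exact zero_ne_one this
  have hΦγ : ∀ {x : Eucl n}, x ≠ 0 → wgauge h (Φ x) = ‖x‖ := fun {x} hx => by
    rw [hΦ, wgauge_smul hpos (norm_nonneg _), (hgrad hx).1, mul_one]
  have hnd : ∀ {x : Eucl n} {t : ℝ}, x ≠ 0 → 0 < t → normalDir h (t • gradient f x) = dir x := by
    intro x t hx ht
    refine (huq (smul_ne_zero ht.ne' (hgrad0 hx)) ?_).symm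
    rw [inner_smul_left, conj_trivial, mul_div_assoc, (hgrad hx).2, wgauge_smul hpos ht.le,
      (hgrad hx).1]
  have hinj : Set.InjOn Φ (({0}ᶜ : Set (Eucl n)) ∩ {x | ‖x‖ ≤ 1}) := by
    intro x hx y hy hxy
    have hx0 : x ≠ 0 := hx.1
    have hy0 : y ≠ 0 := hy.1
    have e1 : ‖x‖ = ‖y‖ := by rw [← hΦγ hx0, ← hΦγ hy0, hxy]
    have e2 : dir x = dir y := by
      rw [← hnd hx0 (norm_pos_iff.2 hx0), ← hnd hy0 (norm_pos_iff.2 hy0)]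
      exact congrArg _ hxy
    rw [← norm_smul_dir x, ← norm_smul_dir y, e1, e2]
  have himg : Φ '' (({0}ᶜ : Set (Eucl n)) ∩ {x | ‖x‖ ≤ 1}) =
      ({0}ᶜ : Set (Eucl n)) ∩ {x | wgauge h x ≤ 1} := by
    ext y
    constructor
    · rintro ⟨x, ⟨hx0, hx1⟩, rfl⟩
      have hx0 : x ≠ 0 := hx0
      exact ⟨smul_ne_zero (norm_ne_zero_iff.2 hx0) (hgrad0 hx0), by
        rw [Set.mem_ofPred_eq, hΦγ hx0]; exact hx1⟩
    · rintro ⟨hy, hy1⟩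
      have hy : y ≠ 0 := hy
      have hg := wgauge_pos hpos hy
      set u := normalDir h y with hu
      have e1 : gradient f (u : Eucl n) = (wgauge h y)⁻¹ • y := by
        refine gradient_supportFn_eq hK (sph_ne_zero u) (hy0 hy) ?_
        rw [inner_smul_right, real_inner_comm, wgauge_eq hpos, ← hu, inv_div]
        have h2 : inner ℝ y (u : Eucl n) ≠ 0 := by
          intro h0
          have := wgauge_eq hpos y
          rw [← hu, h0, zero_div] at this
          exact hg.ne' this
        rw [div_mul_cancel₀ _ h2]; rfl
      refine ⟨wgauge h y • (u : Eucl n), ⟨smul_ne_zero hg.ne' (sph_ne_zero u), ?_⟩, ?_⟩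
      · rw [Set.mem_ofPred_eq, norm_smul, norm_sph, mul_one, Real.norm_of_nonneg hg.le]; exact hy1
      · have e2 : gradient f (wgauge h y • (u : Eucl n)) = gradient f (u : Eucl n) := by
          rw [gradient, gradient, fderiv_smul_of_homogeneous hom hg]
        simp only [hΦ, e2, e1, norm_smul, norm_sph, mul_one, Real.norm_of_nonneg hg.le]
        rw [smul_smul, mul_inv_cancel₀ hg.ne', one_smul]
  have hsm : MeasurableSet (({0}ᶜ : Set (Eucl n)) ∩ {x | ‖x‖ ≤ 1}) :=
    (measurableSet_singleton _).compl.inter (measurableSet_le measurable_norm measurable_const)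
  have hae : ∀ s : Set (Eucl n), (({0}ᶜ : Set (Eucl n)) ∩ s : Set (Eucl n)) =ᵐ[volume] s := by
    intro s
    rw [Set.inter_comm, ← Set.sdiff_eq]
    exact sdiff_null_ae_eq_self (measure_singleton _)
  have hq : Continuous fun v => g v / h v := g.continuous.div h.continuous fun v => (hpos v).ne'
  have e1 := integral_dir hpos (f := fun u => g (normalDir h u) / h (normalDir h u))
    (hq.measurable.comp_aemeasurable (aemeasurable_normalDir hpos)).aestronglyMeasurable
  rw [← setIntegral_congr_set (hae _), ← himg, integral_image_eq_integral_abs_det_fderiv_smul volume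
    hsm (fun x hx => hasFDerivAt_norm_smul_gradient hK hx.1 _) hinj] at e1
  have e2 : ∫ x in ({0}ᶜ : Set (Eucl n)) ∩ {x | ‖x‖ ≤ 1}, |(LinearMap.toContinuousLinearMap
        (Matrix.toLpLin 2 2 (normalJacobian f x) : Eucl n →ₗ[ℝ] Eucl n)).det| •
        (g (normalDir h (dir (Φ x) : Eucl n)) / h (normalDir h (dir (Φ x) : Eucl n))) =
      ∫ x in ({0}ᶜ : Set (Eucl n)) ∩ {x | ‖x‖ ≤ 1},
        g (dir x) * (addRadial (hessianMatrix f (dir x : Eucl n)) (dir x)).det := by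
    refine setIntegral_congr_fun hsm fun x hx => ?_
    have hx0 : x ≠ 0 := hx.1
    have n0 := norm_pos_iff.2 hx0
    have hΦ0 : Φ x ≠ 0 := smul_ne_zero n0.ne' (hgrad0 hx0)
    have e3 : normalDir h (dir (Φ x) : Eucl n) = dir x := by
      rw [coe_dir hΦ0, hΦ, smul_smul]
      exact hnd hx0 (mul_pos (inv_pos.2 (norm_pos_iff.2 hΦ0)) n0)
    have e4 : 0 ≤ (addRadial (hessianMatrix f (dir x : Eucl n)) (dir x)).det :=
      (posSemidef_addRadial_hessian hK (dir x)).det_nonneg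
    have e5 : 0 < f (dir x : Eucl n) := hpos (dir x)
    simp only [det_toLpLin, det_normalJacobian hK hom hx0, e3, smul_eq_mul]
    rw [abs_of_nonneg (mul_nonneg e5.le e4)]
    have e6 : h (dir x) = f (dir x : Eucl n) := rfl
    rw [e6]
    field_simp
  have hdet : Continuous fun u : Sph n => g u * (addRadial (hessianMatrix f (u : Eucl n)) u).det := by
    refine g.continuous.mul (Continuous.matrix_det ?_)
    refine hK.continuous_hessianMatrix.add ?_
    refine Continuous.matrix_vecMulVec ?_ ?_
    · fun_prop
    · fun_prop
  have e7 := integral_dir (h := (1 : C(Sph n, ℝ))) (fun v => one_pos)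
    (f := fun u : Sph n => g u * (addRadial (hessianMatrix f (u : Eucl n)) u).det)
    hdet.aestronglyMeasurable
  simp only [wgauge_one, norm_sph, inv_one, one_pow, one_mul] at e7
  rw [e2, setIntegral_congr_set (hae _), e7] at e1
  exact (mul_left_cancel₀ (inv_ne_zero hN) e1).symm

end

/-! ### Minkowski combinations -/

open scoped Pointwise in
theorem supportFn_add (K L : ConvexBody (Eucl n)) (x : Eucl n) :
    supportFn (K + L) x = supportFn K x + supportFn L x := by
  refine le_antisymm (supportFn_le fun y hy => ?_) ?_
  · have hy : y ∈ (K : Set (Eucl n)) + (L : Set (Eucl n)) := by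
      rw [← ConvexBody.coe_add]; exact hy
    obtain ⟨a, ha, b, hb, rfl⟩ := hy
    rw [inner_add_right]
    exact add_le_add (inner_le_supportFn K ha x) (inner_le_supportFn L hb x)
  · obtain ⟨a, ha, h1⟩ := exists_eq_supportFn K x
    obtain ⟨b, hb, h2⟩ := exists_eq_supportFn L x
    rw [← h1, ← h2, ← inner_add_right]
    refine inner_le_supportFn (K + L) ?_ x
    have : a + b ∈ (K : Set (Eucl n)) + (L : Set (Eucl n)) := Set.add_mem_add ha hb
    rw [← ConvexBody.coe_add] at this
    exact this

open scoped Pointwise in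
theorem supportFn_smul_body {c : ℝ} (hc : 0 ≤ c) (K : ConvexBody (Eucl n)) (x : Eucl n) :
    supportFn (c • K) x = c * supportFn K x := by
  refine le_antisymm (supportFn_le fun y hy => ?_) ?_
  · have hy : y ∈ ((c • K : ConvexBody (Eucl n)) : Set (Eucl n)) := hy
    rw [ConvexBody.coe_smul] at hy
    obtain ⟨a, ha, rfl⟩ := hy
    rw [inner_smul_right]
    exact mul_le_mul_of_nonneg_left (inner_le_supportFn K ha x) hc
  · obtain ⟨a, ha, h1⟩ := exists_eq_supportFn K x
    rw [← h1, ← inner_smul_right]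
    refine inner_le_supportFn (c • K) ?_ x
    change c • a ∈ ((c • K : ConvexBody (Eucl n)) : Set (Eucl n))
    rw [ConvexBody.coe_smul]
    exact Set.smul_mem_smul_set ha

/-- The unit ball as a convex body. -/
def ballBody (n : ℕ) : ConvexBody (Eucl n) where
  carrier := Metric.closedBall 0 1
  convex' := convex_closedBall _ _
  isCompact' := isCompact_closedBall _ _
  nonempty' := ⟨0, by simp⟩

theorem mem_ballBody {x : Eucl n} : x ∈ ballBody n ↔ ‖x‖ ≤ 1 := by
  change x ∈ Metric.closedBall (0 : Eucl n) 1 ↔ _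
  simp

theorem supportFn_ballBody (x : Eucl n) : supportFn (ballBody n) x = ‖x‖ := by
  refine le_antisymm (supportFn_le fun y hy => ?_) ?_
  · have := real_inner_le_norm x y
    have h2 := mem_ballBody.1 hy
    nlinarith [norm_nonneg x]
  · have h1 : (dir x : Eucl n) ∈ ballBody n := mem_ballBody.2 (norm_sph _).le
    have := inner_le_supportFn _ h1 x
    have h2 : inner ℝ (‖x‖ • (dir x : Eucl n)) (dir x : Eucl n) = ‖x‖ := by
      rw [inner_smul_left, real_inner_self_eq_norm_sq, norm_sph]; simp
    rw [norm_smul_dir] at h2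
    rwa [h2] at this

theorem supportMap_add (K L : ConvexBody (Eucl n)) :
    supportMap (K + L) = supportMap K + supportMap L := by
  ext u; exact supportFn_add K L u

theorem supportMap_smul {c : ℝ} (hc : 0 ≤ c) (K : ConvexBody (Eucl n)) :
    supportMap (c • K) = c • supportMap K := by
  ext u; exact supportFn_smul_body hc K u

theorem supportMap_ballBody : supportMap (ballBody n) = 1 := by
  ext u; exact (supportFn_ballBody _).trans (norm_sph u)

/-! ### The Hessian matrix as a linear operation -/

theorem smoothOff_norm : SmoothOff (fun x : Eucl n => ‖x‖) :=
  fun _ hx => (contDiffAt_norm ℝ hx).contDiffWithinAt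

theorem hessianMatrix_add {f g : Eucl n → ℝ} (hf : SmoothOff f) (hg : SmoothOff g) {x : Eucl n}
    (hx : x ≠ 0) :
    hessianMatrix (fun x => f x + g x) x = hessianMatrix f x + hessianMatrix g x := by
  have e : fderiv ℝ (fun x => f x + g x) =ᶠ[𝓝 x] fun y => fderiv ℝ f y + fderiv ℝ g y := by
    filter_upwards [isOpen_compl_singleton.mem_nhds hx] with y hy
    exact fderiv_fun_add (hf.differentiableAt hy) (hg.differentiableAt hy)
  ext i j
  simp only [hessianMatrix, Matrix.of_apply, Matrix.add_apply]
  rw [e.fderiv_eq, fderiv_fun_add (hf.differentiableAt_fderiv hx) (hg.differentiableAt_fderiv hx)]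
  rfl

theorem hessianMatrix_const_mul {f : Eucl n → ℝ} (c : ℝ) (x : Eucl n) :
    hessianMatrix (fun x => c * f x) x = c • hessianMatrix f x := by
  have e : fderiv ℝ (fun x => c * f x) = c • fderiv ℝ f := by
    funext y
    exact congrFun (fderiv_const_smul_field (𝕜 := ℝ) (f := f) c) y
  have e2 : fderiv ℝ (c • fderiv ℝ f) x = c • fderiv ℝ (fderiv ℝ f) x :=
    congrFun (fderiv_const_smul_field (𝕜 := ℝ) (f := fderiv ℝ f) c) x
  ext i j
  simp only [hessianMatrix, Matrix.of_apply, Matrix.smul_apply]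
  rw [e, e2]
  rfl

theorem addRadial_add (A B : Matrix (Fin (n + 1)) (Fin (n + 1)) ℝ) (x : Eucl n) :
    addRadial (A + B) x = addRadial A x + B := by
  simp only [addRadial]; abel

theorem continuous_addRadial {A : Sph n → Matrix (Fin (n + 1)) (Fin (n + 1)) ℝ}
    (hA : Continuous A) : Continuous fun u : Sph n => addRadial (A u) u := by
  refine hA.add (Continuous.matrix_vecMulVec ?_ ?_)
  · fun_prop
  · fun_prop

open scoped Pointwise in
/-- For a smooth support function, the first variation is given by the determinant. -/
theorem firstVar_eq_integral_det {K : ConvexBody (Eucl n)} (hpos : ∀ v, 0 < supportMap K v)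
    (hK : SmoothOff (supportFn K)) (g : C(Sph n, ℝ)) :
    firstVar (supportMap K) g = ∫ u : Sph n,
      g u * (addRadial (hessianMatrix (supportFn K) u) u).det
        ∂((volume : Measure (Eucl n)).toSphere) := by
  set f := supportFn K with hf
  have hN : SmoothOff (fun x : Eucl n => ‖x‖) := smoothOff_norm
  -- Adding ε times the unit ball restores unique normals: a normal u at a + ε b forces b = u.
  -- Afterwards ε tends to 0, both sides being continuous in ε.
  have step : ∀ ε : ℝ, 0 < ε → firstVar (supportMap K + ε • (1 : C(Sph n, ℝ))) g =
      ∫ u : Sph n, g u * (addRadial (hessianMatrix f u) u +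
        ε • hessianMatrix (fun x : Eucl n => ‖x‖) u).det
        ∂((volume : Measure (Eucl n)).toSphere) := by
    intro ε hε
    have e1 : supportMap (K + ε • ballBody n) = supportMap K + ε • (1 : C(Sph n, ℝ)) := by
      rw [supportMap_add, supportMap_smul hε.le, supportMap_ballBody]
    have e2 : supportFn (K + ε • ballBody n) = fun x => f x + ε * ‖x‖ := by
      funext x
      rw [supportFn_add, supportFn_smul_body hε.le, supportFn_ballBody]
    have hs : SmoothOff (fun x : Eucl n => ε * ‖x‖) := contDiffOn_const.mul hN
    have e3 := firstVar_eq_integral_det_of_unique (K := K + ε • ballBody n)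
      (by
        intro v; rw [e1]
        have := hpos v
        change 0 < supportMap K v + ε * 1
        linarith)
      (by rw [e2]; exact hK.add hs) ?_ g
    · rw [e1, e2] at e3
      rw [e3]
      congr 1
      funext u
      rw [hessianMatrix_add hK hs (sph_ne_zero u), hessianMatrix_const_mul, addRadial_add]
    · intro y hy
      have hy : y ∈ ((K + ε • ballBody n : ConvexBody (Eucl n)) : Set (Eucl n)) := hy
      rw [ConvexBody.coe_add, ConvexBody.coe_smul] at hy
      obtain ⟨a, ha, _, ⟨b, hb, rfl⟩, rfl⟩ := hy
      have hb : ‖b‖ ≤ 1 := mem_ballBody.1 hb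
      have key : ∀ u : Sph n, inner ℝ (a + ε • b) (u : Eucl n) = supportMap (K + ε • ballBody n) u →
          b = u := by
        intro u hu
        rw [e1, inner_add_left, inner_smul_left, conj_trivial] at hu
        have h1 := inner_le_supportFn K ha (u : Eucl n)
        rw [real_inner_comm] at h1
        change _ = supportFn K u + ε * 1 at hu
        have h2 : ε * 1 ≤ ε * inner ℝ b (u : Eucl n) := by linarith
        have h3 := le_of_mul_le_mul_left h2 hε
        have h4 : ‖b - u‖ ^ 2 ≤ 0 := by
          rw [norm_sub_sq_real, norm_sph]
          nlinarith [norm_nonneg b]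
        have h5 := pow_eq_zero_iff (two_ne_zero) |>.1 (le_antisymm h4 (sq_nonneg _))
        exact sub_eq_zero.1 (norm_eq_zero.1 h5)
      intro u v hu hv
      exact Subtype.ext ((key u hu).symm.trans (key v hv))
  have lim1 : Tendsto (fun ε : ℝ => firstVar (supportMap K + ε • (1 : C(Sph n, ℝ))) g) (𝓝[>] 0)
      (𝓝 (firstVar (supportMap K) g)) := by
    refine tendsto_firstVar hpos ?_ tendsto_const_nhds
    have : Continuous fun ε : ℝ => supportMap K + ε • (1 : C(Sph n, ℝ)) := by fun_prop
    simpa using (this.tendsto 0).mono_left (nhdsWithin_le_nhds (s := Set.Ioi 0))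
  have hcont : Continuous fun ε : ℝ => ∫ u : Sph n, g u * (addRadial (hessianMatrix f u) u +
        ε • hessianMatrix (fun x : Eucl n => ‖x‖) u).det
        ∂((volume : Measure (Eucl n)).toSphere) := by
    have := continuous_parametric_integral_of_continuous (μ := (volume : Measure (Eucl n)).toSphere)
      (f := fun (ε : ℝ) (u : Sph n) => g u * (addRadial (hessianMatrix f u) u +
        ε • hessianMatrix (fun x : Eucl n => ‖x‖) u).det) ?_ isCompact_univ
    · simpa using this
    · refine (g.continuous.comp continuous_snd).mul (Continuous.matrix_det ?_)
      exact ((continuous_addRadial hK.continuous_hessianMatrix).comp continuous_snd).add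
        (continuous_fst.smul (hN.continuous_hessianMatrix.comp continuous_snd))
  have lim2 := (hcont.tendsto 0).mono_left (nhdsWithin_le_nhds (s := Set.Ioi 0))
  simp only [zero_smul, add_zero] at lim2
  refine tendsto_nhds_unique lim1 (lim2.congr' ?_)
  filter_upwards [self_mem_nhdsWithin] with ε hε using (step ε hε).symm

/-! ### Sublinear functions are support functions -/

/-- The body consists of all η whose linear function lies below F. The hypothesis says that F is
attained at every x by a member of it. -/
theorem exists_body_of_subgradient {F : Eucl n → ℝ} {M : ℝ} (hM : ∀ x, F x ≤ M * ‖x‖)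
    (hsub : ∀ x, ∃ η : Eucl n, inner ℝ x η = F x ∧ ∀ y, inner ℝ y η ≤ F y) :
    ∃ K : ConvexBody (Eucl n), supportFn K = F := by
  let S : Set (Eucl n) := {η | ∀ y, inner ℝ y η ≤ F y}
  have hS : S = ⋂ y : Eucl n, {η | inner ℝ y η ≤ F y} := by ext; simp [S]
  have hclosed : IsClosed S := by
    rw [hS]
    exact isClosed_iInter fun y => isClosed_le (by fun_prop) continuous_const
  have hbdd : S ⊆ Metric.closedBall 0 M := by
    intro η hη
    rw [mem_closedBall_zero_iff]
    have h1 := (hη η).trans (hM η)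
    rw [real_inner_self_eq_norm_sq] at h1
    by_contra! h2
    -- If η = 0 then M would be negative; testing a subgradient on a unit vector and on its negative
    -- excludes that.
    rcases (norm_nonneg η).eq_or_lt with h3 | h3
    · obtain ⟨ζ, -, hζ⟩ := hsub 0
      have h4 := (hζ (EuclideanSpace.single 0 1)).trans (hM _)
      have h5 := (hζ (-EuclideanSpace.single 0 1)).trans (hM _)
      rw [inner_neg_left, norm_neg] at h5
      simp only [PiLp.norm_single, norm_one, mul_one] at h4 h5
      linarith
    · nlinarith
  let K : ConvexBody (Eucl n) :=
    { carrier := S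
      convex' := by
        rw [hS]
        refine convex_iInter fun y => ?_
        intro a ha b hb s t hs ht hst
        simp only [Set.mem_ofPred_eq] at ha hb ⊢
        rw [inner_add_right, inner_smul_right, inner_smul_right]
        calc _ ≤ s * F y + t * F y := by gcongr
          _ = F y := by rw [← add_mul, hst, one_mul]
      isCompact' := (isCompact_closedBall 0 M).of_isClosed_subset hclosed hbdd
      nonempty' := by
        obtain ⟨η, -, hη⟩ := hsub 0
        exact ⟨η, hη⟩ }
  refine ⟨K, funext fun x => ?_⟩
  obtain ⟨η, h1, h2⟩ := hsub x
  refine le_antisymm (supportFn_le fun y (hy : y ∈ S) => hy x) ?_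
  rw [← h1]
  exact inner_le_supportFn K (show η ∈ S from h2) x

/-- Hahn–Banach extends c x ↦ c F(x) from the line through x below F and so supplies the
subgradients. -/
theorem exists_body_of_sublinear {F : Eucl n → ℝ} {M : ℝ} (hM : ∀ x, F x ≤ M * ‖x‖)
    (hom : ∀ t : ℝ, 0 < t → ∀ x, F (t • x) = t * F x)
    (hadd : ∀ x y, F (x + y) ≤ F x + F y) :
    ∃ K : ConvexBody (Eucl n), supportFn K = F := by
  have h0 : F 0 = 0 := by
    have := hom 2 two_pos 0
    rw [smul_zero] at this; linarith
  have key : ∀ f : Eucl n →ₗ.[ℝ] ℝ, (∀ x : f.domain, f x ≤ F x) →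
      ∃ η : Eucl n, (∀ x : f.domain, inner ℝ (x : Eucl n) η = f x) ∧ ∀ y, inner ℝ y η ≤ F y := by
    intro f hf
    obtain ⟨g, h1, h2⟩ := exists_extension_of_le_sublinear f F hom hadd hf
    have e : ∀ y, inner ℝ y ((InnerProductSpace.toDual ℝ (Eucl n)).symm
        (LinearMap.toContinuousLinearMap g)) = g y := fun y => by
      rw [real_inner_comm, InnerProductSpace.toDual_symm_apply]; rfl
    exact ⟨_, fun x => (e x).trans (h1 x), fun y => (e y).trans_le (h2 y)⟩
  refine exists_body_of_subgradient hM fun x => ?_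
  rcases eq_or_ne x 0 with rfl | hx
  · obtain ⟨η, -, h2⟩ := key (⟨⊥, 0⟩ : Eucl n →ₗ.[ℝ] ℝ) (by
      rintro ⟨x, hx⟩
      have : x = 0 := by simpa using hx
      subst this
      change (0 : ℝ) ≤ F 0
      exact h0.ge)
    exact ⟨η, by rw [inner_zero_left, h0], h2⟩
  · obtain ⟨η, h1, h2⟩ := key (LinearPMap.mkSpanSingleton x (F x) hx) (by
      rintro ⟨y, hy⟩
      obtain ⟨c, rfl⟩ := Submodule.mem_span_singleton.1 hy
      rw [LinearPMap.mkSpanSingleton'_apply, RingHom.id_apply, smul_eq_mul]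
      rcases lt_trichotomy c 0 with hc | rfl | hc
      · have h3 := hadd (c • x) ((-c) • x)
        rw [← add_smul, add_neg_cancel, zero_smul, h0, hom (-c) (by linarith)] at h3
        change c * F x ≤ F (c • x)
        linarith
      · simp [h0]
      · exact (hom c hc x).ge)
    refine ⟨η, ?_, h2⟩
    have := h1 ⟨x, Submodule.mem_span_singleton_self x⟩
    rw [LinearPMap.mkSpanSingleton_apply] at this
    exact this

theorem supportFn_add_le (K : ConvexBody (Eucl n)) (x y : Eucl n) :
    supportFn K (x + y) ≤ supportFn K x + supportFn K y :=
  supportFn_le fun z hz => by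
    rw [inner_add_left]
    exact add_le_add (inner_le_supportFn K hz x) (inner_le_supportFn K hz y)

theorem supportFn_le_norm (K : ConvexBody (Eucl n)) (x : Eucl n) :
    supportFn K x ≤ ‖supportMap K‖ * ‖x‖ := by
  rw [supportFn_eq, mul_comm]
  gcongr
  exact (le_abs_self _).trans ((supportMap K).norm_coe_le_norm _)

/-! ### Smoothing of support functions -/

/-- Averages of `f` over balls around `x` whose radius is proportional to `‖x‖`. -/
def radialAverage (f : Eucl n → ℝ) (φ : ContDiffBump (0 : Eucl n)) (x : Eucl n) : ℝ :=
  ∫ y, f (x + ‖x‖ • y) * φ.normed volume y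

theorem integrable_mul_normed {f : Eucl n → ℝ} (hf : Continuous f)
    (φ : ContDiffBump (0 : Eucl n)) : Integrable fun y => f y * φ.normed volume y :=
  (hf.mul φ.continuous_normed).integrable_of_hasCompactSupport φ.hasCompactSupport_normed.mul_left

/-- After substituting w = x + ‖x‖ y, the variable x occurs only in a kernel that is smooth away
from the origin, and the convolution theorem with parameters applies even though f is only
continuous. -/
theorem smoothOff_radialAverage {f : Eucl n → ℝ} (hf : Continuous f)
    (φ : ContDiffBump (0 : Eucl n)) : SmoothOff (radialAverage f φ) := by
  set ψ := φ.normed volume with hψ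
  let g : Eucl n → Eucl n → ℝ := fun x v => ‖x‖⁻¹ ^ (n + 1) * ψ (‖x‖⁻¹ • (-v - x))
  have e : ∀ x ∈ ({0}ᶜ : Set (Eucl n)), radialAverage f φ x =
      convolution f (g x) (ContinuousLinearMap.mul ℝ ℝ) volume 0 := by
    intro x hx
    have hx' : ‖x‖ ≠ 0 := norm_ne_zero_iff.2 hx
    have h1 := Measure.integral_comp_smul (volume : Measure (Eucl n))
      (fun y => f (x + y) * ψ (‖x‖⁻¹ • y)) ‖x‖
    have h2 := integral_sub_right_eq_self (μ := (volume : Measure (Eucl n)))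
      (fun y => f (x + y) * ψ (‖x‖⁻¹ • y)) x
    simp only [smul_smul, inv_mul_cancel₀ hx', one_smul] at h1
    rw [radialAverage, h1, ← h2, finrank_euclideanSpace, Fintype.card_fin, smul_eq_mul,
      ← integral_const_mul, convolution_def]
    congr 1
    funext w
    simp only [g, ContinuousLinearMap.mul_apply', zero_sub, neg_neg, add_sub_cancel]
    rw [abs_of_nonneg (by positivity), inv_pow]
    ring
  refine ContDiffOn.congr (fun x0 hx0 => ?_) e
  have hx0' : 0 < ‖x0‖ := norm_pos_iff.2 hx0
  have hs : IsOpen (Metric.ball x0 (‖x0‖ / 2)) := Metric.isOpen_ball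
  have hn : ∀ x ∈ Metric.ball x0 (‖x0‖ / 2), 0 < ‖x‖ ∧ ‖x‖ ≤ 2 * ‖x0‖ := by
    intro x hx
    rw [mem_ball_iff_norm] at hx
    have h1 := norm_sub_norm_le x x0
    have h2 := norm_sub_norm_le x0 x
    rw [norm_sub_rev] at h2
    constructor <;> linarith
  have h := contDiffOn_convolution_right_with_param_comp (μ := (volume : Measure (Eucl n)))
    (n := ⊤) (ContinuousLinearMap.mul ℝ ℝ) (v := fun _ => 0) contDiffOn_const (g := g) (f := f) hs
    (isCompact_closedBall (0 : Eucl n) ((1 + φ.rOut) * (2 * ‖x0‖))) ?_ hf.locallyIntegrable ?_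
  · exact (h.contDiffAt (hs.mem_nhds (Metric.mem_ball_self (by linarith)))).contDiffWithinAt
  · intro x v hx hv
    obtain ⟨hx1, hx2⟩ := hn x hx
    have : ψ (‖x‖⁻¹ • (-v - x)) = 0 := by
      rw [← Function.notMem_support, hψ, φ.support_normed_eq, mem_ball_zero_iff, norm_smul,
        norm_inv, norm_norm, not_lt]
      rw [mem_closedBall_zero_iff, not_le] at hv
      rw [inv_mul_eq_div, le_div_iff₀ hx1]
      have h3 : ‖v‖ ≤ ‖-v - x‖ + ‖x‖ := by
        calc ‖v‖ = ‖(-v - x) + x‖ := by simp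
          _ ≤ _ := norm_add_le _ _
      have h4 : (1 + φ.rOut) * ‖x‖ ≤ (1 + φ.rOut) * (2 * ‖x0‖) := by
        have := φ.rOut_pos
        gcongr
      linarith
    simp [g, this]
  · have h1 : ContDiffOn ℝ ∞ (fun q : Eucl n × Eucl n => ‖q.1‖⁻¹)
        (Metric.ball x0 (‖x0‖ / 2) ×ˢ Set.univ) := by
      intro q hq
      have hq1 := (hn q.1 hq.1).1
      have : ContDiffAt ℝ ∞ (fun q : Eucl n × Eucl n => ‖q.1‖) q :=
        ContDiffAt.norm ℝ contDiffAt_fst (norm_pos_iff.1 hq1)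
      exact (this.inv hq1.ne').contDiffWithinAt
    have h2 : ContDiff ℝ ∞ ψ := φ.contDiff_normed
    exact (h1.pow _).mul (h2.comp_contDiffOn (h1.smul (by fun_prop)))

/-- As a function of s the sum is convex and even, hence nondecreasing for s ≥ 0. -/
theorem supportFn_add_sub_mono (K : ConvexBody (Eucl n)) (x y : Eucl n) {s t : ℝ} (hs : 0 ≤ s)
    (hst : s ≤ t) : supportFn K (x + s • y) + supportFn K (x - s • y) ≤
      supportFn K (x + t • y) + supportFn K (x - t • y) := by
  rcases (hs.trans hst).eq_or_lt with ht | ht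
  · have : s = t := by linarith
    rw [this]
  have hq : s / t ≤ 1 := (div_le_one ht).2 hst
  have hq0 : 0 ≤ s / t := by positivity
  have hqt : s / t * t = s := div_mul_cancel₀ s ht.ne'
  have key : ∀ a b : ℝ, 0 ≤ a → 0 ≤ b → supportFn K (a • (x + t • y) + b • (x - t • y)) ≤
      a * supportFn K (x + t • y) + b * supportFn K (x - t • y) := fun a b ha hb =>
    (supportFn_add_le K _ _).trans_eq (by rw [supportFn_smul K ha, supportFn_smul K hb])
  have h1 := key ((1 + s / t) / 2) ((1 - s / t) / 2) (by linarith) (by linarith)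
  have h2 := key ((1 - s / t) / 2) ((1 + s / t) / 2) (by linarith) (by linarith)
  have e1 : ((1 + s / t) / 2) • (x + t • y) + ((1 - s / t) / 2) • (x - t • y) = x + s • y := by
    rw [show s • y = (s / t * t) • y by rw [hqt]]; module
  have e2 : ((1 - s / t) / 2) • (x + t • y) + ((1 + s / t) / 2) • (x - t • y) = x - s • y := by
    rw [show s • y = (s / t * t) • y by rw [hqt]]; module
  rw [e1] at h1
  rw [e2] at h2
  linarith

/-- Symmetrize with the even bump function. The averaging radius ‖x + y‖ can thus be enlarged to ‖x‖
+ ‖y‖, which is what subadditivity of the average requires. -/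
theorem integral_add_smul_mono (K : ConvexBody (Eucl n)) (φ : ContDiffBump (0 : Eucl n))
    (x : Eucl n) {s t : ℝ} (hs : 0 ≤ s) (hst : s ≤ t) :
    ∫ y, supportFn K (x + s • y) * φ.normed volume y ≤
      ∫ y, supportFn K (x + t • y) * φ.normed volume y := by
  have hc := continuous_supportFn K
  have I : ∀ r : ℝ, Integrable fun y => supportFn K (x + r • y) * φ.normed volume y := fun r =>
    integrable_mul_normed (hc.comp (by fun_prop)) φ
  have I' : ∀ r : ℝ, Integrable fun y => supportFn K (x - r • y) * φ.normed volume y := fun r =>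
    integrable_mul_normed (hc.comp (by fun_prop)) φ
  have e : ∀ r : ℝ, 2 * ∫ y, supportFn K (x + r • y) * φ.normed volume y =
      ∫ y, (supportFn K (x + r • y) + supportFn K (x - r • y)) * φ.normed volume y := by
    intro r
    simp only [add_mul]
    rw [integral_add (I r) (I' r), two_mul]
    congr 1
    rw [← integral_neg_eq_self]
    simp only [smul_neg, φ.normed_neg, sub_eq_add_neg]
  have : 2 * ∫ y, supportFn K (x + s • y) * φ.normed volume y ≤
      2 * ∫ y, supportFn K (x + t • y) * φ.normed volume y := by
    rw [e, e]
    refine integral_mono ?_ ?_ fun y =>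
      mul_le_mul_of_nonneg_right (supportFn_add_sub_mono K x y hs hst) (φ.nonneg_normed y)
    · exact ((I s).add (I' s)).congr (.of_forall fun y => by simp [add_mul])
    · exact ((I t).add (I' t)).congr (.of_forall fun y => by simp [add_mul])
  linarith

theorem abs_radialAverage_sub_le (K : ConvexBody (Eucl n)) (φ : ContDiffBump (0 : Eucl n))
    (x : Eucl n) :
    |radialAverage (supportFn K) φ x - supportFn K x| ≤ ‖supportMap K‖ * φ.rOut * ‖x‖ := by
  have hc := continuous_supportFn K
  have I := integrable_mul_normed (f := fun y => supportFn K (x + ‖x‖ • y))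
    (hc.comp (by fun_prop)) φ
  have e : radialAverage (supportFn K) φ x - supportFn K x =
      ∫ y, (supportFn K (x + ‖x‖ • y) - supportFn K x) * φ.normed volume y := by
    simp only [sub_mul]
    rw [integral_sub I (integrable_mul_normed continuous_const φ), integral_const_mul,
      φ.integral_normed, mul_one]
    rfl
  rw [e, ← Real.norm_eq_abs]
  have hb : ∀ y, ‖(supportFn K (x + ‖x‖ • y) - supportFn K x) * φ.normed volume y‖ ≤
      (‖supportMap K‖ * φ.rOut * ‖x‖) * φ.normed volume y := by
    intro y
    rw [norm_mul, Real.norm_of_nonneg (φ.nonneg_normed y)]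
    by_cases hy : φ.normed volume y = 0
    · simp [hy]
    have hy : ‖y‖ < φ.rOut := by
      rw [← Ne, ← Function.mem_support, φ.support_normed_eq, mem_ball_zero_iff] at hy
      exact hy
    refine mul_le_mul_of_nonneg_right ?_ (φ.nonneg_normed y)
    have h1 := supportFn_add_le K x (‖x‖ • y)
    have h2 := supportFn_add_le K (x + ‖x‖ • y) (-(‖x‖ • y))
    rw [add_neg_cancel_right] at h2
    have h3 := supportFn_le_norm K (‖x‖ • y)
    have h4 := supportFn_le_norm K (-(‖x‖ • y))
    rw [norm_neg] at h4
    have h5 : ‖supportMap K‖ * ‖‖x‖ • y‖ ≤ ‖supportMap K‖ * φ.rOut * ‖x‖ := by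
      rw [norm_smul, norm_norm, mul_assoc, mul_comm φ.rOut]
      gcongr
    rw [Real.norm_eq_abs, abs_le]
    constructor <;> linarith
  refine (norm_integral_le_of_norm_le ?_ (.of_forall hb)).trans_eq ?_
  · exact (φ.integrable_normed).const_mul _
  · rw [integral_const_mul, φ.integral_normed, mul_one]

/-- Averaging with radius proportional to ‖x‖ preserves homogeneity and, by monotonicity in the
radius, subadditivity. So the average is again a support function, and its distance from the
original is controlled by the size of the bump. -/
theorem exists_smooth_body_near (K : ConvexBody (Eucl n)) {ε : ℝ} (hε : 0 < ε) :
    ∃ L : ConvexBody (Eucl n), SmoothOff (supportFn L) ∧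
      ‖supportMap L - supportMap K‖ ≤ ε := by
  obtain ⟨r, hr, hr'⟩ : ∃ r : ℝ, 0 < r ∧ ‖supportMap K‖ * r ≤ ε := by
    refine ⟨ε / (‖supportMap K‖ + 1), by positivity, ?_⟩
    rw [mul_div_assoc', div_le_iff₀ (by positivity)]
    nlinarith [norm_nonneg (supportMap K)]
  let φ : ContDiffBump (0 : Eucl n) := ⟨r / 2, r, by positivity, by linarith⟩
  have hc := continuous_supportFn K
  have hd := abs_radialAverage_sub_le K φ
  obtain ⟨L, hL⟩ : ∃ L : ConvexBody (Eucl n), supportFn L = radialAverage (supportFn K) φ := by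
    refine exists_body_of_sublinear (M := ‖supportMap K‖ + ‖supportMap K‖ * φ.rOut) ?_ ?_ ?_
    · intro x
      have h1 := (abs_le.1 (hd x)).2
      have h2 := supportFn_le_norm K x
      linarith
    · intro t ht x
      rw [radialAverage, radialAverage, ← integral_const_mul]
      congr 1
      funext y
      rw [norm_smul, Real.norm_of_nonneg ht.le, mul_smul, ← smul_add, supportFn_smul K ht.le]
      ring
    · intro x y
      have I : ∀ (x : Eucl n) (r : ℝ),
          Integrable fun y => supportFn K (x + r • y) * φ.normed volume y := fun x r =>
        integrable_mul_normed (hc.comp (by fun_prop)) φ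
      refine (integral_add_smul_mono K φ (x + y) (norm_nonneg _) (norm_add_le x y)).trans ?_
      rw [radialAverage, radialAverage, ← integral_add (I _ _) (I _ _)]
      refine integral_mono (I _ _) ((I _ _).add (I _ _)) fun w => ?_
      beta_reduce
      rw [← add_mul]
      refine mul_le_mul_of_nonneg_right ?_ (φ.nonneg_normed w)
      refine le_trans (le_of_eq ?_) (supportFn_add_le K _ _)
      congr 1
      module
  refine ⟨L, hL ▸ smoothOff_radialAverage hc φ, ?_⟩
  rw [ContinuousMap.norm_le _ hε.le]
  intro u
  change ‖supportFn L u - supportFn K u‖ ≤ ε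
  rw [hL]
  refine (hd u).trans ?_
  rw [norm_sph, mul_one]
  exact hr'

theorem exists_smooth_approx (K : ConvexBody (Eucl n)) :
    ∃ L : ℕ → ConvexBody (Eucl n), (∀ k, SmoothOff (supportFn (L k))) ∧
      Tendsto (fun k => supportMap (L k)) atTop (𝓝 (supportMap K)) := by
  choose L h1 h2 using fun k : ℕ => exists_smooth_body_near K (Nat.one_div_pos_of_nat (n := k))
  refine ⟨L, h1, ?_⟩
  rw [tendsto_iff_norm_sub_tendsto_zero]
  exact squeeze_zero (fun _ => norm_nonneg _) h2 tendsto_one_div_add_atTop_nhds_zero_nat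

/-! ### Interpolation of polynomials -/

section interpolation
open Polynomial

/-- The Lagrange basis for the nodes `0, …, d`. -/
def lagrangeNat (d j : ℕ) : ℝ[X] :=
  Lagrange.basis (Finset.range (d + 1)) (fun i : ℕ => (i : ℝ)) j

theorem eq_sum_lagrangeNat {d : ℕ} {P : ℝ[X]} (hP : P.natDegree ≤ d) :
    P = ∑ j ∈ Finset.range (d + 1), C (P.eval (j : ℝ)) * lagrangeNat d j := by
  have h := Lagrange.eq_interpolate (s := Finset.range (d + 1)) (v := fun i : ℕ => (i : ℝ))
    (f := P) Nat.cast_injective.injOn (by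
      rw [Finset.card_range]
      exact degree_le_natDegree.trans_lt (by exact_mod_cast Nat.lt_succ_of_le hP))
  rwa [Lagrange.interpolate_apply] at h

theorem eval_eq_sum_lagrangeNat {d : ℕ} {P : ℝ[X]} (hP : P.natDegree ≤ d) (s : ℝ) :
    P.eval s = ∑ j ∈ Finset.range (d + 1), (lagrangeNat d j).eval s * P.eval (j : ℝ) := by
  conv_lhs => rw [eq_sum_lagrangeNat hP]
  rw [eval_finsetSum]
  exact Finset.sum_congr rfl fun j _ => by rw [eval_mul, eval_C, mul_comm]

theorem derivative_eval_eq_sum_lagrangeNat {d : ℕ} {P : ℝ[X]} (hP : P.natDegree ≤ d) (s : ℝ) :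
    P.derivative.eval s =
      ∑ j ∈ Finset.range (d + 1), (lagrangeNat d j).derivative.eval s * P.eval (j : ℝ) := by
  conv_lhs => rw [eq_sum_lagrangeNat hP]
  rw [derivative_sum, eval_finsetSum]
  exact Finset.sum_congr rfl fun j _ => by rw [derivative_C_mul, eval_mul, eval_C, mul_comm]

/-- Integrate the Lagrange interpolation of P' over [0, 1]. The nodes are taken in [0, 1] because
they will be the parameters of convex combinations of bodies. -/
theorem exists_quadrature (d : ℕ) : ∃ w : ℕ → ℝ, ∀ P : ℝ[X], P.natDegree ≤ d →
    P.eval 1 - P.eval 0 =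
      ∑ j ∈ Finset.range (d + 1), w j * P.derivative.eval ((j : ℝ) / (d + 1)) := by
  have hd : ((d : ℝ) + 1) ≠ 0 := by positivity
  let v : ℕ → ℝ := fun i => (i : ℝ) / (d + 1)
  have hv : Set.InjOn v (Finset.range (d + 1)) := fun i _ j _ hij => by
    have := (div_left_inj' hd).1 hij
    exact_mod_cast this
  refine ⟨fun j => ∫ s in (0 : ℝ)..1, (Lagrange.basis (Finset.range (d + 1)) v j).eval s,
    fun P hP => ?_⟩
  have h := Lagrange.eq_interpolate (s := Finset.range (d + 1)) (f := P.derivative) hv (by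
      rw [Finset.card_range]
      refine degree_le_natDegree.trans_lt ?_
      exact_mod_cast Nat.lt_succ_of_le ((natDegree_derivative_le P).trans (by omega)))
  rw [Lagrange.interpolate_apply] at h
  have e : ∫ s in (0 : ℝ)..1, P.derivative.eval s = P.eval 1 - P.eval 0 :=
    intervalIntegral.integral_eq_sub_of_hasDerivAt (fun s _ => P.hasDerivAt s)
      (P.derivative.continuous.intervalIntegrable _ _)
  rw [← e]
  conv_lhs => rw [h]
  simp only [eval_finsetSum, eval_mul, eval_C]
  rw [intervalIntegral.integral_finsetSum fun j _ => Continuous.intervalIntegrable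
    (by exact continuous_const.mul (Polynomial.continuous _)) _ _]
  exact Finset.sum_congr rfl fun j _ => by
    rw [intervalIntegral.integral_const_mul, mul_comm]

end interpolation

/-! ### The derivative of the determinant -/

section determinant
open Matrix
variable {m : Type*} [Fintype m] [DecidableEq m]

theorem sum_det_updateRow (A B : Matrix m m ℝ) :
    ∑ i, (A.updateRow i (B i)).det = (A.adjugate * B).trace := by
  rw [Matrix.trace_mul_comm, Matrix.trace]
  refine Finset.sum_congr rfl fun i _ => ?_
  rw [← cramer_transpose_apply, cramer_eq_adjugate_mulVec, ← adjugate_transpose]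
  simp only [Matrix.mulVec, dotProduct, diag_apply, Matrix.mul_apply, transpose_apply]
  exact Finset.sum_congr rfl fun j _ => mul_comm _ _

theorem hasDerivAt_det_add_smul (A B : Matrix m m ℝ) (s : ℝ) :
    HasDerivAt (fun s : ℝ => (A + s • B).det) (((A + s • B).adjugate * B).trace) s := by
  let D : ContinuousMultilinearMap ℝ (fun _ : m => m → ℝ) ℝ :=
    { (detRowAlternating (n := m) (R := ℝ)).toMultilinearMap with
      cont := Continuous.matrix_det (A := fun M : Matrix m m ℝ => M) continuous_id }
  have h1 : HasDerivAt (fun s : ℝ => (fun i => A i + s • B i : m → m → ℝ)) (fun i => B i) s := by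
    rw [hasDerivAt_pi]
    intro i
    simpa using ((hasDerivAt_id s).smul_const (B i)).const_add (A i)
  have h2 := (D.hasFDerivAt (fun i => A i + s • B i)).comp_hasDerivAt s h1
  rw [← sum_det_updateRow]
  convert! h2 using 1
  rw [ContinuousMultilinearMap.linearDeriv_apply]
  rfl

open Polynomial in
theorem exists_polynomial_det (A B : Matrix m m ℝ) :
    ∃ P : ℝ[X], P.natDegree ≤ Fintype.card m ∧ (∀ s, P.eval s = (A + s • B).det) ∧
      ∀ s, P.derivative.eval s = ((A + s • B).adjugate * B).trace := by
  have key : ∀ s, (((X : ℝ[X]) • B.map C + A.map C).det).eval s = (A + s • B).det := by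
    intro s
    rw [← coe_evalRingHom, RingHom.map_det]
    congr 1
    ext i j
    simp [add_comm, mul_comm s]
  refine ⟨((X : ℝ[X]) • B.map C + A.map C).det, natDegree_det_X_add_C_le B A, key, fun s => ?_⟩
  refine (Polynomial.hasDerivAt _ s).unique ?_
  simp only [key]
  exact hasDerivAt_det_add_smul A B s

end determinant

/-! ### The mixed second variation of the volume -/

/-- The nodes and weights are chosen such that, for support functions, this is the derivative of
`s ↦ firstVar (h + s • f) g` at `s = 0`. -/
def mixedVar (h f g : C(Sph n, ℝ)) : ℝ :=
  ∑ j ∈ Finset.range (n + 2 + 1),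
    (lagrangeNat (n + 2) j).derivative.eval 0 * firstVar (h + (j : ℝ) • f) g

theorem add_smul_pos {h f : C(Sph n, ℝ)} (hh : ∀ v, 0 < h v) (hf : ∀ v, 0 < f v) {s : ℝ}
    (hs : 0 ≤ s) (v : Sph n) : 0 < (h + s • f) v := by
  have h1 := hh v
  have h2 := (hf v).le
  change 0 < h v + s * f v
  positivity

theorem tendsto_mixedVar {ι : Type*} {l : Filter ι} [l.IsCountablyGenerated]
    {hs fs gs : ι → C(Sph n, ℝ)} {h f g : C(Sph n, ℝ)} (hh : ∀ v, 0 < h v) (hf : ∀ v, 0 < f v)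
    (H : Tendsto hs l (𝓝 h)) (F : Tendsto fs l (𝓝 f)) (G : Tendsto gs l (𝓝 g)) :
    Tendsto (fun i => mixedVar (hs i) (fs i) (gs i)) l (𝓝 (mixedVar h f g)) :=
  tendsto_finsetSum _ fun j _ => Tendsto.const_mul _ <|
    tendsto_firstVar (add_smul_pos hh hf j.cast_nonneg) (H.add (F.const_smul _)) G

theorem mixedVar_add {h f : C(Sph n, ℝ)} (hh : ∀ v, 0 < h v) (hf : ∀ v, 0 < f v)
    (g g' : C(Sph n, ℝ)) : mixedVar h f (g + g') = mixedVar h f g + mixedVar h f g' := by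
  simp only [mixedVar, firstVar_add (add_smul_pos hh hf (Nat.cast_nonneg _)), mul_add,
    Finset.sum_add_distrib]

theorem mixedVar_smul (h f : C(Sph n, ℝ)) (c : ℝ) (g : C(Sph n, ℝ)) :
    mixedVar h f (c • g) = c * mixedVar h f g := by
  simp only [mixedVar, firstVar_smul, Finset.mul_sum]
  exact Finset.sum_congr rfl fun j _ => by ring

theorem mixedVar_sub {h f : C(Sph n, ℝ)} (hh : ∀ v, 0 < h v) (hf : ∀ v, 0 < f v)
    (g g' : C(Sph n, ℝ)) : mixedVar h f (g - g') = mixedVar h f g - mixedVar h f g' := by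
  have e : g - g' = g + (-1 : ℝ) • g' := by rw [neg_one_smul, sub_eq_add_neg]
  rw [e, mixedVar_add hh hf, mixedVar_smul]; ring

open scoped Pointwise in
theorem supportMap_add_smul (K M : ConvexBody (Eucl n)) {s : ℝ} (hs : 0 ≤ s) :
    supportMap (K + s • M) = supportMap K + s • supportMap M := by
  rw [supportMap_add, supportMap_smul hs]

/-! ### The mixed variation for smooth bodies -/

section smooth
variable {K M : ConvexBody (Eucl n)} (hK : ∀ v, 0 < supportMap K v)
  (hM : ∀ v, 0 < supportMap M v) (sK : SmoothOff (supportFn K)) (sM : SmoothOff (supportFn M))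
include hK hM sK sM

open scoped Pointwise in
theorem firstVar_add_smul_eq_integral {s : ℝ} (hs : 0 ≤ s) (g : C(Sph n, ℝ)) :
    firstVar (supportMap K + s • supportMap M) g = ∫ u : Sph n, g u *
      (addRadial (hessianMatrix (supportFn K) u) u + s • hessianMatrix (supportFn M) u).det
        ∂((volume : Measure (Eucl n)).toSphere) := by
  have e2 : supportFn (K + s • M) = fun x => supportFn K x + s * supportFn M x := by
    funext x
    rw [supportFn_add, supportFn_smul_body hs]
  have sM' : SmoothOff (fun x => s * supportFn M x) := contDiffOn_const.mul sM
  rw [← supportMap_add_smul K M hs, firstVar_eq_integral_det (by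
    rw [supportMap_add_smul K M hs]; exact add_smul_pos hK hM hs) (by rw [e2]; exact sK.add sM')]
  congr 1
  funext u
  rw [e2, hessianMatrix_add sK sM' (sph_ne_zero u), hessianMatrix_const_mul, addRadial_add]

omit hK hM in
theorem continuous_det_add_smul (g : C(Sph n, ℝ)) (s : ℝ) : Continuous fun u : Sph n => g u *
      (addRadial (hessianMatrix (supportFn K) u) u + s • hessianMatrix (supportFn M) u).det :=
  g.continuous.mul (Continuous.matrix_det ((continuous_addRadial sK.continuous_hessianMatrix).add
    (sM.continuous_hessianMatrix.const_smul s)))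

/-- The integrand is polynomial in s at every point of the sphere. The test function moves with s so
that the choice g = h_K, g' = h_M covers the volume itself. -/
theorem firstVar_interpolate_of_smooth {s : ℝ} (hs : 0 ≤ s) (g g' : C(Sph n, ℝ)) :
    firstVar (supportMap K + s • supportMap M) (g + s • g') =
      ∑ j ∈ Finset.range (n + 2 + 1), (lagrangeNat (n + 2) j).eval s *
        firstVar (supportMap K + (j : ℝ) • supportMap M) (g + (j : ℝ) • g') := by
  rw [firstVar_add_smul_eq_integral hK hM sK sM hs]
  simp_rw [firstVar_add_smul_eq_integral hK hM sK sM (Nat.cast_nonneg _), ← integral_const_mul]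
  rw [← integral_finsetSum _ fun j _ =>
    ((continuous_det_add_smul sK sM _ _).const_mul _).integrable_of_hasCompactSupport
      (HasCompactSupport.of_compactSpace _)]
  congr 1
  funext u
  obtain ⟨P, h1, h2, -⟩ := exists_polynomial_det (addRadial (hessianMatrix (supportFn K) u) u)
    (hessianMatrix (supportFn M) u)
  rw [Fintype.card_fin] at h1
  -- The determinant has degree at most n + 1 in s and the moving test function adds one, hence the
  -- degree n + 2.
  have h3 := eval_eq_sum_lagrangeNat (d := n + 2)
    (P := (Polynomial.C (g u) + Polynomial.X * Polynomial.C (g' u)) * P) (by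
      refine Polynomial.natDegree_mul_le.trans ?_
      have : (Polynomial.C (g u) + Polynomial.X * Polynomial.C (g' u)).natDegree ≤ 1 := by
        compute_degree
      omega) s
  simpa [h2, mul_comm (g' u)] using h3

/-- The Lagrange weights differentiate the polynomial det(A + s B) at 0 exactly, and Jacobi's
formula identifies the derivative. -/
theorem mixedVar_eq_integral (g : C(Sph n, ℝ)) :
    mixedVar (supportMap K) (supportMap M) g = ∫ u : Sph n, g u *
      ((addRadial (hessianMatrix (supportFn K) u) u).adjugate *
        hessianMatrix (supportFn M) u).trace ∂((volume : Measure (Eucl n)).toSphere) := by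
  rw [mixedVar]
  simp_rw [firstVar_add_smul_eq_integral hK hM sK sM (Nat.cast_nonneg _), ← integral_const_mul]
  rw [← integral_finsetSum _ fun j _ =>
    ((continuous_det_add_smul sK sM _ _).const_mul _).integrable_of_hasCompactSupport
      (HasCompactSupport.of_compactSpace _)]
  congr 1
  funext u
  obtain ⟨P, h1, h2, h3⟩ := exists_polynomial_det (addRadial (hessianMatrix (supportFn K) u) u)
    (hessianMatrix (supportFn M) u)
  rw [Fintype.card_fin] at h1
  have h4 := derivative_eval_eq_sum_lagrangeNat (d := n + 2) (P := P) (by omega) 0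
  rw [h3, zero_smul, add_zero] at h4
  rw [h4, Finset.mul_sum]
  exact Finset.sum_congr rfl fun j _ => by rw [h2]; ring

end smooth

theorem exists_smooth_pos_approx {K : ConvexBody (Eucl n)} (hK : ∀ v, 0 < supportMap K v) :
    ∃ L : ℕ → ConvexBody (Eucl n), (∀ k, SmoothOff (supportFn (L k))) ∧
      (∀ k v, 0 < supportMap (L k) v) ∧
      Tendsto (fun k => supportMap (L k)) atTop (𝓝 (supportMap K)) := by
  obtain ⟨L, h1, h2⟩ := exists_smooth_approx K
  obtain ⟨N, hN⟩ := eventually_atTop.1 (eventually_pos h2 hK)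
  exact ⟨fun k => L (k + N), fun k => h1 _, fun k => hN _ (by omega),
    h2.comp (tendsto_add_atTop_nat N)⟩

/-! ### Interpolation and symmetry for general bodies -/

section bodies
variable {K M L : ConvexBody (Eucl n)} (hK : ∀ v, 0 < supportMap K v)
  (hM : ∀ v, 0 < supportMap M v) (hL : ∀ v, 0 < supportMap L v)
include hK hM

/-- Only finitely many values of the continuous functional `firstVar` occur, so the identity passes
to the limit from smooth bodies. -/
theorem firstVar_interpolate {s : ℝ} (hs : 0 ≤ s) (g g' : C(Sph n, ℝ)) :
    firstVar (supportMap K + s • supportMap M) (g + s • g') =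
      ∑ j ∈ Finset.range (n + 2 + 1), (lagrangeNat (n + 2) j).eval s *
        firstVar (supportMap K + (j : ℝ) • supportMap M) (g + (j : ℝ) • g') := by
  obtain ⟨A, a1, a2, a3⟩ := exists_smooth_pos_approx hK
  obtain ⟨B, b1, b2, b3⟩ := exists_smooth_pos_approx hM
  refine tendsto_nhds_unique_of_eventuallyEq
    (tendsto_firstVar (add_smul_pos hK hM hs) (a3.add (b3.const_smul s)) tendsto_const_nhds)
    (tendsto_finsetSum _ fun j _ => Tendsto.const_mul _ <| tendsto_firstVar
      (add_smul_pos hK hM j.cast_nonneg) (a3.add (b3.const_smul (j : ℝ))) tendsto_const_nhds)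
    (.of_forall fun k => firstVar_interpolate_of_smooth (a2 k) (b2 k) (a1 k) (b1 k) hs g g')

theorem hasDerivWithinAt_firstVar_add_smul (g : C(Sph n, ℝ)) :
    HasDerivWithinAt (fun s : ℝ => firstVar (supportMap K + s • supportMap M) g)
      (mixedVar (supportMap K) (supportMap M) g) (Set.Ici 0) 0 := by
  have h : HasDerivWithinAt (fun s : ℝ => ∑ j ∈ Finset.range (n + 2 + 1),
      (lagrangeNat (n + 2) j).eval s * firstVar (supportMap K + (j : ℝ) • supportMap M) g)
      (mixedVar (supportMap K) (supportMap M) g) (Set.Ici 0) 0 :=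
    (HasDerivAt.fun_sum fun j _ =>
      ((lagrangeNat (n + 2) j).hasDerivAt 0).mul_const _).hasDerivWithinAt
  have e : ∀ s ∈ Set.Ici (0 : ℝ), firstVar (supportMap K + s • supportMap M) g =
      ∑ j ∈ Finset.range (n + 2 + 1),
      (lagrangeNat (n + 2) j).eval s * firstVar (supportMap K + (j : ℝ) • supportMap M) g :=
    fun s hs => by simpa using firstVar_interpolate hK hM hs g 0
  exact h.congr e (e 0 Set.self_mem_Ici)

theorem wvol_interpolate {s : ℝ} (hs : 0 ≤ s) : wvol (supportMap K + s • supportMap M) =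
      ∑ j ∈ Finset.range (n + 2 + 1), (lagrangeNat (n + 2) j).eval s *
        wvol (supportMap K + (j : ℝ) • supportMap M) := by
  have h := firstVar_interpolate hK hM hs (supportMap K) (supportMap M)
  rw [firstVar_self (add_smul_pos hK hM hs)] at h
  simp_rw [firstVar_self (add_smul_pos hK hM (Nat.cast_nonneg _))] at h
  refine mul_left_cancel₀ (show ((n : ℝ) + 1) ≠ 0 by positivity) (h.trans ?_)
  rw [Finset.mul_sum]
  exact Finset.sum_congr rfl fun j _ => by ring

/-- The right derivative of the volume of K + s M at s = 0, computed by Aleksandrov's lemma and by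
differentiating the interpolation formula. -/
theorem firstVar_eq_sum_wvol : firstVar (supportMap K) (supportMap M) =
    ∑ j ∈ Finset.range (n + 2 + 1), (lagrangeNat (n + 2) j).derivative.eval 0 *
      wvol (supportMap K + (j : ℝ) • supportMap M) := by
  have h : HasDerivWithinAt (fun s : ℝ => ∑ j ∈ Finset.range (n + 2 + 1),
      (lagrangeNat (n + 2) j).eval s * wvol (supportMap K + (j : ℝ) • supportMap M))
      (∑ j ∈ Finset.range (n + 2 + 1), (lagrangeNat (n + 2) j).derivative.eval 0 *
        wvol (supportMap K + (j : ℝ) • supportMap M)) (Set.Ici 0) 0 :=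
    (HasDerivAt.fun_sum fun j _ =>
      ((lagrangeNat (n + 2) j).hasDerivAt 0).mul_const _).hasDerivWithinAt
  have e : ∀ s ∈ Set.Ici (0 : ℝ), wvol (supportMap K + s • supportMap M) =
      ∑ j ∈ Finset.range (n + 2 + 1), (lagrangeNat (n + 2) j).eval s *
        wvol (supportMap K + (j : ℝ) • supportMap M) := fun s hs => wvol_interpolate hK hM hs
  have h2 := h.congr e (e 0 Set.self_mem_Ici)
  have h3 : HasDerivWithinAt (fun s : ℝ => supportMap K + s • supportMap M) (supportMap M)
      (Set.Ici 0) 0 := by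
    simpa using (((hasDerivAt_id (0 : ℝ)).smul_const (supportMap M)).const_add
      (supportMap K)).hasDerivWithinAt (s := Set.Ici 0)
  have h4 := hasDerivWithinAt_wvol h3 (by simpa using hK)
  rw [zero_smul, add_zero] at h4
  exact (uniqueDiffOn_Ici (0 : ℝ) 0 Set.self_mem_Ici).eq_deriv _ h4 h2

include hL

-- Both sides are the mixed second derivative of the volume of K + r L + s M at 0. The derivative in
-- s is a finite combination of volumes, so the derivative in r can be taken term by term with
-- Aleksandrov's lemma.
open scoped Pointwise in
theorem mixedVar_comm : mixedVar (supportMap K) (supportMap L) (supportMap M) =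
    mixedVar (supportMap K) (supportMap M) (supportMap L) := by
  have h1 := hasDerivWithinAt_firstVar_add_smul hK hL (supportMap M)
  have h2 : HasDerivWithinAt (fun r : ℝ => ∑ j ∈ Finset.range (n + 2 + 1),
      (lagrangeNat (n + 2) j).derivative.eval 0 *
        wvol ((supportMap K + (j : ℝ) • supportMap M) + r • supportMap L))
      (mixedVar (supportMap K) (supportMap M) (supportMap L)) (Set.Ici 0) 0 := by
    refine HasDerivWithinAt.fun_sum fun j _ => HasDerivWithinAt.const_mul _ ?_
    have h3 : HasDerivWithinAt (fun r : ℝ => (supportMap K + (j : ℝ) • supportMap M) +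
        r • supportMap L) (supportMap L) (Set.Ici 0) 0 := by
      simpa using (((hasDerivAt_id (0 : ℝ)).smul_const (supportMap L)).const_add
        (supportMap K + (j : ℝ) • supportMap M)).hasDerivWithinAt (s := Set.Ici 0)
    have h4 := hasDerivWithinAt_wvol h3 (by
      simpa using add_smul_pos hK hM (s := (j : ℝ)) j.cast_nonneg)
    rwa [zero_smul, add_zero] at h4
  have e : ∀ r ∈ Set.Ici (0 : ℝ), firstVar (supportMap K + r • supportMap L) (supportMap M) =
      ∑ j ∈ Finset.range (n + 2 + 1), (lagrangeNat (n + 2) j).derivative.eval 0 *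
        wvol ((supportMap K + (j : ℝ) • supportMap M) + r • supportMap L) := by
    intro r hr
    rw [← supportMap_add_smul K L hr, firstVar_eq_sum_wvol (K := K + r • L)
      (by rw [supportMap_add_smul K L hr]; exact add_smul_pos hK hL hr) hM,
      supportMap_add_smul K L hr]
    simp only [add_right_comm]
  exact (uniqueDiffOn_Ici (0 : ℝ) 0 Set.self_mem_Ici).eq_deriv _ h1
    (h2.congr e (e 0 Set.self_mem_Ici))

end bodies

/-! ### The derivative of the first variation -/

theorem combination_pos {h f : C(Sph n, ℝ)} (hh : ∀ v, 0 < h v) (hf : ∀ v, 0 < f v) {s : ℝ}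
    (hs : s ∈ Set.Icc (0 : ℝ) 1) (v : Sph n) : 0 < ((1 - s) • h + s • f) v := by
  change 0 < (1 - s) * h v + s * f v
  have h1 := hh v
  have h2 := hf v
  rcases hs.2.eq_or_lt with h3 | h3
  · simp [h3, h2]
  · have : 0 < 1 - s := by linarith
    have h4 := hs.1
    positivity

open scoped Pointwise in
theorem supportMap_combination (K L : ConvexBody (Eucl n)) {s : ℝ} (hs : s ∈ Set.Icc (0 : ℝ) 1) :
    supportMap ((1 - s) • K + s • L) = (1 - s) • supportMap K + s • supportMap L := by
  rw [supportMap_add, supportMap_smul (by linarith [hs.2]), supportMap_smul hs.1]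

theorem node_mem (d : ℕ) {j : ℕ} (hj : j ∈ Finset.range (d + 1)) :
    (j : ℝ) / (d + 1) ∈ Set.Icc (0 : ℝ) 1 := by
  have : (j : ℝ) ≤ d := by exact_mod_cast Nat.lt_succ_iff.1 (Finset.mem_range.1 hj)
  exact ⟨by positivity, (div_le_one (by positivity)).2 (by linarith)⟩

open scoped Pointwise in
theorem mixedVar_combination_eq_integral {K₀ K₁ : ConvexBody (Eucl n)}
    (h₀ : ∀ v, 0 < supportMap K₀ v) (h₁ : ∀ v, 0 < supportMap K₁ v)
    (s₀ : SmoothOff (supportFn K₀)) (s₁ : SmoothOff (supportFn K₁)) {s : ℝ}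
    (hs : s ∈ Set.Icc (0 : ℝ) 1) (g : C(Sph n, ℝ)) {M : ConvexBody (Eucl n)}
    (hM : ∀ v, 0 < supportMap M v) (sM : SmoothOff (supportFn M)) :
    mixedVar ((1 - s) • supportMap K₀ + s • supportMap K₁) (supportMap M) g =
      ∫ u : Sph n, g u * ((addRadial (hessianMatrix (supportFn K₀) u) u +
        s • (hessianMatrix (supportFn K₁) u - hessianMatrix (supportFn K₀) u)).adjugate *
          hessianMatrix (supportFn M) u).trace ∂((volume : Measure (Eucl n)).toSphere) := by
  have e2 : supportFn ((1 - s) • K₀ + s • K₁) =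
      fun x => (1 - s) * supportFn K₀ x + s * supportFn K₁ x := by
    funext x
    rw [supportFn_add, supportFn_smul_body (by linarith [hs.2]), supportFn_smul_body hs.1]
  have t₀ : SmoothOff (fun x => (1 - s) * supportFn K₀ x) := contDiffOn_const.mul s₀
  have t₁ : SmoothOff (fun x => s * supportFn K₁ x) := contDiffOn_const.mul s₁
  rw [← supportMap_combination K₀ K₁ hs, mixedVar_eq_integral (K := (1 - s) • K₀ + s • K₁)
    (by rw [supportMap_combination K₀ K₁ hs]; exact combination_pos h₀ h₁ hs) hM
    (by rw [e2]; exact t₀.add t₁) sM]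
  congr 1
  funext u
  rw [e2, hessianMatrix_add t₀ t₁ (sph_ne_zero u), hessianMatrix_const_mul,
    hessianMatrix_const_mul]
  congr 4
  simp only [addRadial]
  module

/-- The fundamental theorem of calculus along the segment from K₀ to K₁, in exact finite form
because everything is polynomial in the parameter. Symmetry moves the difference of the two support
functions into the last slot, where `mixedVar` is linear and accepts continuous functions. -/
theorem exists_firstVar_sub_eq (n : ℕ) : ∃ w : ℕ → ℝ,
    ∑ j ∈ Finset.range (n + 1 + 1), w j = 1 ∧
    ∀ K₀ K₁ M : ConvexBody (Eucl n), (∀ v, 0 < supportMap K₀ v) → (∀ v, 0 < supportMap K₁ v) →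
      (∀ v, 0 < supportMap M v) →
      firstVar (supportMap K₁) (supportMap M) - firstVar (supportMap K₀) (supportMap M) =
        ∑ j ∈ Finset.range (n + 1 + 1), w j *
          mixedVar ((1 - (j : ℝ) / ((n + 1 : ℕ) + 1)) • supportMap K₀ +
            ((j : ℝ) / ((n + 1 : ℕ) + 1)) • supportMap K₁) (supportMap M)
            (supportMap K₁ - supportMap K₀) := by
  obtain ⟨w, hw⟩ := exists_quadrature (n + 1)
  refine ⟨w, ?_, ?_⟩
  · have := hw Polynomial.X (by simp)
    simpa using this.symm
  -- For smooth bodies the quadrature formula holds for the determinants pointwise on the sphere.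
  -- The direction is split into two bodies, since the integral formula for `mixedVar` needs a
  -- support function in the second slot.
  have smooth : ∀ K₀ K₁ : ConvexBody (Eucl n), (∀ v, 0 < supportMap K₀ v) →
      (∀ v, 0 < supportMap K₁ v) → SmoothOff (supportFn K₀) → SmoothOff (supportFn K₁) →
      ∀ g : C(Sph n, ℝ), firstVar (supportMap K₁) g - firstVar (supportMap K₀) g =
        ∑ j ∈ Finset.range (n + 1 + 1), w j *
          (mixedVar ((1 - (j : ℝ) / ((n + 1 : ℕ) + 1)) • supportMap K₀ +
            ((j : ℝ) / ((n + 1 : ℕ) + 1)) • supportMap K₁) (supportMap K₁) g -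
          mixedVar ((1 - (j : ℝ) / ((n + 1 : ℕ) + 1)) • supportMap K₀ +
            ((j : ℝ) / ((n + 1 : ℕ) + 1)) • supportMap K₁) (supportMap K₀) g) := by
    intro K₀ K₁ p₀ p₁ s₀ s₁ g
    have c₀ := continuous_addRadial s₀.continuous_hessianMatrix
    have c₁ := continuous_addRadial s₁.continuous_hessianMatrix
    have I : ∀ {f : Sph n → ℝ}, Continuous f →
        Integrable f ((volume : Measure (Eucl n)).toSphere) := fun hf =>
      hf.integrable_of_hasCompactSupport (HasCompactSupport.of_compactSpace _)
    have cT : ∀ (s : ℝ) {M : ConvexBody (Eucl n)}, SmoothOff (supportFn M) →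
        Continuous fun u : Sph n => g u * ((addRadial (hessianMatrix (supportFn K₀) u) u +
        s • (hessianMatrix (supportFn K₁) u - hessianMatrix (supportFn K₀) u)).adjugate *
          hessianMatrix (supportFn M) u).trace := fun s M sM =>
      g.continuous.mul (Continuous.matrix_trace (Continuous.matrix_mul
        (Continuous.matrix_adjugate (c₀.add
          ((s₁.continuous_hessianMatrix.sub s₀.continuous_hessianMatrix).const_smul s)))
        sM.continuous_hessianMatrix))
    rw [firstVar_eq_integral_det p₀ s₀, firstVar_eq_integral_det p₁ s₁,
      ← integral_sub (I (by exact g.continuous.mul c₁.matrix_det))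
        (I (by exact g.continuous.mul c₀.matrix_det))]
    have e : ∀ j ∈ Finset.range (n + 1 + 1), w j *
          (mixedVar ((1 - (j : ℝ) / ((n + 1 : ℕ) + 1)) • supportMap K₀ +
            ((j : ℝ) / ((n + 1 : ℕ) + 1)) • supportMap K₁) (supportMap K₁) g -
          mixedVar ((1 - (j : ℝ) / ((n + 1 : ℕ) + 1)) • supportMap K₀ +
            ((j : ℝ) / ((n + 1 : ℕ) + 1)) • supportMap K₁) (supportMap K₀) g) =
        ∫ u : Sph n, w j * (g u * ((addRadial (hessianMatrix (supportFn K₀) u) u +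
          ((j : ℝ) / ((n + 1 : ℕ) + 1)) •
            (hessianMatrix (supportFn K₁) u - hessianMatrix (supportFn K₀) u)).adjugate *
          (hessianMatrix (supportFn K₁) u - hessianMatrix (supportFn K₀) u)).trace)
          ∂((volume : Measure (Eucl n)).toSphere) := by
      intro j hj
      rw [mixedVar_combination_eq_integral p₀ p₁ s₀ s₁ (node_mem _ hj) g p₁ s₁,
        mixedVar_combination_eq_integral p₀ p₁ s₀ s₁ (node_mem _ hj) g p₀ s₀,
        ← integral_sub (I (cT _ s₁)) (I (cT _ s₀)), ← integral_const_mul]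
      congr 1
      funext u
      rw [Matrix.mul_sub, Matrix.trace_sub]; ring
    rw [Finset.sum_congr rfl e, ← integral_finsetSum]
    · congr 1
      funext u
      obtain ⟨P, h1, h2, h3⟩ := exists_polynomial_det
        (addRadial (hessianMatrix (supportFn K₀) u) u)
        (hessianMatrix (supportFn K₁) u - hessianMatrix (supportFn K₀) u)
      rw [Fintype.card_fin] at h1
      have h4 := hw P h1
      simp only [h2, h3] at h4
      rw [one_smul, zero_smul, add_zero] at h4
      have e5 : addRadial (hessianMatrix (supportFn K₀) u) (u : Eucl n) +
          (hessianMatrix (supportFn K₁) u - hessianMatrix (supportFn K₀) u) =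
          addRadial (hessianMatrix (supportFn K₁) u) u := by
        simp only [addRadial]; abel
      rw [e5] at h4
      rw [← mul_sub, h4, Finset.mul_sum]
      exact Finset.sum_congr rfl fun j _ => by ring
    · intro j _
      refine Integrable.const_mul (((I (cT ((j : ℝ) / ((n + 1 : ℕ) + 1)) s₁)).sub
        (I (cT ((j : ℝ) / ((n + 1 : ℕ) + 1)) s₀))).congr (.of_forall fun u => ?_)) _
      simp only [Pi.sub_apply]
      rw [Matrix.mul_sub, Matrix.trace_sub, mul_sub]
  intro K₀ K₁ M p₀ p₁ pM
  obtain ⟨A, a1, a2, a3⟩ := exists_smooth_pos_approx p₀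
  obtain ⟨B, b1, b2, b3⟩ := exists_smooth_pos_approx p₁
  have key := tendsto_nhds_unique_of_eventuallyEq
    ((tendsto_firstVar p₁ b3 tendsto_const_nhds).sub (tendsto_firstVar p₀ a3 tendsto_const_nhds))
    (tendsto_finsetSum (Finset.range (n + 1 + 1)) fun j hj => Tendsto.const_mul (w j) <|
      (tendsto_mixedVar (combination_pos p₀ p₁ (node_mem _ hj)) p₁
        ((a3.const_smul _).add (b3.const_smul _)) b3 tendsto_const_nhds).sub
      (tendsto_mixedVar (combination_pos p₀ p₁ (node_mem _ hj)) p₀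
        ((a3.const_smul _).add (b3.const_smul _)) a3 tendsto_const_nhds))
    (.of_forall fun k => smooth (A k) (B k) (a2 k) (b2 k) (a1 k) (b1 k) (supportMap M))
  rw [key]
  refine Finset.sum_congr rfl fun j hj => ?_
  have hs := node_mem (n + 1) hj
  have hp := combination_pos p₀ p₁ hs
  rw [mixedVar_sub hp pM]
  rw [← supportMap_combination K₀ K₁ hs] at hp ⊢
  rw [mixedVar_comm hp pM p₁, mixedVar_comm hp pM p₀]

/-- Divide the exact difference formula by τ - t. All convex combinations tend to K t, the weights
sum to 1, and the slope sits in the slot where `mixedVar` is continuous; h' is thus allowed to be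
any continuous function. -/
theorem hasDerivWithinAt_firstVar {K : ℝ → ConvexBody (Eucl n)} {M : ConvexBody (Eucl n)}
    {h' : C(Sph n, ℝ)} {s : Set ℝ} {t : ℝ}
    (hd : HasDerivWithinAt (fun τ => supportMap (K τ)) h' s t)
    (hK : ∀ v, 0 < supportMap (K t) v) (hM : ∀ v, 0 < supportMap M v) :
    HasDerivWithinAt (fun τ => firstVar (supportMap (K τ)) (supportMap M))
      (mixedVar (supportMap (K t)) (supportMap M) h') s t := by
  obtain ⟨w, hw1, hw⟩ := exists_firstVar_sub_eq n
  have hcont : Tendsto (fun τ => supportMap (K τ)) (𝓝[s \ {t}] t) (𝓝 (supportMap (K t))) :=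
    hd.continuousWithinAt.tendsto.mono_left (nhdsWithin_mono _ Set.sdiff_subset)
  rw [hasDerivWithinAt_iff_tendsto_slope] at hd ⊢
  have lim : Tendsto (fun τ => ∑ j ∈ Finset.range (n + 1 + 1), w j *
      mixedVar ((1 - (j : ℝ) / ((n + 1 : ℕ) + 1)) • supportMap (K t) +
        ((j : ℝ) / ((n + 1 : ℕ) + 1)) • supportMap (K τ)) (supportMap M)
        (slope (fun τ => supportMap (K τ)) t τ)) (𝓝[s \ {t}] t)
      (𝓝 (∑ j ∈ Finset.range (n + 1 + 1), w j *
        mixedVar (supportMap (K t)) (supportMap M) h')) := by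
    refine tendsto_finsetSum _ fun j hj => Tendsto.const_mul _ ?_
    refine tendsto_mixedVar hK hM ?_ tendsto_const_nhds hd
    have := (tendsto_const_nhds (x := (1 - (j : ℝ) / ((n + 1 : ℕ) + 1)) • supportMap (K t))).add
      (hcont.const_smul ((j : ℝ) / ((n + 1 : ℕ) + 1)))
    rwa [← add_smul, sub_add_cancel, one_smul] at this
  rw [← Finset.sum_mul, hw1, one_mul] at lim
  refine lim.congr' ?_
  filter_upwards [eventually_pos hcont hK] with τ hτ
  rw [slope_def_module (fun τ => firstVar (supportMap (K τ)) (supportMap M)),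
    hw _ _ _ hK hτ hM, smul_eq_mul, Finset.mul_sum]
  refine Finset.sum_congr rfl fun j _ => ?_
  rw [slope_def_module, mixedVar_smul]
  ring

/-! ### Plurisubharmonicity and convexity -/

theorem circleIntegrable_quadratic (c A B Λ : ℝ) :
    CircleIntegrable (fun ζ : ℂ => c + A * ζ.re + B * ζ.im - Λ * ζ.re ^ 2) 0 1 :=
  ContinuousOn.circleIntegrable zero_le_one (by fun_prop)

theorem circleAverage_quadratic (c A B Λ : ℝ) :
    Real.circleAverage (fun ζ : ℂ => c + A * ζ.re + B * ζ.im - Λ * ζ.re ^ 2) 0 1 =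
      c - Λ / 2 := by
  have e : ∀ θ : ℝ, c + A * (circleMap 0 1 θ).re + B * (circleMap 0 1 θ).im -
      Λ * (circleMap 0 1 θ).re ^ 2 =
      c + A * Real.cos θ + B * Real.sin θ - Λ * Real.cos θ ^ 2 := fun θ => by
    simp [circleMap, Complex.exp_re, Complex.exp_im]
  rw [Real.circleAverage_def]
  simp_rw [e]
  have i1 : ∀ {f : ℝ → ℝ}, Continuous f → IntervalIntegrable f volume 0 (2 * Real.pi) :=
    fun hf => hf.intervalIntegrable _ _
  rw [intervalIntegral.integral_sub (i1 (by fun_prop)) (i1 (by fun_prop)),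
    intervalIntegral.integral_add (i1 (by fun_prop)) (i1 (by fun_prop)),
    intervalIntegral.integral_add (i1 (by fun_prop)) (i1 (by fun_prop)),
    intervalIntegral.integral_const, intervalIntegral.integral_const_mul,
    intervalIntegral.integral_const_mul, intervalIntegral.integral_const_mul,
    integral_cos, integral_sin, integral_cos_sq]
  simp only [Real.sin_two_pi, Real.sin_zero, Real.cos_two_pi, Real.cos_zero, smul_eq_mul]
  have := Real.pi_ne_zero
  field_simp
  ring

/-- The inclusion of the real points. -/
def ofRealVec (x : Eucl n) : Fin (n + 1) → ℂ := fun i => (x i : ℂ)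

theorem rePart_ofRealVec (x : Eucl n) : rePart (ofRealVec x) = x := by
  ext i; simp [rePart, ofRealVec]

theorem rePart_add (v w : Fin (n + 1) → ℂ) : rePart (v + w) = rePart v + rePart w := by
  ext i; simp [rePart]

theorem rePart_smul_ofRealVec (ζ : ℂ) (x : Eucl n) :
    rePart (ζ • ofRealVec x) = ζ.re • x := by
  ext i; simp [rePart, ofRealVec]

theorem continuous_rePart : Continuous (rePart : (Fin (n + 1) → ℂ) → Eucl n) := by
  unfold rePart
  fun_prop

theorem norm_ofRealVec_le (x : Eucl n) : ‖ofRealVec x‖ ≤ ‖x‖ := by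
  rw [pi_norm_le_iff_of_nonneg (norm_nonneg _)]
  intro i
  rw [ofRealVec, Complex.norm_real]
  exact PiLp.norm_apply_le x i

theorem ofRealVec_sub (x y : Eucl n) : ofRealVec (x - y) = ofRealVec x - ofRealVec y := by
  funext i; simp [ofRealVec]

theorem exists_taylor_bound {V : Type*} [NormedAddCommGroup V] [NormedSpace ℝ V] {φ : V → ℝ}
    {Ω : Set V} (hΩ : IsOpen Ω) (hφ : ContDiffOn ℝ ∞ φ Ω) {w : V} (hw : w ∈ Ω) :
    ∃ r > 0, r ≤ 1 ∧ ∃ C ≥ 0, Metric.ball w r ⊆ Ω ∧ ∀ a ∈ Metric.ball w r, ∃ L : V →L[ℝ] ℝ,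
      ∀ b ∈ Metric.ball w r, φ b ≤ φ a + L (b - a) + C * ‖b - a‖ ^ 2 := by
  have h1 : ContDiffAt ℝ ∞ φ w := hφ.contDiffAt (hΩ.mem_nhds hw)
  have h2 : ContDiffAt ℝ 1 (fderiv ℝ φ) w :=
    h1.fderiv_right (by
      rw [one_add_one_eq_two]
      exact ENat.LEInfty.out)
  obtain ⟨C, t, ht, hC⟩ := h2.exists_lipschitzOnWith
  obtain ⟨r', hr', hrt'⟩ := Metric.mem_nhds_iff.1 (inter_mem ht (hΩ.mem_nhds hw))
  obtain ⟨r, hr, hr1, hrr'⟩ : ∃ r > 0, r ≤ 1 ∧ r ≤ r' :=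
    ⟨min r' 1, by positivity, min_le_right _ _, min_le_left _ _⟩
  have hrt := (Metric.ball_subset_ball hrr').trans hrt'
  refine ⟨r, hr, hr1, C, C.coe_nonneg, fun x hx => (hrt hx).2, fun a ha => ⟨fderiv ℝ φ a,
    fun b hb => ?_⟩⟩
  have hs : Convex ℝ (Metric.ball w r ∩ Metric.closedBall a ‖b - a‖) :=
    (convex_ball _ _).inter (convex_closedBall _ _)
  have key := hs.norm_image_sub_le_of_norm_fderiv_le' (𝕜 := ℝ) (f := φ) (φ := fderiv ℝ φ a)
    (C := C * ‖b - a‖) (x := a) (y := b)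
    (fun x hx => (hφ.contDiffAt (hΩ.mem_nhds (hrt hx.1).2)).differentiableAt (by simp))
    (fun x hx => by
      refine (hC.norm_sub_le (hrt hx.1).1 (hrt ha).1).trans ?_
      have := mem_closedBall_iff_norm.1 hx.2
      gcongr) ⟨ha, Metric.mem_closedBall_self (norm_nonneg _)⟩
    ⟨hb, mem_closedBall_iff_norm.2 le_rfl⟩
  have := (abs_le.1 key).2
  nlinarith

/-- Where `f ∘ Re + φ` is plurisubharmonic, `f` is convex up to a quadratic function. -/
theorem exists_convexOn_add_sq {φ : (Fin (n + 1) → ℂ) → ℝ} {Ω : Set (Fin (n + 1) → ℂ)}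
    (hΩ : IsOpen Ω) (hφ : ContDiffOn ℝ ∞ φ Ω) {x₀ : Eucl n} (hx₀ : ofRealVec x₀ ∈ Ω) :
    ∃ r > 0, r ≤ 1 / 2 ∧ ∃ Λ ≥ 0, ∀ f : Eucl n → ℝ, ContinuousOn f (Metric.ball x₀ r) →
      IsPSHOn (fun v => f (rePart v) + φ v) Ω →
      ConvexOn ℝ (Metric.ball x₀ r) fun x => f x + Λ * ‖x‖ ^ 2 := by
  obtain ⟨r, hr, hr1, C, hC, hsub, htaylor⟩ := exists_taylor_bound hΩ hφ hx₀
  -- Halving the radius keeps the discs used below inside the ball of the Taylor estimate. The mean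
  -- of (Re ζ)² over the unit circle is 1/2, so Λ / 2 has to exceed the Taylor constant C, hence Λ =
  -- 2 C + 1.
  refine ⟨r / 2, half_pos hr, by linarith, 2 * C + 1, by positivity, fun f hf hpsh =>
    ⟨convex_ball _ _, fun p hp q hq α β hα hβ hαβ => ?_⟩⟩
  set Λ := 2 * C + 1 with hΛ
  obtain rfl : α = 1 - β := by linarith
  set G : Eucl n → ℝ := fun x => f x + Λ * ‖x‖ ^ 2 with hG
  let P : ℝ → Eucl n := fun s => p + s • (q - p)
  have hP : ∀ s, (1 - s) • p + s • q = P s := fun s => by simp only [P]; module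
  have hPmem : ∀ s ∈ Set.Icc (0 : ℝ) 1, P s ∈ Metric.ball x₀ (r / 2) := fun s hs => by
    rw [← hP]
    exact convex_ball _ _ hp hq (by linarith [hs.2]) hs.1 (by ring)
  -- The excess of G over its chord. If convexity fails, it has a positive maximum at an interior
  -- point s, where the sub-mean value inequality will be violated.
  let D : ℝ → ℝ := fun s => G (P s) - ((1 - s) * G p + s * G q)
  have hPc : Continuous P := by fun_prop
  have hDc : ContinuousOn D (Set.Icc 0 1) := by
    have : ContinuousOn (fun s => f (P s)) (Set.Icc 0 1) := hf.comp hPc.continuousOn hPmem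
    exact (this.add (by fun_prop)).sub (by fun_prop)
  have hβ1 : β ∈ Set.Icc (0 : ℝ) 1 := ⟨hβ, by linarith⟩
  rw [hP]
  change G (P β) ≤ (1 - β) * G p + β * G q
  by_contra! hlt
  have hDβ : 0 < D β := sub_pos.2 hlt
  obtain ⟨s, hs, hmax⟩ := isCompact_Icc.exists_isMaxOn ⟨β, hβ1⟩ hDc
  have hDs : 0 < D s := hDβ.trans_le (hmax hβ1)
  have hs0 : s ≠ 0 := by
    rintro rfl
    simp [D, P] at hDs
  have hs1 : s ≠ 1 := by
    rintro rfl
    simp [D, P] at hDs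
  have hs' : 0 < s ∧ s < 1 := ⟨lt_of_le_of_ne hs.1 hs0.symm, lt_of_le_of_ne hs.2 hs1⟩
  have hpq : 0 < ‖q - p‖ := by
    rw [norm_pos_iff]
    intro h0
    have : q = p := sub_eq_zero.1 h0
    simp only [D, P, this, sub_self, smul_zero, add_zero] at hDs
    linarith
  obtain ⟨δ, hδ, hδ0, hδ1, hδr⟩ : ∃ δ > 0, δ ≤ s ∧ δ ≤ 1 - s ∧ δ * ‖q - p‖ < r / 2 := by
    refine ⟨min (min s (1 - s)) (r / 4 / ‖q - p‖), ?_, ?_, ?_, ?_⟩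
    · have : 0 < 1 - s := by linarith
      have := hs'.1
      positivity
    · exact (min_le_left _ _).trans (min_le_left _ _)
    · exact (min_le_left _ _).trans (min_le_right _ _)
    · calc _ ≤ r / 4 / ‖q - p‖ * ‖q - p‖ := by gcongr; exact min_le_right _ _
        _ = r / 4 := by field_simp
        _ < r / 2 := by linarith
  -- The disc lies in the complexified line through p and q, so the real parts of its points stay on
  -- the segment.
  set a : Fin (n + 1) → ℂ := ofRealVec (P s) with ha
  set b : Fin (n + 1) → ℂ := ofRealVec (δ • (q - p)) with hb
  have hbn : ‖b‖ ≤ δ * ‖q - p‖ := by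
    refine (norm_ofRealVec_le _).trans ?_
    rw [norm_smul, Real.norm_of_nonneg hδ.le]
  have hamem : a ∈ Metric.ball (ofRealVec x₀) (r / 2) := by
    rw [mem_ball_iff_norm, ha, ← ofRealVec_sub]
    exact (norm_ofRealVec_le _).trans_lt (mem_ball_iff_norm.1 (hPmem s hs))
  have hdisc : ∀ ζ : ℂ, ‖ζ‖ ≤ 1 → a + ζ • b ∈ Metric.ball (ofRealVec x₀) r := by
    intro ζ hζ
    rw [mem_ball_iff_norm] at hamem ⊢
    have h3 : ‖ζ • b‖ ≤ 1 * (δ * ‖q - p‖) := by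
      rw [norm_smul]; gcongr
    calc ‖a + ζ • b - ofRealVec x₀‖ = ‖(a - ofRealVec x₀) + ζ • b‖ := by congr 1; abel
      _ ≤ _ := norm_add_le _ _
      _ < r := by linarith
  obtain ⟨hint, hle⟩ := hpsh.2 a b fun ζ hζ => hsub (hdisc ζ hζ)
  obtain ⟨L, hL⟩ := htaylor a (by simpa using hdisc 0 (by simp))
  have hre : ∀ ζ : ℂ, rePart (a + ζ • b) = P (s + δ * ζ.re) := fun ζ => by
    rw [rePart_add, ha, hb, rePart_ofRealVec, rePart_smul_ofRealVec]
    simp only [P]; module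
  -- the integrand is bounded by a quadratic polynomial with small mean
  set d := q - p with hd
  set A : ℝ := L b - Λ * (2 * δ * inner ℝ (P s) d) + δ * (G q - G p) with hA
  set B : ℝ := L (Complex.I • b) with hB
  have hLζ : ∀ ζ : ℂ, L (ζ • b) = ζ.re * L b + ζ.im * B := fun ζ => by
    have : ζ • b = ζ.re • b + ζ.im • (Complex.I • b) := by
      conv_lhs => rw [← Complex.re_add_im ζ]
      rw [add_smul, mul_smul]; rfl
    rw [this, map_add, map_smul, map_smul, smul_eq_mul, smul_eq_mul]
  have hbound : ∀ ζ ∈ Metric.sphere (0 : ℂ) |1|, f (rePart (a + ζ • b)) + φ (a + ζ • b) ≤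
      (f (P s) + φ a + C * (δ * ‖d‖) ^ 2) + A * ζ.re + B * ζ.im -
        (Λ * (δ * ‖d‖) ^ 2) * ζ.re ^ 2 := by
    intro ζ hζ
    have hζ1 : ‖ζ‖ = 1 := by simpa using hζ
    have hr1 := abs_le.1 ((Complex.abs_re_le_norm ζ).trans hζ1.le)
    have h1 := hL (a + ζ • b) (hdisc ζ hζ1.le)
    rw [add_sub_cancel_left, hLζ] at h1
    have h2 : C * ‖ζ • b‖ ^ 2 ≤ C * (δ * ‖d‖) ^ 2 := by
      rw [norm_smul, hζ1, one_mul]; gcongr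
    have h3 : D (s + δ * ζ.re) ≤ D s := hmax ⟨by nlinarith, by nlinarith⟩
    have h4 : ‖P (s + δ * ζ.re)‖ ^ 2 = ‖P s‖ ^ 2 + 2 * (δ * ζ.re * inner ℝ (P s) d) +
        (δ * ζ.re) ^ 2 * ‖d‖ ^ 2 := by
      have : P (s + δ * ζ.re) = P s + (δ * ζ.re) • d := by simp only [P]; module
      rw [this, norm_add_sq_real, inner_smul_right, norm_smul, mul_pow, Real.norm_eq_abs, sq_abs]
    simp only [D, hG, h4] at h3
    rw [hre]
    simp only [hA, hG]
    linarith
  have havg := Real.circleAverage_mono hint (circleIntegrable_quadratic _ _ _ _) hbound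
  rw [circleAverage_quadratic] at havg
  have h5 := hle.trans havg
  beta_reduce at h5
  rw [show rePart a = P s from rePart_ofRealVec _] at h5
  have h6 : 0 < (δ * ‖d‖) ^ 2 := by positivity
  have h7 : Λ * (δ * ‖d‖) ^ 2 / 2 = C * (δ * ‖d‖) ^ 2 + (δ * ‖d‖) ^ 2 / 2 := by rw [hΛ]; ring
  linarith

theorem exists_subgradient {G : Eucl n → ℝ} {x : Eucl n} {r : ℝ} (hr : 0 < r)
    (hG : ConvexOn ℝ (Metric.ball x r) G) (hc : ContinuousOn G (Metric.ball x r)) :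
    ∃ η : Eucl n, ∀ y ∈ Metric.ball x r, G x + inner ℝ η (y - x) ≤ G y := by
  have hx : x ∈ Metric.ball x r := Metric.mem_ball_self hr
  have hopen : IsOpen {q : Eucl n × ℝ | q.1 ∈ Metric.ball x r ∧ G q.1 < q.2} := by
    have h1 : IsOpen (Metric.ball x r ×ˢ (Set.univ : Set ℝ)) := Metric.isOpen_ball.prod isOpen_univ
    have h2 : ContinuousOn (fun q : Eucl n × ℝ => q.2 - G q.1) (Metric.ball x r ×ˢ Set.univ) :=
      continuousOn_snd.sub (hc.comp continuousOn_fst fun q hq => hq.1)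
    have h3 := h2.isOpen_inter_preimage h1 (isOpen_Ioi (a := (0 : ℝ)))
    convert! h3 using 1
    ext q
    simp
  obtain ⟨f, hf⟩ := geometric_hahn_banach_point_open hG.convex_strict_epigraph hopen
    (x := (x, G x)) (by simp)
  set c := f (0, 1) with hc'
  have hsplit : ∀ (y : Eucl n) (t : ℝ), f (y, t) = f (y, 0) + t * c := fun y t => by
    have : ((y, t) : Eucl n × ℝ) = (y, 0) + t • (0, 1) := by simp
    rw [this, map_add, map_smul, smul_eq_mul]
  have hcpos : 0 < c := by
    have := hf (x, G x + 1) ⟨hx, by simp⟩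
    rw [hsplit, hsplit x (G x + 1)] at this
    linarith
  let η : Eucl n := (InnerProductSpace.toDual ℝ (Eucl n)).symm
    (f.comp (ContinuousLinearMap.inl ℝ (Eucl n) ℝ))
  have hη : ∀ v, inner ℝ η v = f (v, 0) := fun v => by
    rw [InnerProductSpace.toDual_symm_apply]; rfl
  refine ⟨-(c⁻¹ • η), fun y hy => ?_⟩
  refine le_of_forall_pos_le_add fun ε hε => ?_
  have h1 := hf (y, G y + ε) ⟨hy, by simpa using hε⟩
  rw [hsplit, hsplit y] at h1
  rw [inner_neg_left, inner_smul_left, inner_sub_right, hη, hη, conj_trivial]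
  have h2 : f (x, 0) - f (y, 0) < (G y + ε - G x) * c := by linarith
  have h3 : c⁻¹ * (f (x, 0) - f (y, 0)) < G y + ε - G x := by
    rw [inv_mul_eq_div, div_lt_iff₀ hcpos]; exact h2
  linarith

/-! ### Semiconvex functions on the sphere -/

/-- Lower bounds by tangential affine functions up to a quadratic error. -/
def IsSemiconvex (c : ℝ) (f : Sph n → ℝ) : Prop :=
  ∀ x : Sph n, ∃ ξ : Eucl n, inner ℝ ξ (x : Eucl n) = 0 ∧ ‖ξ‖ ≤ c ∧
    ∀ y : Sph n, f x + inner ℝ ξ (y : Eucl n) - c * ‖(y : Eucl n) - x‖ ^ 2 ≤ f y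

theorem homExt_eq (z : Sph n → ℝ) {x : Eucl n} (hx : x ≠ 0) : homExt z x = z (dir x) := by
  rw [homExt, dif_neg hx]
  congr 1
  exact Subtype.ext (coe_dir hx).symm

theorem homExt_sph (z : Sph n → ℝ) (u : Sph n) : homExt z u = z u := by
  rw [homExt_eq z (sph_ne_zero u)]
  congr 1
  have := dir_smul one_pos u
  rwa [one_smul] at this

theorem homExt_smul (z : Sph n → ℝ) {r : ℝ} (hr : 0 < r) {x : Eucl n} (hx : x ≠ 0) :
    homExt z (r • x) = homExt z x := by
  rw [homExt_eq z hx, homExt_eq z (smul_ne_zero hr.ne' hx), dir_smul_pos hr hx]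

theorem continuousOn_homExt {z : Sph n → ℝ} (hz : Continuous z) :
    ContinuousOn (homExt z) {0}ᶜ := by
  have h : Continuous fun x : ({0}ᶜ : Set (Eucl n)) => dir (x : Eucl n) := by
    refine continuous_induced_rng.2 (Continuous.congr ?_ fun x => (coe_dir x.2).symm)
    exact (Continuous.inv₀ (by fun_prop) fun x => norm_ne_zero_iff.2 x.2).smul (by fun_prop)
  rw [continuousOn_iff_continuous_domRestrict]
  exact (hz.comp h).congr fun x => (homExt_eq z x.2).symm

/-- Compactness of the sphere makes the local radius and the local constant uniform, also in k.
Radii up to 1/2 keep the balls away from the origin. -/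
theorem exists_uniform_convexOn {κ : Type} {ζ : κ → Sph n → ℝ} (hζ : IsQuasiPSHFamily ζ)
    (hc : ∀ k, Continuous (ζ k)) : ∃ r > 0, r ≤ 1 / 2 ∧ ∃ Λ ≥ 0, ∀ (x : Sph n) (k : κ),
      ConvexOn ℝ (Metric.ball (x : Eucl n) r) fun y => homExt (ζ k) y + Λ * ‖y‖ ^ 2 := by
  have ne : ∀ {x : Sph n} {r : ℝ}, r ≤ 1 / 2 → Metric.ball (x : Eucl n) r ⊆ {0}ᶜ := by
    rintro x r hr y hy rfl
    rw [mem_ball_iff_norm, zero_sub, norm_neg, norm_sph] at hy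
    linarith
  have key : ∃ r > 0, r ≤ 1 / 2 ∧ ∃ Λ ≥ 0, ∀ x ∈ (Set.univ : Set (Sph n)), ∀ k : κ,
      ConvexOn ℝ (Metric.ball (x : Eucl n) r) fun y => homExt (ζ k) y + Λ * ‖y‖ ^ 2 := by
    refine isCompact_univ.induction_on (p := fun s => ∃ r > 0, r ≤ 1 / 2 ∧ ∃ Λ ≥ 0,
      ∀ x ∈ (s : Set (Sph n)), ∀ k : κ, ConvexOn ℝ (Metric.ball (x : Eucl n) r)
        fun y => homExt (ζ k) y + Λ * ‖y‖ ^ 2) ?_ ?_ ?_ ?_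
    · exact ⟨1 / 2, by norm_num, le_rfl, 0, le_rfl, by simp⟩
    · rintro s t hst ⟨r, hr, hr2, Λ, hΛ, h⟩
      exact ⟨r, hr, hr2, Λ, hΛ, fun x hx => h x (hst hx)⟩
    · have mono : ∀ {x : Sph n} {r r' Λ Λ' : ℝ} {k : κ}, r' ≤ r → Λ ≤ Λ' →
          ConvexOn ℝ (Metric.ball (x : Eucl n) r) (fun y => homExt (ζ k) y + Λ * ‖y‖ ^ 2) →
          ConvexOn ℝ (Metric.ball (x : Eucl n) r') fun y => homExt (ζ k) y + Λ' * ‖y‖ ^ 2 := by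
        intro x r r' Λ Λ' k h1 h2 h3
        have h4 : ConvexOn ℝ (Metric.ball (x : Eucl n) r') fun y : Eucl n => (Λ' - Λ) * ‖y‖ ^ 2 :=
          ((convexOn_norm (convex_ball _ _)).pow (fun _ _ => norm_nonneg _) 2).smul
            (sub_nonneg.2 h2)
        refine ((h3.subset (Metric.ball_subset_ball h1) (convex_ball _ _)).add h4).congr
          fun y _ => ?_
        simp only [Pi.add_apply]; ring
      rintro s t ⟨r, hr, hr2, Λ, hΛ, h⟩ ⟨r', hr', hr2', Λ', hΛ', h'⟩
      refine ⟨min r r', lt_min hr hr', (min_le_left _ _).trans hr2, max Λ Λ', le_max_of_le_left hΛ,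
        fun x hx k => ?_⟩
      rcases hx with hx | hx
      · exact mono (min_le_left _ _) (le_max_left _ _) (h x hx k)
      · exact mono (min_le_right _ _) (le_max_right _ _) (h' x hx k)
    · intro x _
      obtain ⟨Ω, hΩ, hxΩ, φ, hφ, hk⟩ := hζ (ofRealVec x) (by
        rw [rePart_ofRealVec]; exact sph_ne_zero x)
      obtain ⟨r, hr, hr2, Λ, hΛ, H⟩ := exists_convexOn_add_sq hΩ hφ hxΩ
      refine ⟨Metric.ball x (r / 2), mem_nhdsWithin_of_mem_nhds
        (Metric.ball_mem_nhds _ (by positivity)), r / 2, by positivity, by linarith, Λ, hΛ, ?_⟩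
      intro y hy k
      refine (H _ ((continuousOn_homExt (hc k)).mono (ne hr2)) (hk k)).subset (fun w hw => ?_)
        (convex_ball _ _)
      have h1 : dist (y : Eucl n) x < r / 2 := hy
      have h2 := dist_triangle w (y : Eucl n) x
      rw [Metric.mem_ball] at hw ⊢
      linarith
  obtain ⟨r, hr, hr2, Λ, hΛ, h⟩ := key
  exact ⟨r, hr, hr2, Λ, hΛ, fun x k => h x (Set.mem_univ x) k⟩

/-- A subgradient of the convex function with the quadratic part removed supports the extension from
below up to a quadratic error. Degree 0 homogeneity makes it tangential, and the bound B controls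
its length, so the constant depends only on the family. -/
theorem exists_isSemiconvex {κ : Type} {ζ : κ → Sph n → ℝ} (hζ : IsQuasiPSHFamily ζ)
    (hc : ∀ k, Continuous (ζ k)) {B : ℝ} (hB : ∀ k x, |ζ k x| ≤ B) :
    ∃ c, ∀ k, IsSemiconvex c (ζ k) := by
  obtain ⟨r, hr, hr2, Λ, hΛ, H⟩ := exists_uniform_convexOn hζ hc
  have ne : ∀ {x : Sph n} {y : Eucl n}, y ∈ Metric.ball (x : Eucl n) r → y ≠ 0 := by
    rintro x y hy rfl
    rw [mem_ball_iff_norm, zero_sub, norm_neg, norm_sph] at hy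
    linarith
  -- X results from testing at distance r / 2 in the direction of ξ. The last entry of c makes the
  -- inequality hold trivially at distances of at least r.
  set X := (2 * B + Λ * (r / 2) ^ 2) / (r / 2) with hX
  set c := max X (max Λ ((2 * B + 2 * X) / r ^ 2)) with hcdef
  refine ⟨c, fun k x => ?_⟩
  have hBk : ∀ y, |homExt (ζ k) y| ≤ B ∨ y = 0 := fun y => by
    by_cases hy : y = 0
    · exact Or.inr hy
    · rw [homExt_eq _ hy]; exact Or.inl (hB k _)
  obtain ⟨η, hη⟩ := exists_subgradient hr (H x k)
    (((continuousOn_homExt (hc k)).mono fun y hy => ne hy).add (by fun_prop))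
  set ξ : Eucl n := η - (2 * Λ) • (x : Eucl n) with hξ
  have hsub : ∀ y ∈ Metric.ball (x : Eucl n) r,
      ζ k x + inner ℝ ξ (y - x) - Λ * ‖y - x‖ ^ 2 ≤ homExt (ζ k) y := by
    intro y hy
    have h1 := hη y hy
    rw [homExt_sph] at h1
    have h2 : ‖y‖ ^ 2 = ‖(x : Eucl n)‖ ^ 2 + 2 * inner ℝ (x : Eucl n) (y - x) + ‖y - x‖ ^ 2 := by
      rw [← norm_add_sq_real, add_sub_cancel]
    rw [hξ, inner_sub_left, inner_smul_left, conj_trivial]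
    nlinarith
  have htan : inner ℝ ξ (x : Eucl n) = 0 := by
    -- Along the ray through x the extension is constant, so the linear term is dominated by the
    -- quadratic one for both signs of t and must vanish.
    have hray : ∀ t : ℝ, |t| < r → t * inner ℝ ξ (x : Eucl n) ≤ Λ * t ^ 2 := by
      intro t ht
      have h1 := hsub ((1 + t) • (x : Eucl n)) (by
        rw [mem_ball_iff_norm, add_smul, one_smul, add_sub_cancel_left, norm_smul, norm_sph,
          mul_one]
        exact ht)
      rw [homExt_smul _ (by linarith [(abs_lt.1 ht).1]) (sph_ne_zero x), homExt_sph, add_smul,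
        one_smul, add_sub_cancel_left, inner_smul_right, norm_smul, norm_sph, mul_one,
        Real.norm_eq_abs, sq_abs] at h1
      linarith
    by_contra h0
    set q := inner ℝ ξ (x : Eucl n) with hq
    have hq' : 0 < |q| := abs_pos.2 h0
    have hε : 0 < min (r / 2) (|q| / (2 * (Λ + 1))) := by positivity
    set ε := min (r / 2) (|q| / (2 * (Λ + 1))) with hεd
    have hε1 : ε ≤ r / 2 := min_le_left _ _
    have hε2 : ε * (2 * (Λ + 1)) ≤ |q| := by
      rw [← le_div_iff₀ (by positivity)]; exact min_le_right _ _
    have h3 : ε * |q| ≤ Λ * ε ^ 2 := by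
      rcases abs_cases q with ⟨h, -⟩ | ⟨h, -⟩
      · rw [h]; exact hray ε (by rw [abs_of_pos hε]; linarith)
      · have := hray (-ε) (by rw [abs_neg, abs_of_pos hε]; linarith)
        rw [h]; nlinarith
    have h4 : |q| ≤ Λ * ε := by
      refine le_of_mul_le_mul_left ?_ hε
      linarith
    nlinarith
  have hB0 : 0 ≤ B := (abs_nonneg _).trans (hB k x)
  have hnorm : ‖ξ‖ ≤ X := by
    rcases eq_or_ne ξ 0 with h0 | h0
    · rw [h0, norm_zero]; positivity
    have h0' : 0 < ‖ξ‖ := norm_pos_iff.2 h0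
    set y : Eucl n := x + (r / 2) • (‖ξ‖⁻¹ • ξ) with hy
    have e1 : y - x = (r / 2) • (‖ξ‖⁻¹ • ξ) := by rw [hy, add_sub_cancel_left]
    have e2 : ‖y - x‖ = r / 2 := by
      rw [e1, norm_smul, norm_smul, norm_inv, norm_norm, inv_mul_cancel₀ h0'.ne', mul_one,
        Real.norm_of_nonneg (by positivity)]
    have hmem : y ∈ Metric.ball (x : Eucl n) r := by
      rw [mem_ball_iff_norm, e2]; linarith
    have h1 := hsub y hmem
    have h2 : homExt (ζ k) y ≤ B :=
      (abs_le.1 ((hBk y).resolve_right (ne hmem))).2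
    have h3 := (abs_le.1 (hB k x)).1
    rw [e2, e1, inner_smul_right, inner_smul_right, real_inner_self_eq_norm_sq, sq,
      inv_mul_cancel_left₀ h0'.ne'] at h1
    rw [hX, le_div_iff₀ (by positivity)]
    nlinarith
  refine ⟨ξ, htan, hnorm.trans (le_max_left _ _), fun y => ?_⟩
  have hcΛ : Λ ≤ c := (le_max_left _ _).trans (le_max_right _ _)
  have hcr : (2 * B + 2 * X) / r ^ 2 ≤ c := (le_max_right _ _).trans (le_max_right _ _)
  by_cases hyr : (y : Eucl n) ∈ Metric.ball (x : Eucl n) r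
  · have h1 := hsub y hyr
    rw [homExt_sph, inner_sub_right, htan, sub_zero] at h1
    nlinarith [sq_nonneg ‖(y : Eucl n) - x‖]
  · rw [mem_ball_iff_norm, not_lt] at hyr
    have h1 : inner ℝ ξ (y : Eucl n) ≤ X := by
      refine (real_inner_le_norm _ _).trans ?_
      rw [norm_sph, mul_one]; exact hnorm
    have h2 := (abs_le.1 (hB k x)).2
    have h3 := (abs_le.1 (hB k y)).1
    have hX0 : 0 ≤ X := (norm_nonneg _).trans hnorm
    have h4 : 2 * B + 2 * X ≤ c * ‖(y : Eucl n) - x‖ ^ 2 := by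
      rw [div_le_iff₀ (by positivity)] at hcr
      refine hcr.trans ?_
      have : 0 ≤ c := hΛ.trans hcΛ
      gcongr
    linarith

theorem inner_sph (x y : Sph n) :
    inner ℝ (x : Eucl n) (y : Eucl n) = 1 - ‖(y : Eucl n) - x‖ ^ 2 / 2 := by
  rw [norm_sub_sq_real, norm_sph, norm_sph, real_inner_comm]; ring

/-! ### Support functions and semiconvexity -/

/-- For unit vectors ⟨x, y⟩ = 1 - ‖y - x‖² / 2, so the hypothesis says that the vector ξ + G(x) x
defines a linear function below G that touches it at x. -/
theorem exists_body_of_tangent {G : C(Sph n, ℝ)}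
    (h0 : ∀ x : Sph n, ∃ ξ : Eucl n, inner ℝ ξ (x : Eucl n) = 0 ∧ ∀ y : Sph n,
    G x + inner ℝ ξ (y : Eucl n) - G x / 2 * ‖(y : Eucl n) - x‖ ^ 2 ≤ G y) :
    ∃ K : ConvexBody (Eucl n), supportMap K = G := by
  have key : ∀ x : Sph n, ∃ η : Eucl n, inner ℝ (x : Eucl n) η = G x ∧
      ∀ y, inner ℝ y η ≤ ‖y‖ * G (dir y) := by
    intro x
    obtain ⟨ξ, h1, h2⟩ := h0 x
    refine ⟨ξ + G x • (x : Eucl n), ?_, fun y => ?_⟩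
    · rw [inner_add_right, inner_smul_right, real_inner_self_eq_norm_sq, norm_sph,
        real_inner_comm, h1]; ring
    · have h3 := h2 (dir y)
      have h4 := inner_sph (dir y) x
      rw [norm_sub_rev] at h4
      conv_lhs => rw [← norm_smul_dir y]
      rw [inner_smul_left, conj_trivial]
      refine mul_le_mul_of_nonneg_left ?_ (norm_nonneg y)
      rw [inner_add_right, inner_smul_right, h4, real_inner_comm]
      linarith
  obtain ⟨K, hK⟩ := exists_body_of_subgradient (F := fun x => ‖x‖ * G (dir x)) (M := ‖G‖)
    (fun x => by
      rw [mul_comm]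
      gcongr
      exact (le_abs_self _).trans (G.norm_coe_le_norm _))
    (fun x => by
      obtain ⟨η, h1, h2⟩ := key (dir x)
      refine ⟨η, ?_, h2⟩
      conv_lhs => rw [← norm_smul_dir x]
      rw [inner_smul_left, h1, conj_trivial])
  refine ⟨K, ContinuousMap.ext fun u => ?_⟩
  change supportFn K u = G u
  have hu := dir_smul one_pos u
  rw [one_smul] at hu
  rw [hK]
  simp [hu]

theorem IsSemiconvex.exists_body {c : ℝ} {G : C(Sph n, ℝ)} (h : IsSemiconvex c G)
    (hc : ∀ x, 2 * c ≤ G x) : ∃ K : ConvexBody (Eucl n), supportMap K = G :=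
  exists_body_of_tangent fun x => by
    obtain ⟨ξ, h1, -, h2⟩ := h x
    refine ⟨ξ, h1, fun y => le_trans ?_ (h2 y)⟩
    have := hc x
    gcongr
    linarith

theorem IsSemiconvex.nonneg {c : ℝ} {f : Sph n → ℝ} (h : IsSemiconvex c f) : 0 ≤ c := by
  obtain ⟨ξ, -, h1, -⟩ := h (dir 0)
  exact (norm_nonneg _).trans h1

/-- From G(y)² ≥ G(x)² + 2 G(x) (G(y) - G(x)) the square has tangent vector 2 G(x) ξ and quadratic
error 2 c G(x), which is at most G(x)² / 2 once 4 c ≤ G(x). -/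
theorem IsSemiconvex.exists_body_sq {c : ℝ} {G : C(Sph n, ℝ)} (h : IsSemiconvex c G)
    (hc : ∀ x, 4 * c ≤ G x) : ∃ K : ConvexBody (Eucl n), supportMap K = G * G :=
  exists_body_of_tangent fun x => by
    obtain ⟨ξ, h1, -, h2⟩ := h x
    refine ⟨(2 * G x) • ξ, by rw [inner_smul_left, h1, mul_zero], fun y => ?_⟩
    have h3 := h2 y
    have h4 := hc x
    have h5 : 0 ≤ G x := by linarith [h.nonneg]
    rw [inner_smul_left, conj_trivial]
    simp only [ContinuousMap.mul_apply]
    have h6 := mul_le_mul_of_nonneg_left h3 (mul_nonneg zero_le_two h5)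
    have h7 := mul_le_mul_of_nonneg_right h4 (sq_nonneg ‖(y : Eucl n) - x‖)
    have h8 := mul_le_mul_of_nonneg_left h7 h5
    nlinarith [sq_nonneg (G y - G x)]

theorem IsSemiconvex.add_const {c : ℝ} {f : Sph n → ℝ} (h : IsSemiconvex c f) (a : ℝ) :
    IsSemiconvex c fun x => f x + a := fun x => by
  obtain ⟨ξ, h1, h2, h3⟩ := h x
  exact ⟨ξ, h1, h2, fun y => by linarith [h3 y]⟩

theorem norm_sub_sph_le (x y : Sph n) : ‖(y : Eucl n) - x‖ ≤ 2 := by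
  refine (norm_sub_le _ _).trans ?_
  rw [norm_sph, norm_sph]; norm_num

theorem IsSemiconvex.sub_le {c : ℝ} {f : Sph n → ℝ} (h : IsSemiconvex c f) (x y : Sph n) :
    f x - f y ≤ 3 * c * ‖(y : Eucl n) - x‖ := by
  obtain ⟨ξ, h1, h2, h3⟩ := h x
  have h4 := h3 y
  have h5 : inner ℝ ξ (y : Eucl n) = inner ℝ ξ ((y : Eucl n) - x) := by
    rw [inner_sub_right, h1, sub_zero]
  have h6 := (abs_le.1 (abs_real_inner_le_norm ξ ((y : Eucl n) - x))).1
  have h7 := norm_sub_sph_le x y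
  have h8 := norm_nonneg ((y : Eucl n) - x)
  have h9 := mul_le_mul_of_nonneg_right h2 h8
  have h10 := mul_le_mul_of_nonneg_left (mul_le_mul_of_nonneg_right h7 h8) h.nonneg
  rw [h5] at h4
  nlinarith

/-- Makes h (z + C), and not only z + C, a support function up to a constant. The term 3 c d is the
product of the slope c of f with the Lipschitz constant 3 d of g. -/
theorem IsSemiconvex.mul {c d B : ℝ} {f g : Sph n → ℝ} (hf : IsSemiconvex c f)
    (hg : IsSemiconvex d g) (hf0 : ∀ x, 0 ≤ f x) (hg0 : ∀ x, 0 ≤ g x) (hfB : ∀ x, f x ≤ B)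
    (hgB : ∀ x, g x ≤ B) : IsSemiconvex (B * c + B * d + 3 * c * d) fun x => f x * g x := by
  intro x
  have hc := hf.nonneg
  have hd := hg.nonneg
  have hB : 0 ≤ B := (hf0 x).trans (hfB x)
  obtain ⟨ξ, a1, a2, a3⟩ := hf x
  obtain ⟨ζ, b1, b2, b3⟩ := hg x
  refine ⟨g x • ξ + f x • ζ, ?_, ?_, fun y => ?_⟩
  · rw [inner_add_left, inner_smul_left, inner_smul_left, a1, b1]; simp
  · calc ‖g x • ξ + f x • ζ‖ ≤ g x * ‖ξ‖ + f x * ‖ζ‖ := by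
          refine (norm_add_le _ _).trans ?_
          rw [norm_smul, norm_smul, Real.norm_of_nonneg (hf0 x), Real.norm_of_nonneg (hg0 x)]
      _ ≤ B * c + B * d := by
          have := hfB x
          have := hgB x
          gcongr
      _ ≤ _ := by nlinarith [mul_nonneg hc hd]
  · rw [inner_add_left, inner_smul_left, inner_smul_left, conj_trivial, conj_trivial]
    set D := ‖(y : Eucl n) - x‖ with hD
    have hD0 : 0 ≤ D := norm_nonneg _
    set p := inner ℝ ξ (y : Eucl n) with hp
    set q := inner ℝ ζ (y : Eucl n) with hq
    have hpD : |p| ≤ c * D := by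
      have : p = inner ℝ ξ ((y : Eucl n) - x) := by rw [inner_sub_right, a1, sub_zero]
      rw [this]
      refine (abs_real_inner_le_norm _ _).trans ?_
      gcongr
    have hgD : |g y - g x| ≤ 3 * d * D := by
      rw [abs_le]
      have h1 := hg.sub_le x y
      have h2 := hg.sub_le y x
      rw [norm_sub_rev] at h2
      constructor <;> linarith
    have h1 := mul_le_mul_of_nonneg_right (a3 y) (hg0 y)
    have h2 := mul_le_mul_of_nonneg_left (b3 y) (hf0 x)
    have h3 : -(c * D * (3 * d * D)) ≤ p * (g y - g x) := by
      have : |p * (g y - g x)| ≤ c * D * (3 * d * D) := by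
        rw [abs_mul]; gcongr
      exact (abs_le.1 this).1
    have h4 : c * D ^ 2 * g y ≤ c * D ^ 2 * B := by
      have := hgB y
      gcongr
    have h5 : f x * (d * D ^ 2) ≤ B * (d * D ^ 2) := by
      have := hfB x
      gcongr
    nlinarith

theorem norm_le_of_mem {K : ConvexBody (Eucl n)} {η : Eucl n} (hη : η ∈ K) :
    ‖η‖ ≤ ‖supportMap K‖ := by
  have h1 := (inner_le_supportFn K hη η).trans (supportFn_le_norm K η)
  rw [real_inner_self_eq_norm_sq] at h1
  rcases (norm_nonneg η).eq_or_lt with h | h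
  · rw [← h]; exact norm_nonneg _
  · nlinarith

/-- Take the tangential part of a point of K with normal x. The constant depends only on a sup norm
bound, so convergent sequences of support functions are uniformly semiconvex. -/
theorem isSemiconvex_supportMap {K : ConvexBody (Eucl n)} {R : ℝ} (hR : ‖supportMap K‖ ≤ R) :
    IsSemiconvex (2 * R) (supportMap K) := by
  intro x
  obtain ⟨η, hη, h1⟩ := exists_eq_supportFn K (x : Eucl n)
  have h2 : |supportMap K x| ≤ R := ((supportMap K).norm_coe_le_norm x).trans hR
  have h3 : ‖η‖ ≤ R := (norm_le_of_mem hη).trans hR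
  refine ⟨η - supportMap K x • (x : Eucl n), ?_, ?_, fun y => ?_⟩
  · rw [inner_sub_left, inner_smul_left, real_inner_self_eq_norm_sq, norm_sph, real_inner_comm, h1]
    simp [supportMap]
  · refine (norm_sub_le _ _).trans ?_
    rw [norm_smul, norm_sph, Real.norm_eq_abs]
    linarith
  · have h4 : inner ℝ (y : Eucl n) η ≤ supportMap K y := inner_le_supportFn K hη y
    rw [inner_sub_left, inner_smul_left, conj_trivial, inner_sph, real_inner_comm]
    have h5 := (abs_le.1 h2).2
    have h6 := (abs_nonneg _).trans h2
    have h7 := sq_nonneg ‖(y : Eucl n) - x‖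
    nlinarith

/-! ### Semiconvex families are quasi-plurisubharmonic -/

theorem dist_dir_le {x y : Eucl n} (hx : x ≠ 0) (hy : y ≠ 0) :
    ‖(dir y : Eucl n) - dir x‖ ≤ 2 * ‖y - x‖ / ‖x‖ := by
  have hx' : 0 < ‖x‖ := norm_pos_iff.2 hx
  rw [le_div_iff₀ hx']
  have e : ‖x‖ • ((dir y : Eucl n) - dir x) = (y - x) + (‖x‖ - ‖y‖) • (dir y : Eucl n) := by
    rw [smul_sub, norm_smul_dir, sub_smul, norm_smul_dir]; abel
  have h1 : ‖‖x‖ • ((dir y : Eucl n) - dir x)‖ = ‖(dir y : Eucl n) - dir x‖ * ‖x‖ := by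
    rw [norm_smul, norm_norm, mul_comm]
  rw [← h1, e]
  refine (norm_add_le _ _).trans ?_
  rw [norm_smul, norm_sph, mul_one, Real.norm_eq_abs]
  have := abs_norm_sub_norm_le x y
  rw [norm_sub_rev] at this
  linarith

/-- Of the factor 5, four comes from the squared Lipschitz estimate for x ↦ x / ‖x‖ and one from
replacing 1 / ‖y‖ by 1 / ‖x‖ in the linear term. -/
theorem IsSemiconvex.homExt_ge {c : ℝ} {f : Sph n → ℝ} (h : IsSemiconvex c f) {ρ : ℝ}
    (hρ : 0 < ρ) {x : Eucl n} (hx : ρ ≤ ‖x‖) : ∃ η : Eucl n, ∀ y : Eucl n, ρ ≤ ‖y‖ →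
      homExt f x + inner ℝ η (y - x) - 5 * c / ρ ^ 2 * ‖y - x‖ ^ 2 ≤ homExt f y := by
  have hx0 : x ≠ 0 := norm_pos_iff.1 (hρ.trans_le hx)
  have hx' : 0 < ‖x‖ := hρ.trans_le hx
  have hc := h.nonneg
  obtain ⟨ξ, h1, h2, h3⟩ := h (dir x)
  refine ⟨‖x‖⁻¹ • ξ, fun y hy => ?_⟩
  have hy0 : y ≠ 0 := norm_pos_iff.1 (hρ.trans_le hy)
  have hy' : 0 < ‖y‖ := hρ.trans_le hy
  have h4 := h3 (dir y)
  rw [homExt_eq f hx0, homExt_eq f hy0]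
  refine le_trans ?_ h4
  have hξx : inner ℝ ξ x = 0 := by
    conv_lhs => rw [← norm_smul_dir x]
    rw [inner_smul_right, h1, mul_zero]
  have e1 : inner ℝ ξ (dir y : Eucl n) = ‖y‖⁻¹ * inner ℝ ξ (y - x) := by
    rw [coe_dir hy0, inner_smul_right, inner_sub_right, hξx, sub_zero]
  have e2 : ‖(dir y : Eucl n) - dir x‖ ^ 2 ≤ 4 * ‖y - x‖ ^ 2 / ρ ^ 2 := by
    calc _ ≤ (2 * ‖y - x‖ / ‖x‖) ^ 2 := by gcongr; exact dist_dir_le hx0 hy0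
      _ ≤ (2 * ‖y - x‖ / ρ) ^ 2 := by gcongr
      _ = _ := by ring
  have e3 : (‖x‖⁻¹ - ‖y‖⁻¹) * inner ℝ ξ (y - x) ≤ c * ‖y - x‖ ^ 2 / ρ ^ 2 := by
    refine (le_abs_self _).trans ?_
    rw [abs_mul]
    have h5 : |‖x‖⁻¹ - ‖y‖⁻¹| ≤ ‖y - x‖ / ρ ^ 2 := by
      rw [inv_sub_inv hx'.ne' hy'.ne', abs_div, abs_of_pos (mul_pos hx' hy')]
      have := abs_norm_sub_norm_le y x
      calc _ ≤ ‖y - x‖ / (‖x‖ * ‖y‖) := by gcongr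
        _ ≤ ‖y - x‖ / (ρ * ρ) := by gcongr
        _ = _ := by rw [sq]
    have h6 : |inner ℝ ξ (y - x)| ≤ c * ‖y - x‖ := (abs_real_inner_le_norm _ _).trans (by gcongr)
    calc _ ≤ ‖y - x‖ / ρ ^ 2 * (c * ‖y - x‖) := by gcongr
      _ = _ := by ring
  rw [e1, inner_smul_left, conj_trivial]
  have e4 := mul_le_mul_of_nonneg_left e2 hc
  have e5 : 5 * c / ρ ^ 2 * ‖y - x‖ ^ 2 =
      c * (4 * ‖y - x‖ ^ 2 / ρ ^ 2) + c * ‖y - x‖ ^ 2 / ρ ^ 2 := by ring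
  rw [e5]
  linarith

theorem rePart_smul (ζ : ℂ) (b : Fin (n + 1) → ℂ) :
    rePart (ζ • b) = ζ.re • rePart b + ζ.im • rePart (Complex.I • b) := by
  ext i; simp [rePart]; ring

/-- With a multiple of ‖Re v‖² added, each function has an affine minorant touching it at the centre
of any disc, and affine functions satisfy the mean value property. This shows that the smooth
approximations constructed below are admissible. -/
theorem isQuasiPSHFamily_of_isSemiconvex {κ : Type} {ζ : κ → Sph n → ℝ} {c : ℝ}
    (h : ∀ k, IsSemiconvex c (ζ k)) (hc : ∀ k, Continuous (ζ k)) : IsQuasiPSHFamily ζ := by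
  intro w hw
  set ρ := ‖rePart w‖ / 2 with hρd
  have hρ : 0 < ρ := by have := norm_pos_iff.2 hw; positivity
  set Λ := 5 * c / ρ ^ 2 with hΛ
  have hΩ : ∀ v ∈ rePart ⁻¹' {x : Eucl n | ρ < ‖x‖}, (rePart v : Eucl n) ∈ ({0}ᶜ : Set (Eucl n)) :=
    fun _ hv => norm_pos_iff.1 (hρ.trans hv)
  have hφ : ContDiff ℝ ∞ fun v : Fin (n + 1) → ℂ => Λ * ‖rePart v‖ ^ 2 := by
    have : ContDiff ℝ ∞ (rePart : (Fin (n + 1) → ℂ) → Eucl n) := by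
      rw [contDiff_euclidean]
      intro i
      exact (Complex.reCLM.contDiff).comp (contDiff_apply ℝ ℂ i)
    exact contDiff_const.mul (this.norm_sq ℝ)
  refine ⟨rePart ⁻¹' {x | ρ < ‖x‖},
    (isOpen_lt continuous_const continuous_norm).preimage continuous_rePart, ?_, _,
    hφ.contDiffOn, fun k => ?_⟩
  · change ρ < ‖rePart w‖
    linarith
  have hcont : ContinuousOn (fun v => homExt (ζ k) (rePart v) + Λ * ‖rePart v‖ ^ 2)
      (rePart ⁻¹' {x : Eucl n | ρ < ‖x‖}) :=
    ((continuousOn_homExt (hc k)).comp continuous_rePart.continuousOn hΩ).add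
      hφ.continuous.continuousOn
  refine ⟨hcont.upperSemicontinuousOn, fun a b hab => ?_⟩
  have hint : CircleIntegrable (fun ζ' : ℂ =>
      homExt (ζ k) (rePart (a + ζ' • b)) + Λ * ‖rePart (a + ζ' • b)‖ ^ 2) 0 1 :=
    ContinuousOn.circleIntegrable zero_le_one
      (hcont.comp (by fun_prop) fun ζ' hζ' => hab ζ' (by simpa using hζ'.le))
  refine ⟨hint, ?_⟩
  have ha : ρ < ‖rePart a‖ := by simpa using hab 0 (by simp)
  obtain ⟨η, hη⟩ := (h k).homExt_ge hρ ha.le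
  have hbound : ∀ ζ' ∈ Metric.sphere (0 : ℂ) |1|,
      (homExt (ζ k) (rePart a) + Λ * ‖rePart a‖ ^ 2) +
        (inner ℝ (η + (2 * Λ) • rePart a) (rePart b)) * ζ'.re +
        (inner ℝ (η + (2 * Λ) • rePart a) (rePart (Complex.I • b))) * ζ'.im - 0 * ζ'.re ^ 2 ≤
      homExt (ζ k) (rePart (a + ζ' • b)) + Λ * ‖rePart (a + ζ' • b)‖ ^ 2 := by
    intro ζ' hζ'
    have hmem : ρ < ‖rePart (a + ζ' • b)‖ := hab ζ' (by
      have : ‖ζ'‖ = 1 := by simpa using hζ'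
      exact this.le)
    have h1 := hη _ hmem.le
    rw [rePart_add] at h1 ⊢
    rw [add_sub_cancel_left] at h1
    rw [norm_add_sq_real, inner_add_left, inner_add_left, inner_smul_left, inner_smul_left,
      conj_trivial]
    have h2 : ∀ v : Eucl n, inner ℝ v (rePart (ζ' • b)) =
        ζ'.re * inner ℝ v (rePart b) + ζ'.im * inner ℝ v (rePart (Complex.I • b)) := fun v => by
      rw [rePart_smul, inner_add_right, inner_smul_right, inner_smul_right]
    rw [h2] at h1 ⊢
    linarith
  have havg := Real.circleAverage_mono (circleIntegrable_quadratic _ _ _ _) hint hbound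
  rw [circleAverage_quadratic] at havg
  simpa using havg

/-! ### Hessians of products -/

section products
variable {f g : Eucl n → ℝ} (hf : SmoothOff f) (hg : SmoothOff g) {x : Eucl n} (hx : x ≠ 0)

include hf hg in
theorem SmoothOff.mul : SmoothOff fun x => f x * g x := ContDiffOn.mul hf hg

include hf hg in
theorem SmoothOff.add : SmoothOff fun x => f x + g x := ContDiffOn.add hf hg

theorem SmoothOff.add_const (hf : SmoothOff f) (c : ℝ) : SmoothOff fun x => f x + c :=
  ContDiffOn.add hf contDiffOn_const

include hf hg hx in
theorem gradVec_mul :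
    gradVec (fun x => f x * g x) x = f x • gradVec g x + g x • gradVec f x := by
  funext i
  simp only [gradVec, Pi.add_apply, Pi.smul_apply]
  rw [fderiv_fun_mul (hf.differentiableAt hx) (hg.differentiableAt hx)]
  rfl

include hf hg hx in
theorem hessianMatrix_mul : hessianMatrix (fun x => f x * g x) x =
    f x • hessianMatrix g x + g x • hessianMatrix f x +
      (Matrix.vecMulVec (gradVec f x) (gradVec g x) +
        Matrix.vecMulVec (gradVec g x) (gradVec f x)) := by
  have e : fderiv ℝ (fun x => f x * g x) =ᶠ[𝓝 x]
      fun y => f y • fderiv ℝ g y + g y • fderiv ℝ f y := by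
    filter_upwards [isOpen_compl_singleton.mem_nhds hx] with y hy
    exact fderiv_fun_mul (hf.differentiableAt hy) (hg.differentiableAt hy)
  have h1 := ((hf.differentiableAt hx).hasFDerivAt.smul
    (hg.differentiableAt_fderiv hx).hasFDerivAt).add
    ((hg.differentiableAt hx).hasFDerivAt.smul (hf.differentiableAt_fderiv hx).hasFDerivAt)
  ext i j
  simp only [hessianMatrix, Matrix.of_apply, Matrix.add_apply, Matrix.smul_apply,
    Matrix.vecMulVec_apply, gradVec]
  rw [e.fderiv_eq]
  erw [h1.fderiv]
  simp only [add_apply, smul_apply, ContinuousLinearMap.smulRight_apply,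
    smul_eq_mul]
  ring

include hf hg hx in
/-- `D²(f g²) - 2 g D²(f g) + g² D²f = 2 f Dg ⊗ Dg`. -/
theorem hessianMatrix_mul_sq :
    hessianMatrix (fun x => f x * g x * g x) x - (2 * g x) • hessianMatrix (fun x => f x * g x) x +
      g x ^ 2 • hessianMatrix f x =
      (2 * f x) • Matrix.vecMulVec (gradVec g x) (gradVec g x) := by
  rw [hessianMatrix_mul (hf.mul hg) hg hx, hessianMatrix_mul hf hg hx, gradVec_mul hf hg hx]
  ext i j
  simp only [Matrix.add_apply, Matrix.sub_apply, Matrix.smul_apply, Matrix.vecMulVec_apply,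
    Pi.add_apply, Pi.smul_apply, smul_eq_mul]
  ring

theorem gradVec_add_const (f : Eucl n → ℝ) (c : ℝ) (x : Eucl n) :
    gradVec (fun x => f x + c) x = gradVec f x := by
  funext i
  simp only [gradVec, fderiv_add_const]

end products

/-! ### The linearized determinant -/

/-- The derivative of `det (D²h_L + x ⊗ x)` in the direction `D²f`. -/
def linearizedDet (L : ConvexBody (Eucl n)) (f : Eucl n → ℝ) (u : Sph n) : ℝ :=
  ((addRadial (hessianMatrix (supportFn L) u) u).adjugate * hessianMatrix f u).trace

theorem continuous_linearizedDet {L : ConvexBody (Eucl n)} (hL : SmoothOff (supportFn L))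
    {f : Eucl n → ℝ} (hf : SmoothOff f) : Continuous (linearizedDet L f) :=
  Continuous.matrix_trace (Continuous.matrix_mul (Continuous.matrix_adjugate
    (continuous_addRadial hL.continuous_hessianMatrix)) hf.continuous_hessianMatrix)

theorem linearizedDet_add (L : ConvexBody (Eucl n)) {f g : Eucl n → ℝ} (hf : SmoothOff f)
    (hg : SmoothOff g) (u : Sph n) :
    linearizedDet L (fun x => f x + g x) u = linearizedDet L f u + linearizedDet L g u := by
  rw [linearizedDet, hessianMatrix_add hf hg (sph_ne_zero u), Matrix.mul_add, Matrix.trace_add]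
  rfl

theorem linearizedDet_const_mul (L : ConvexBody (Eucl n)) (c : ℝ) (f : Eucl n → ℝ) (u : Sph n) :
    linearizedDet L (fun x => c * f x) u = c * linearizedDet L f u := by
  rw [linearizedDet, hessianMatrix_const_mul, Matrix.mul_smul, Matrix.trace_smul]
  rfl

/-- Write D²h = A - u ⊗ u. The adjugate of A multiplies A to det A times the identity and u to det A
times u, so the trace is (n + 1) det A - det A. -/
theorem linearizedDet_supportFn {L : ConvexBody (Eucl n)} (hL : SmoothOff (supportFn L))
    (u : Sph n) : linearizedDet L (supportFn L) u =
      n * (addRadial (hessianMatrix (supportFn L) u) u).det := by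
  set H := hessianMatrix (supportFn L) (u : Eucl n)
  set A := addRadial H (u : Eucl n) with hA
  have h1 : A.mulVec (u : Eucl n) = (u : Eucl n) := by
    rw [hA, addRadial, Matrix.add_mulVec,
      hL.hessianMatrix_mulVec_self (supportFn_homogeneous L) (sph_ne_zero u), zero_add,
      Matrix.vecMulVec_mulVec, dotProduct_sph]
    simp
  have h2 : A.adjugate.mulVec (u : Eucl n) = A.det • (u : Eucl n).ofLp := by
    conv_lhs => rw [← h1]
    rw [Matrix.mulVec_mulVec, Matrix.adjugate_mul, Matrix.smul_mulVec, Matrix.one_mulVec]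
  have h3 : H = A - Matrix.vecMulVec (u : Eucl n) (u : Eucl n) := by
    rw [hA, addRadial]
    exact (add_sub_cancel_right _ _).symm
  change (A.adjugate * H).trace = _
  rw [h3, Matrix.mul_sub, Matrix.adjugate_mul, Matrix.mul_vecMulVec, h2, Matrix.trace_sub,
    Matrix.trace_vecMulVec, Matrix.trace_smul, Matrix.trace_one, smul_dotProduct, dotProduct_sph,
    Fintype.card_fin, smul_eq_mul, smul_eq_mul]
  push_cast
  ring

/-- Contract `hessianMatrix_mul_sq` with the adjugate: its rank one right side becomes the quadratic
form in the gradient. The constant C is free because gradients do not see it. -/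
theorem two_mul_gradDensity (L : ConvexBody (Eucl n)) {f : Eucl n → ℝ} (hf : SmoothOff f)
    {ζ : Sph n → ℝ} (hζ : SmoothOff (homExt ζ)) (C : ℝ) (u : Sph n) :
    linearizedDet L (fun x => f x * (homExt ζ x + C) * (homExt ζ x + C)) u -
      2 * (ζ u + C) * linearizedDet L (fun x => f x * (homExt ζ x + C)) u +
      (ζ u + C) ^ 2 * linearizedDet L f u = 2 * f u * gradDensity L ζ u := by
  have h := hessianMatrix_mul_sq hf (hζ.add_const C) (sph_ne_zero u)
  have h2 := congrArg (fun B => ((addRadial (hessianMatrix (supportFn L) u) u).adjugate *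
    B).trace) h
  simp only [Matrix.mul_add, Matrix.mul_sub, Matrix.trace_add, Matrix.trace_sub, Matrix.mul_smul,
    Matrix.trace_smul, smul_eq_mul, Matrix.mul_vecMulVec, Matrix.trace_vecMulVec,
    gradVec_add_const, homExt_sph] at h2
  rw [dotProduct_comm] at h2
  exact h2

/-- For positive definite matrices the adjugate is the determinant times the inverse; perturb A by ε
times the identity and let ε tend to 0. -/
theorem adjugate_posSemidef {m : Type*} [Fintype m] [DecidableEq m] {A : Matrix m m ℝ}
    (hA : A.PosSemidef) (v : m → ℝ) : 0 ≤ v ⬝ᵥ A.adjugate.mulVec v := by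
  have h1 : ∀ ε : ℝ, 0 < ε → 0 ≤ v ⬝ᵥ (A + ε • (1 : Matrix m m ℝ)).adjugate.mulVec v := by
    intro ε hε
    have hB : (A + ε • (1 : Matrix m m ℝ)).PosDef :=
      Matrix.PosDef.posSemidef_add hA (Matrix.PosDef.one.smul hε)
    have hd := hB.det_pos
    have e : (A + ε • (1 : Matrix m m ℝ)).adjugate =
        (A + ε • (1 : Matrix m m ℝ)).det • (A + ε • (1 : Matrix m m ℝ))⁻¹ := by
      rw [Matrix.inv_def, smul_smul, Ring.mul_inverse_cancel _ hd.ne'.isUnit, one_smul]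
    rw [e, Matrix.smul_mulVec, dotProduct_smul]
    have := hB.inv.posSemidef.dotProduct_mulVec_nonneg v
    rw [star_trivial] at this
    exact mul_nonneg hd.le this
  have hc : Continuous fun ε : ℝ => v ⬝ᵥ (A + ε • (1 : Matrix m m ℝ)).adjugate.mulVec v :=
    continuous_const.dotProduct ((Continuous.matrix_adjugate (by fun_prop)).matrix_mulVec
      continuous_const)
  have lim := (hc.tendsto 0).mono_left (nhdsWithin_le_nhds (s := Set.Ioi 0))
  simp only [zero_smul, add_zero] at lim
  exact ge_of_tendsto lim (by filter_upwards [self_mem_nhdsWithin] with ε hε using h1 ε hε)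

theorem gradDensity_nonneg {L : ConvexBody (Eucl n)} (hL : SmoothOff (supportFn L))
    (ζ : Sph n → ℝ) (u : Sph n) : 0 ≤ gradDensity L ζ u :=
  adjugate_posSemidef (posSemidef_addRadial_hessian hL u) _

theorem continuous_gradDensity {L : ConvexBody (Eucl n)} (hL : SmoothOff (supportFn L))
    {ζ : Sph n → ℝ} (hζ : SmoothOff (homExt ζ)) : Continuous (gradDensity L ζ) :=
  hζ.continuous_gradVec.dotProduct ((Continuous.matrix_adjugate
    (continuous_addRadial hL.continuous_hessianMatrix)).matrix_mulVec hζ.continuous_gradVec)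

theorem supportFn_eq_mul {K : ConvexBody (Eucl n)} {f : Sph n → ℝ}
    (h : ∀ u, supportMap K u = f u) (x : Eucl n) : supportFn K x = ‖x‖ * homExt f x := by
  rcases eq_or_ne x 0 with rfl | hx
  · rw [supportFn_eq]; simp
  · rw [supportFn_eq, homExt_eq f hx, h]

theorem continuous_of_smoothOff {ζ : Sph n → ℝ} (hζ : SmoothOff (homExt ζ)) : Continuous ζ := by
  have : Continuous fun u : Sph n => homExt ζ u :=
    hζ.continuousOn.comp_continuous continuous_subtype_val fun u => sph_ne_zero u
  exact this.congr (homExt_sph ζ)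

theorem integrable_of_continuous {f : Sph n → ℝ} (hf : Continuous f) :
    Integrable f ((volume : Measure (Eucl n)).toSphere) :=
  hf.integrable_of_hasCompactSupport (HasCompactSupport.of_compactSpace _)

/-- The functional that extends `φ ↦ ∫ φ U^{ij} z_i z_j dS`; here `h` is the support function and
`w` differs from `z` by a large constant. -/
def gradFunctional (h w φ : C(Sph n, ℝ)) : ℝ :=
  mixedVar h (w * w) φ / 2 - mixedVar h w (φ * w) + mixedVar h 1 (φ * (w * w)) / 2

theorem tendsto_gradFunctional {ι : Type*} {l : Filter ι} [l.IsCountablyGenerated]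
    {hs ws φs : ι → C(Sph n, ℝ)} {h w φ : C(Sph n, ℝ)} (hh : ∀ v, 0 < h v) (hw : ∀ v, 0 < w v)
    (H : Tendsto hs l (𝓝 h)) (W : Tendsto ws l (𝓝 w)) (Φ : Tendsto φs l (𝓝 φ)) :
    Tendsto (fun i => gradFunctional (hs i) (ws i) (φs i)) l (𝓝 (gradFunctional h w φ)) :=
  (((tendsto_mixedVar hh (fun v => mul_pos (hw v) (hw v)) H (W.mul W) Φ).div_const 2).sub
    (tendsto_mixedVar hh hw H W (Φ.mul W))).add
    ((tendsto_mixedVar hh (fun _ => one_pos) H tendsto_const_nhds (Φ.mul (W.mul W))).div_const 2)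

/-- The product identity with f = ‖x‖ involves the Hessians of the support functions of W₂, of W and
of the unit ball. This is why both w and its square have to be support functions. -/
theorem integral_gradDensity {L W W₂ : ConvexBody (Eucl n)} (hL : ∀ v, 0 < supportMap L v)
    (sL : SmoothOff (supportFn L)) {ζ : Sph n → ℝ} (hζ : SmoothOff (homExt ζ)) {C : ℝ}
    (hW : ∀ u, supportMap W u = ζ u + C) (pW : ∀ u, 0 < supportMap W u)
    (hW₂ : supportMap W₂ = supportMap W * supportMap W) (φ : C(Sph n, ℝ)) :
    ∫ u, φ u * gradDensity L ζ u ∂((volume : Measure (Eucl n)).toSphere) =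
      gradFunctional (supportMap L) (supportMap W) φ := by
  have sN : SmoothOff (fun x : Eucl n => ‖x‖) := smoothOff_norm
  have e1 : supportFn W = fun x => ‖x‖ * (homExt ζ x + C) := by
    funext x
    rw [supportFn_eq_mul hW]
    rcases eq_or_ne x 0 with rfl | hx
    · simp
    · rw [homExt_eq _ hx, homExt_eq _ hx]
  have e2 : supportFn W₂ = fun x => ‖x‖ * (homExt ζ x + C) * (homExt ζ x + C) := by
    funext x
    rw [supportFn_eq_mul (f := fun u => (ζ u + C) * (ζ u + C))
      (fun u => by rw [hW₂, ContinuousMap.mul_apply, hW])]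
    rcases eq_or_ne x 0 with rfl | hx
    · simp
    · rw [homExt_eq _ hx, homExt_eq _ hx, mul_assoc]
  have e3 : supportFn (ballBody n) = fun x => ‖x‖ := funext supportFn_ballBody
  have sW : SmoothOff (supportFn W) := by rw [e1]; exact sN.mul (hζ.add_const C)
  have sW₂ : SmoothOff (supportFn W₂) := by
    rw [e2]; exact (sN.mul (hζ.add_const C)).mul (hζ.add_const C)
  have sB : SmoothOff (supportFn (ballBody n)) := by rw [e3]; exact sN
  have key : ∀ {M : ConvexBody (Eucl n)} (_ : ∀ v, 0 < supportMap M v)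
      (_ : SmoothOff (supportFn M)) (g : C(Sph n, ℝ)), mixedVar (supportMap L) (supportMap M) g =
      ∫ u, g u * linearizedDet L (supportFn M) u ∂((volume : Measure (Eucl n)).toSphere) :=
    fun pM sM g => mixedVar_eq_integral hL pM sL sM g
  have I : ∀ {M : ConvexBody (Eucl n)} (_ : SmoothOff (supportFn M)) (g : C(Sph n, ℝ)),
      Integrable (fun u => g u * linearizedDet L (supportFn M) u)
        ((volume : Measure (Eucl n)).toSphere) := fun sM g =>
    integrable_of_continuous (g.continuous.mul (continuous_linearizedDet sL sM))
  rw [gradFunctional, ← hW₂, ← supportMap_ballBody,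
    key (fun v => by rw [hW₂]; exact mul_pos (pW v) (pW v)) sW₂, key pW sW,
    key (fun v => by rw [supportMap_ballBody]; exact one_pos) sB, ← integral_div, ← integral_div,
    ← integral_sub ((I sW₂ _).div_const 2) (I sW _), ← integral_add
      (by exact ((I sW₂ _).div_const 2).sub (I sW _)) (by exact (I sB _).div_const 2)]
  congr 1
  funext u
  have h := two_mul_gradDensity L sN hζ C u
  rw [← e1, ← e2, ← e3, e3, norm_sph] at h
  simp only [ContinuousMap.mul_apply, hW, hW₂, e3]
  linear_combination (-(φ u) / 2) * h

/-! ### Bodies associated with semiconvex and smooth functions -/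

theorem IsSemiconvex.exists_body_add {c B C : ℝ} {f : C(Sph n, ℝ)} (h : IsSemiconvex c f)
    (hB : ∀ u, |f u| ≤ B) (hC : B + 2 * c + 1 ≤ C) : ∃ K : ConvexBody (Eucl n),
      supportMap K = f + C • (1 : C(Sph n, ℝ)) ∧ ∀ u, 0 < supportMap K u := by
  have e : ∀ u, (f + C • (1 : C(Sph n, ℝ))) u = f u + C := fun u => by simp
  have hlow : ∀ u, 2 * c + 1 ≤ f u + C := fun u => by linarith [(abs_le.1 (hB u)).1]
  have h' : IsSemiconvex c (f + C • (1 : C(Sph n, ℝ))) := by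
    have := h.add_const C
    simp only [← e] at this
    exact this
  obtain ⟨K, hK⟩ := h'.exists_body (fun u => by rw [e]; linarith [hlow u])
  exact ⟨K, hK, fun u => by rw [hK, e]; linarith [hlow u, h.nonneg]⟩

theorem isQuasiPSH_of_smoothOff {f : Sph n → ℝ} (hf : SmoothOff (homExt f)) : IsQuasiPSH f := by
  intro w hw
  have hre : ContDiff ℝ ∞ (rePart : (Fin (n + 1) → ℂ) → Eucl n) := by
    rw [contDiff_euclidean]
    intro i
    exact (Complex.reCLM.contDiff).comp (contDiff_apply ℝ ℂ i)
  refine ⟨rePart ⁻¹' {0}ᶜ, isOpen_compl_singleton.preimage continuous_rePart, hw,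
    fun v => -homExt f (rePart v), (hf.comp hre.contDiffOn fun v hv => hv).neg, fun _ => ?_⟩
  simp only [add_neg_cancel]
  refine ⟨upperSemicontinuousOn_const, fun a b _ => ⟨circleIntegrable_const _ _ _, ?_⟩⟩
  rw [Real.circleAverage_const]

theorem exists_bound (f : C(Sph n, ℝ)) : ∀ u, |f u| ≤ ‖f‖ := fun u => f.norm_coe_le_norm u

theorem exists_isSemiconvex_of_isQuasiPSH {f : C(Sph n, ℝ)} (hf : IsQuasiPSH f) :
    ∃ c, IsSemiconvex c f := by
  obtain ⟨c, hc⟩ := exists_isSemiconvex hf (fun _ => f.continuous)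
    (fun _ => exists_bound f)
  exact ⟨c, hc ()⟩

theorem exists_body_of_smoothOff {f : C(Sph n, ℝ)} (hf : SmoothOff (homExt f)) :
    ∃ (C : ℝ) (K : ConvexBody (Eucl n)), supportMap K = f + C • (1 : C(Sph n, ℝ)) ∧
      ∀ u, 0 < supportMap K u := by
  obtain ⟨c, hc⟩ := exists_isSemiconvex_of_isQuasiPSH (isQuasiPSH_of_smoothOff hf)
  exact ⟨_, hc.exists_body_add (exists_bound f) le_rfl⟩

/-! ### Integration by parts -/

/-- With f = h the product identity reads 2 h U^{ij} z_i z_j = T(h z²) - 2 z T(h z) + z² T(h), where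
T is the linearized determinant. Multiply by h / 2 and integrate: symmetry of T and T(h) = n det
combine the outer terms into n ∫ h z² det, and the middle one, ∫ h z T(h z), is expressed through
the body F by linearity. -/
theorem integral_sq_gradDensity {L F : ConvexBody (Eucl n)} (hL : ∀ v, 0 < supportMap L v)
    (sL : SmoothOff (supportFn L)) {z : C(Sph n, ℝ)} (hz : SmoothOff (homExt z)) {C C' : ℝ}
    (hF : supportMap F = supportMap L * (z + C • (1 : C(Sph n, ℝ))) + C' • (1 : C(Sph n, ℝ)))
    (pF : ∀ u, 0 < supportMap F u) :
    ∫ u, (supportMap L * supportMap L) u * gradDensity L z u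
        ∂((volume : Measure (Eucl n)).toSphere) =
      n * firstVar (supportMap L) (supportMap L * (z * z)) -
      (mixedVar (supportMap L) (supportMap F) (supportMap L * z) -
        C * (n * firstVar (supportMap L) (supportMap L * z)) -
        C' * mixedVar (supportMap L) 1 (supportMap L * z)) := by
  have sN : SmoothOff (fun x : Eucl n => ‖x‖) := smoothOff_norm
  have sA : SmoothOff (fun x => supportFn L x * homExt z x) := sL.mul hz
  have sB : SmoothOff (fun x => supportFn L x * homExt z x * homExt z x) := sA.mul hz
  have sCL : ∀ a : ℝ, SmoothOff (fun x => a * supportFn L x) := fun a => contDiffOn_const.mul sL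
  have sCN : ∀ a : ℝ, SmoothOff (fun x : Eucl n => a * ‖x‖) := fun a => contDiffOn_const.mul sN
  have e3 : supportFn (ballBody n) = fun x => ‖x‖ := funext supportFn_ballBody
  have pN : ∀ v, 0 < supportMap (ballBody n) v := fun v => by
    rw [supportMap_ballBody]; exact one_pos
  have sN' : SmoothOff (supportFn (ballBody n)) := by rw [e3]; exact sN
  have hq : SmoothOff (homExt ⇑(supportMap L * (z * z))) := by
    have h1 : SmoothOff (fun x : Eucl n => ‖x‖⁻¹ * (supportFn L x * homExt z x * homExt z x)) :=
      (sN.inv fun x hx => norm_ne_zero_iff.2 hx).mul sB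
    refine h1.congr fun x hx => ?_
    have hx' : ‖x‖ ≠ 0 := norm_ne_zero_iff.2 hx
    rw [homExt_eq _ hx, homExt_eq _ hx, supportFn_eq]
    simp only [ContinuousMap.mul_apply]
    field_simp
  -- Symmetry is available only between bodies. Being smooth, h z² is a support function up to a
  -- constant, whose contribution is removed by symmetry between L and the ball.
  obtain ⟨C₂, Q, hQ, pQ⟩ := exists_body_of_smoothOff hq
  have eQ : supportFn Q =
      fun x => supportFn L x * homExt z x * homExt z x + C₂ * ‖x‖ := by
    funext x
    rw [supportFn_eq, hQ, supportFn_eq L]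
    rcases eq_or_ne x 0 with rfl | hx
    · simp
    · rw [homExt_eq _ hx]
      simp only [ContinuousMap.mul_apply, ContinuousMap.add_apply, ContinuousMap.smul_apply,
        ContinuousMap.one_apply, smul_eq_mul]
      ring
  have eF : supportFn F =
      fun x => supportFn L x * homExt z x + (C * supportFn L x + C' * ‖x‖) := by
    funext x
    rw [supportFn_eq, hF, supportFn_eq L]
    rcases eq_or_ne x 0 with rfl | hx
    · simp
    · rw [homExt_eq _ hx]
      simp only [ContinuousMap.mul_apply, ContinuousMap.add_apply, ContinuousMap.smul_apply,
        ContinuousMap.one_apply, smul_eq_mul]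
      ring
  have sQ : SmoothOff (supportFn Q) := by rw [eQ]; exact sB.add (sCN C₂)
  have sF : SmoothOff (supportFn F) := by rw [eF]; exact sA.add ((sCL C).add (sCN C'))
  set T := linearizedDet L with hT
  have TQ : ∀ u, T (supportFn Q) u =
      T (fun x => supportFn L x * homExt z x * homExt z x) u + C₂ * T (fun x => ‖x‖) u := fun u => by
    rw [hT, eQ, linearizedDet_add L sB (sCN C₂), linearizedDet_const_mul]
  have TF : ∀ u, T (supportFn F) u = T (fun x => supportFn L x * homExt z x) u +
      (C * T (supportFn L) u + C' * T (fun x => ‖x‖) u) := fun u => by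
    rw [hT, eF, linearizedDet_add L sA ((sCL C).add (sCN C')), linearizedDet_add L (sCL C) (sCN C'),
      linearizedDet_const_mul, linearizedDet_const_mul]
  have key : ∀ {M : ConvexBody (Eucl n)} (_ : ∀ v, 0 < supportMap M v)
      (_ : SmoothOff (supportFn M)) (g : C(Sph n, ℝ)), mixedVar (supportMap L) (supportMap M) g =
      ∫ u, g u * T (supportFn M) u ∂((volume : Measure (Eucl n)).toSphere) :=
    fun pM sM g => mixedVar_eq_integral hL pM sL sM g
  have keyL : ∀ g : C(Sph n, ℝ), n * firstVar (supportMap L) g =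
      ∫ u, g u * T (supportFn L) u ∂((volume : Measure (Eucl n)).toSphere) := fun g => by
    rw [firstVar_eq_integral_det hL sL, ← integral_const_mul]
    congr 1
    funext u
    rw [hT, linearizedDet_supportFn sL]; ring
  have I : ∀ {f : Eucl n → ℝ} (_ : SmoothOff f) (g : C(Sph n, ℝ)),
      Integrable (fun u => g u * T f u) ((volume : Measure (Eucl n)).toSphere) := fun sM g =>
    integrable_of_continuous (g.continuous.mul (continuous_linearizedDet sL sM))
  -- symmetry
  have s1 := mixedVar_comm hL hL pQ
  have s2 := mixedVar_comm hL hL pN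
  rw [key pQ sQ, key hL sL] at s1
  rw [key pN sN', key hL sL] at s2
  rw [e3] at s2
  have s3 : ∫ u, supportMap L u * T (supportFn Q) u ∂((volume : Measure (Eucl n)).toSphere) =
      ∫ u, supportMap L u * T (fun x => supportFn L x * homExt z x * homExt z x) u
        ∂((volume : Measure (Eucl n)).toSphere) +
      C₂ * ∫ u, supportMap L u * T (fun x => ‖x‖) u ∂((volume : Measure (Eucl n)).toSphere) := by
    rw [← integral_const_mul, ← integral_add (I sB _) ((I sN _).const_mul _)]
    congr 1
    funext u
    rw [TQ]; ring
  have s4 : ∫ u, supportMap Q u * T (supportFn L) u ∂((volume : Measure (Eucl n)).toSphere) =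
      ∫ u, (supportMap L * (z * z)) u * T (supportFn L) u
        ∂((volume : Measure (Eucl n)).toSphere) +
      C₂ * ∫ u, supportMap (ballBody n) u * T (supportFn L) u
        ∂((volume : Measure (Eucl n)).toSphere) := by
    rw [← integral_const_mul, ← integral_add (I sL _) ((I sL _).const_mul _)]
    congr 1
    funext u
    rw [hQ, supportMap_ballBody]
    simp only [ContinuousMap.add_apply, ContinuousMap.smul_apply,
      ContinuousMap.one_apply, smul_eq_mul]
    ring
  have s5 : ∫ u, supportMap L u * T (fun x => supportFn L x * homExt z x * homExt z x) u
        ∂((volume : Measure (Eucl n)).toSphere) =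
      ∫ u, (supportMap L * (z * z)) u * T (supportFn L) u
        ∂((volume : Measure (Eucl n)).toSphere) := by
    rw [s3, s4, s2] at s1
    linarith
  have s6 : ∫ u, (supportMap L * z) u * T (supportFn F) u
      ∂((volume : Measure (Eucl n)).toSphere) =
      ∫ u, (supportMap L * z) u * T (fun x => supportFn L x * homExt z x) u
        ∂((volume : Measure (Eucl n)).toSphere) +
      (C * ∫ u, (supportMap L * z) u * T (supportFn L) u
        ∂((volume : Measure (Eucl n)).toSphere) +
      C' * ∫ u, (supportMap L * z) u * T (fun x => ‖x‖) u
        ∂((volume : Measure (Eucl n)).toSphere)) := by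
    rw [← integral_const_mul, ← integral_const_mul,
      ← integral_add ((I sL _).const_mul _) ((I sN _).const_mul _),
      ← integral_add (I sA _) (by exact ((I sL _).const_mul _).add ((I sN _).const_mul _))]
    congr 1
    funext u
    rw [TF]; ring
  have s7 : ∫ u, (supportMap L * supportMap L) u * gradDensity L z u
        ∂((volume : Measure (Eucl n)).toSphere) =
      (∫ u, supportMap L u * T (fun x => supportFn L x * homExt z x * homExt z x) u
        ∂((volume : Measure (Eucl n)).toSphere)) / 2 -
      ∫ u, (supportMap L * z) u * T (fun x => supportFn L x * homExt z x) u
        ∂((volume : Measure (Eucl n)).toSphere) +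
      (∫ u, (supportMap L * (z * z)) u * T (supportFn L) u
        ∂((volume : Measure (Eucl n)).toSphere)) / 2 := by
    rw [← integral_div, ← integral_div, ← integral_sub ((I sB _).div_const 2) (I sA _),
      ← integral_add (by exact ((I sB _).div_const 2).sub (I sA _))
        (by exact (I sL _).div_const 2)]
    congr 1
    funext u
    have h := two_mul_gradDensity L sL hz 0 u
    simp only [add_zero] at h
    have h2 : supportFn L u = supportMap L u := rfl
    rw [h2] at h
    simp only [ContinuousMap.mul_apply]
    linear_combination (-(supportMap L u) / 2) * h
  rw [s7, s5, key pF sF, s6, keyL, keyL, ← supportMap_ballBody, key pN sN', e3]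
  ring

/-! ### Limits along smooth approximations -/

/-- The smooth approximations `(L k, ζ k)` of `(K, z)` that occur in `IsGradMeasure`. -/
structure IsGradApprox (K : ConvexBody (Eucl n)) (z : Sph n → ℝ) (L : ℕ → ConvexBody (Eucl n))
    (ζ : ℕ → Sph n → ℝ) : Prop where
  smoothOff_left : ∀ k, SmoothOff (supportFn (L k))
  tendsto_left : Tendsto (fun k => supportMap (L k)) atTop (𝓝 (supportMap K))
  smoothOff_right : ∀ k, SmoothOff (homExt (ζ k))
  tendsto_right : TendstoUniformly ζ z atTop
  isQuasiPSHFamily : IsQuasiPSHFamily ζ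

theorem exists_norm_le_of_tendsto {E : Type*} [SeminormedAddCommGroup E] {f : ℕ → E} {a : E}
    (h : Tendsto f atTop (𝓝 a)) : ∃ R, ∀ k, ‖f k‖ ≤ R := by
  obtain ⟨R, hR⟩ := h.norm.bddAbove_range
  exact ⟨R, fun k => hR ⟨k, rfl⟩⟩

variable {K : ConvexBody (Eucl n)} {z : C(Sph n, ℝ)} {L : ℕ → ConvexBody (Eucl n)}
  {ζ : ℕ → Sph n → ℝ}

/-- One semiconvexity constant serves the whole sequence, so one C turns all ζ k + C and their
squares into support functions, and the limit follows from continuity of `gradFunctional`. The test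
functions vary with k so that the squares of the approximating support functions can be inserted. -/
theorem IsGradApprox.tendsto_integral_gradDensity (hK : ∀ v, 0 < supportMap K v)
    (h : IsGradApprox K z L ζ) : ∃ C₁ : ℝ, ∀ C : ℝ, C₁ ≤ C → ∀ (φs : ℕ → C(Sph n, ℝ)) (φ : C(Sph n, ℝ)),
      Tendsto φs atTop (𝓝 φ) →
      Tendsto (fun k => ∫ u, φs k u * gradDensity (L k) (ζ k) u
        ∂((volume : Measure (Eucl n)).toSphere)) atTop
        (𝓝 (gradFunctional (supportMap K) (z + C • (1 : C(Sph n, ℝ))) φ)) := by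
  have hcont : ∀ k, Continuous (ζ k) := fun k => continuous_of_smoothOff (h.smoothOff_right k)
  let ζ' : ℕ → C(Sph n, ℝ) := fun k => ⟨ζ k, hcont k⟩
  have hζ' : Tendsto ζ' atTop (𝓝 z) :=
    ContinuousMap.tendsto_iff_tendstoUniformly.2 h.tendsto_right
  obtain ⟨B, hB⟩ := exists_norm_le_of_tendsto hζ'
  have hB' : ∀ k u, |ζ k u| ≤ B := fun k u => ((ζ' k).norm_coe_le_norm u).trans (hB k)
  obtain ⟨c, hc⟩ := exists_isSemiconvex h.isQuasiPSHFamily hcont hB'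
  have hc0 : 0 ≤ c := (hc 0).nonneg
  have hzB : ∀ u, |z u| ≤ B := fun u => le_of_tendsto
    ((h.tendsto_right.tendsto_at u).abs) (Eventually.of_forall fun k => hB' k u)
  -- For the support function itself B + 2 c + 1 would be enough; the square needs 4 c.
  refine ⟨B + 4 * c + 1, fun C hC φs φ hφ => ?_⟩
  have hW : ∀ k, ∃ W : ConvexBody (Eucl n), supportMap W = ζ' k + C • (1 : C(Sph n, ℝ)) ∧
      ∀ u, 0 < supportMap W u := fun k =>
    IsSemiconvex.exists_body_add (f := ζ' k) (hc k) (hB' k) (by linarith)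
  choose W hW pW using hW
  have hWu : ∀ k u, supportMap (W k) u = ζ k u + C := fun k u => by rw [hW]; simp [ζ']
  have hW₂ : ∀ k, ∃ W₂ : ConvexBody (Eucl n), supportMap W₂ = supportMap (W k) * supportMap (W k) :=
    fun k => by
      refine IsSemiconvex.exists_body_sq (c := c) ?_ fun u => ?_
      · have := (hc k).add_const C
        simp only [← hWu] at this
        exact this
      · rw [hWu]; linarith [(abs_le.1 (hB' k u)).1]
  choose W₂ hW₂ using hW₂
  have hlim : Tendsto (fun k => supportMap (W k)) atTop (𝓝 (z + C • (1 : C(Sph n, ℝ)))) := by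
    simp only [hW]
    exact hζ'.add_const _
  refine (tendsto_gradFunctional hK (fun u => ?_) h.tendsto_left hlim hφ).congr' ?_
  · simp only [ContinuousMap.add_apply, ContinuousMap.smul_apply, ContinuousMap.one_apply,
      smul_eq_mul, mul_one]
    linarith [(abs_le.1 (hzB u)).1]
  · filter_upwards [eventually_pos h.tendsto_left hK] with k hk
    exact (integral_gradDensity hk (h.smoothOff_left k) (h.smoothOff_right k) (hWu k) (pW k)
      (hW₂ k) (φs k)).symm

/-- Smooth the two bodies with support functions h_K and z + C, and subtract C again. The sup norm
bound on the second sequence gives a common semiconvexity constant, hence uniform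
quasi-plurisubharmonicity. -/
theorem exists_isGradApprox (hK : ∀ v, 0 < supportMap K v) (hz : IsQuasiPSH z) :
    ∃ (L : ℕ → ConvexBody (Eucl n)) (ζ : ℕ → C(Sph n, ℝ)) (c : ℝ),
      IsGradApprox K z L (fun k => ζ k) ∧ (∀ k v, 0 < supportMap (L k) v) ∧
      Tendsto ζ atTop (𝓝 z) ∧ ∀ k, IsSemiconvex c (ζ k) := by
  obtain ⟨c, hc⟩ := exists_isSemiconvex_of_isQuasiPSH hz
  obtain ⟨W, hW, pW⟩ := hc.exists_body_add (exists_bound z) le_rfl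
  set C := ‖z‖ + 2 * c + 1
  obtain ⟨L, sL, pL, tL⟩ := exists_smooth_pos_approx hK
  obtain ⟨M, sM, pM, tM⟩ := exists_smooth_pos_approx pW
  obtain ⟨R, hR⟩ := exists_norm_le_of_tendsto tM
  let ζ : ℕ → C(Sph n, ℝ) := fun k => supportMap (M k) - C • (1 : C(Sph n, ℝ))
  have eζ : ∀ k, (ζ k : Sph n → ℝ) = fun u => supportMap (M k) u + -C := fun k => by
    funext u; simp [ζ, sub_eq_add_neg]
  have tζ : Tendsto ζ atTop (𝓝 z) := by
    have := tM.sub_const (C • (1 : C(Sph n, ℝ)))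
    rwa [hW, add_sub_cancel_right] at this
  have hSC : ∀ k, IsSemiconvex (2 * R) (ζ k) := fun k => by
    rw [eζ]; exact (isSemiconvex_supportMap (hR k)).add_const _
  refine ⟨L, ζ, 2 * R, ⟨sL, tL, fun k => ?_, ContinuousMap.tendsto_iff_tendstoUniformly.1 tζ,
    isQuasiPSHFamily_of_isSemiconvex hSC fun k => (ζ k).continuous⟩, pL, tζ, hSC⟩
  have h1 : SmoothOff (fun x : Eucl n => ‖x‖⁻¹ * supportFn (M k) x + -C) :=
    (((smoothOff_norm).inv fun x hx => norm_ne_zero_iff.2 hx).mul (sM k)).add contDiffOn_const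
  refine h1.congr fun x hx => ?_
  have hx' : ‖x‖ ≠ 0 := norm_ne_zero_iff.2 hx
  rw [eζ, homExt_eq _ hx, supportFn_eq]
  field_simp

theorem exists_measure_of_positive {X : Type*} [TopologicalSpace X] [T2Space X] [CompactSpace X]
    [MeasurableSpace X] [BorelSpace X] (Λ : C(X, ℝ) →ₗ[ℝ] ℝ)
    (hΛ : ∀ φ : C(X, ℝ), (∀ x, 0 ≤ φ x) → 0 ≤ Λ φ) :
    ∃ μ : Measure X, IsFiniteMeasure μ ∧ ∀ φ : C(X, ℝ), ∫ x, φ x ∂μ = Λ φ := by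
  let Λ' : CompactlySupportedContinuousMap X ℝ →ₗ[ℝ] ℝ :=
    { toFun := fun f => Λ f.toContinuousMap
      map_add' := fun f g => Λ.map_add f.toContinuousMap g.toContinuousMap
      map_smul' := fun c f => Λ.map_smul c f.toContinuousMap }
  let Λ'' := PositiveLinearMap.mk₀ Λ' fun f hf => hΛ f.toContinuousMap hf
  exact ⟨RealRMK.rieszMeasure Λ'', inferInstance, fun φ => RealRMK.integral_rieszMeasure Λ''
    ⟨φ, HasCompactSupport.of_compactSpace _⟩⟩

/-- One fixed approximation shows that the limit functional is linear and positive, since the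
densities U^{ij} z_i z_j are nonnegative; Riesz representation gives μ. The formula for the limit
then serves every other approximation. -/
theorem exists_gradMeasure (hK : ∀ v, 0 < supportMap K v) (hz : IsQuasiPSH z) :
    ∃ μ : Measure (Sph n), IsFiniteMeasure μ ∧ ∀ L ζ, IsGradApprox K z L ζ →
      ∀ (φs : ℕ → C(Sph n, ℝ)) (φ : C(Sph n, ℝ)), Tendsto φs atTop (𝓝 φ) →
      Tendsto (fun k => ∫ u, φs k u * gradDensity (L k) (ζ k) u
        ∂((volume : Measure (Eucl n)).toSphere)) atTop (𝓝 (∫ u, φ u ∂μ)) := by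
  obtain ⟨L₀, ζ₀, c, h₀, -, -, -⟩ := exists_isGradApprox hK hz
  obtain ⟨C₀, hC₀⟩ := h₀.tendsto_integral_gradDensity hK
  have lim := fun φ => hC₀ C₀ le_rfl (fun _ => φ) φ tendsto_const_nhds
  have int : ∀ k (φ : C(Sph n, ℝ)), Integrable (fun u => φ u * gradDensity (L₀ k) (ζ₀ k) u)
      ((volume : Measure (Eucl n)).toSphere) := fun k φ => integrable_of_continuous
    (φ.continuous.mul (continuous_gradDensity (h₀.smoothOff_left k) (h₀.smoothOff_right k)))
  let Λ : C(Sph n, ℝ) →ₗ[ℝ] ℝ :=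
    { toFun := fun φ => gradFunctional (supportMap K) (z + C₀ • (1 : C(Sph n, ℝ))) φ
      map_add' := fun φ ψ => by
        refine tendsto_nhds_unique (lim (φ + ψ)) (((lim φ).add (lim ψ)).congr fun k => ?_)
        rw [← integral_add (int k φ) (int k ψ)]
        simp only [ContinuousMap.add_apply, add_mul]
      map_smul' := fun a φ => by
        refine tendsto_nhds_unique (lim (a • φ)) (((lim φ).const_mul a).congr fun k => ?_)
        rw [← integral_const_mul]
        simp only [ContinuousMap.smul_apply, smul_eq_mul, mul_assoc] }
  obtain ⟨μ, hμ, H⟩ := exists_measure_of_positive Λ fun φ hφ =>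
    ge_of_tendsto' (lim φ) fun k => integral_nonneg fun u =>
      mul_nonneg (hφ u) (gradDensity_nonneg (h₀.smoothOff_left k) _ _)
  refine ⟨μ, hμ, fun L ζ h φs φ hφ => ?_⟩
  obtain ⟨C₁, hC₁⟩ := h.tendsto_integral_gradDensity hK
  -- Another approximation may require a larger constant; the first one shows that enlarging the
  -- constant does not change the functional.
  have e := tendsto_nhds_unique (lim φ)
    (hC₀ (max C₀ C₁) (le_max_left _ _) (fun _ => φ) φ tendsto_const_nhds)
  rw [H]
  change Tendsto _ _ (𝓝 (gradFunctional (supportMap K) (z + C₀ • (1 : C(Sph n, ℝ))) φ))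
  rw [e]
  exact hC₁ _ (le_max_right _ _) φs φ hφ

theorem IsGradMeasure.unique (hK : ∀ v, 0 < supportMap K v) (hz : IsQuasiPSH z)
    {μ ν : Measure (Sph n)} (hμ : IsGradMeasure K z μ) (hν : IsGradMeasure K z ν) : μ = ν := by
  have := hμ.finite
  have := hν.finite
  obtain ⟨L, ζ, c, h, -, -, -⟩ := exists_isGradApprox hK hz
  refine ext_of_forall_integral_eq_of_IsFiniteMeasure fun f => ?_
  have h1 := hμ.weak_limit L _ h.1 h.2 h.3 h.4 h.5 f.toContinuousMap
  have h2 := hν.weak_limit L _ h.1 h.2 h.3 h.4 h.5 f.toContinuousMap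
  exact tendsto_nhds_unique h1 h2

/-! ### The quadratic form in the direction `h z` -/

/-- The smooth formula is continuous in all its entries, so it passes to the limit, provided the
auxiliary bodies converge to F with constants that do not depend on k. -/
theorem exists_gradMeasure_and_integral_sq (hK : ∀ v, 0 < supportMap K v) (hz : IsQuasiPSH z) :
    ∃ (μ : Measure (Sph n)) (C C' : ℝ) (F : ConvexBody (Eucl n)), IsGradMeasure K z μ ∧
      supportMap F = supportMap K * (z + C • (1 : C(Sph n, ℝ))) + C' • (1 : C(Sph n, ℝ)) ∧
      (∀ u, 0 < supportMap F u) ∧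
      ∫ u, supportMap K u ^ 2 ∂μ = n * firstVar (supportMap K) (supportMap K * (z * z)) -
        (mixedVar (supportMap K) (supportMap F) (supportMap K * z) -
          C * (n * firstVar (supportMap K) (supportMap K * z)) -
          C' * mixedVar (supportMap K) 1 (supportMap K * z)) := by
  obtain ⟨μ, fμ, hμ⟩ := exists_gradMeasure hK hz
  obtain ⟨L, ζ, c, h, pL, tζ, hc⟩ := exists_isGradApprox hK hz
  obtain ⟨R, hR⟩ := exists_norm_le_of_tendsto h.tendsto_left
  obtain ⟨S, hS⟩ := exists_norm_le_of_tendsto tζ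
  obtain ⟨c₀, hc₀⟩ := exists_isSemiconvex_of_isQuasiPSH hz
  set C := S with hC
  have bζ : ∀ k u, |ζ k u| ≤ S := fun k u => ((ζ k).norm_coe_le_norm u).trans (hS k)
  have bz : ‖z‖ ≤ S := le_of_tendsto tζ.norm (Eventually.of_forall hS)
  have bK : ‖supportMap K‖ ≤ R := le_of_tendsto h.tendsto_left.norm (Eventually.of_forall hR)
  set B := R + 2 * S with hB
  have hR0 : 0 ≤ R := (norm_nonneg _).trans bK
  have hS0 : 0 ≤ S := (norm_nonneg _).trans bz
  -- The constants involve only the bounds R, S and e, which hold for the limit pair as well as for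
  -- the whole sequence.
  have body : ∀ (M : ConvexBody (Eucl n)) (f : C(Sph n, ℝ)) (d e : ℝ), (∀ v, 0 < supportMap M v) →
      ‖supportMap M‖ ≤ R → ‖f‖ ≤ S → IsSemiconvex d f → d ≤ e → ∃ F : ConvexBody (Eucl n),
      supportMap F = supportMap M * (f + C • (1 : C(Sph n, ℝ))) +
        (B * B + 2 * (B * (2 * R) + B * e + 3 * (2 * R) * e) + 1) • (1 : C(Sph n, ℝ)) ∧
      ∀ u, 0 < supportMap F u := by
    intro M f d e pM bM bf hf hde
    have b1 : ∀ u, supportMap M u ≤ R := fun u =>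
      (le_abs_self _).trans (((supportMap M).norm_coe_le_norm u).trans bM)
    have b2 : ∀ u, |f u| ≤ S := fun u => (f.norm_coe_le_norm u).trans bf
    have e1 : ∀ u, (supportMap M * (f + C • (1 : C(Sph n, ℝ)))) u = supportMap M u * (f u + C) :=
      fun u => by simp
    have hm := (isSemiconvex_supportMap bM).mul (hf.add_const C) (fun u => (pM u).le)
      (fun u => by linarith [(abs_le.1 (b2 u)).1]) (B := B) (fun u => by linarith [b1 u])
      (fun u => by linarith [(abs_le.1 (b2 u)).2])
    simp only [← e1] at hm
    refine hm.exists_body_add (B := B * B) (fun u => ?_) ?_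
    · rw [e1, abs_of_nonneg (mul_nonneg (pM u).le (by linarith [(abs_le.1 (b2 u)).1]))]
      have h1 := b1 u
      have h2 := abs_le.1 (b2 u)
      exact mul_le_mul (by linarith) (by linarith) (by linarith) (by linarith)
    · have : 0 ≤ B := by positivity
      gcongr
  set e := max c c₀
  set C' := B * B + 2 * (B * (2 * R) + B * e + 3 * (2 * R) * e) + 1
  obtain ⟨F, hF, pF⟩ := body K z c₀ e hK bK bz hc₀ (le_max_right _ _)
  choose G hG pG using fun k => body (L k) (ζ k) c e (pL k) (hR k) (hS k) (hc k) (le_max_left _ _)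
  refine ⟨μ, C, C', F, ⟨fμ, fun L ζ h1 h2 h3 h4 h5 φ =>
    hμ L ζ ⟨h1, h2, h3, h4, h5⟩ (fun _ => φ) φ tendsto_const_nhds⟩, hF, pF, ?_⟩
  have tL := h.tendsto_left
  have l1 := hμ L _ h _ _ (tL.mul tL)
  have tG : Tendsto (fun k => supportMap (G k)) atTop (𝓝 (supportMap F)) := by
    simp only [hF, hG]
    exact (tL.mul (tζ.add_const _)).add_const _
  have l2 := ((tendsto_firstVar hK tL (tL.mul (tζ.mul tζ))).const_mul (n : ℝ)).sub
    (((tendsto_mixedVar hK pF tL tG (tL.mul tζ)).sub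
    (((tendsto_firstVar hK tL (tL.mul tζ)).const_mul (n : ℝ)).const_mul C)).sub
    ((tendsto_mixedVar (f := 1) hK (fun _ => one_pos) tL tendsto_const_nhds (tL.mul tζ)).const_mul C'))
  have e2 := tendsto_nhds_unique l1 (l2.congr fun k =>
    (integral_sq_gradDensity (pL k) (h.smoothOff_left k) (h.smoothOff_right k) (hG k) (pG k)).symm)
  rw [← e2]
  simp only [ContinuousMap.mul_apply, pow_two]

/-! ### The derivative of the volume term -/

/-- Euler's relation for the first variation, which is homogeneous of degree n in h. -/
theorem mixedVar_self {K : ConvexBody (Eucl n)} (hK : ∀ v, 0 < supportMap K v) (g : C(Sph n, ℝ)) :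
    mixedVar (supportMap K) (supportMap K) g = n * firstVar (supportMap K) g := by
  obtain ⟨L, sL, pL, tL⟩ := exists_smooth_pos_approx hK
  refine tendsto_nhds_unique (tendsto_mixedVar hK hK tL tL tendsto_const_nhds)
    (((tendsto_firstVar hK tL tendsto_const_nhds).const_mul (n : ℝ)).congr fun k => ?_)
  rw [mixedVar_eq_integral (pL k) (pL k) (sL k) (sL k), firstVar_eq_integral_det (pL k) (sL k),
    ← integral_const_mul]
  congr 1
  funext u
  have := linearizedDet_supportFn (sL k) u
  rw [linearizedDet] at this
  rw [this]; ring

/-- Split h'_τ into h'_τ - h'_t and h'_t. The first part contributes the first variation in the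
direction h₂. The second is fixed and equals h_F - C h - C', a combination of support functions, so
that `hasDerivWithinAt_firstVar` applies to each term. -/
theorem hasDerivWithinAt_firstVar_deriv {K : ℝ → ConvexBody (Eucl n)} {h' : ℝ → C(Sph n, ℝ)}
    {h₂ z : C(Sph n, ℝ)} {s : Set ℝ} {t : ℝ} {C C' : ℝ} {F : ConvexBody (Eucl n)}
    (hd : HasDerivWithinAt (fun τ => supportMap (K τ)) (h' t) s t)
    (hd2 : HasDerivWithinAt h' h₂ s t) (hK : ∀ v, 0 < supportMap (K t) v)
    (hz : h' t = supportMap (K t) * z)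
    (hF : supportMap F = supportMap (K t) * (z + C • (1 : C(Sph n, ℝ))) + C' • (1 : C(Sph n, ℝ)))
    (pF : ∀ u, 0 < supportMap F u) :
    HasDerivWithinAt (fun τ => firstVar (supportMap (K τ)) (h' τ))
      (firstVar (supportMap (K t)) h₂ + (mixedVar (supportMap (K t)) (supportMap F) (h' t) -
        C * (n * firstVar (supportMap (K t)) (h' t)) -
        C' * mixedVar (supportMap (K t)) 1 (h' t))) s t := by
  have h1 : HasDerivWithinAt (fun τ => firstVar (supportMap (K τ)) (h' τ - h' t))
      (firstVar (supportMap (K t)) h₂) s t := by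
    rw [hasDerivWithinAt_iff_tendsto_slope] at hd2 ⊢
    have tH : Tendsto (fun τ => supportMap (K τ)) (𝓝[s \ {t}] t) (𝓝 (supportMap (K t))) :=
      hd.continuousWithinAt.mono_left (nhdsWithin_mono _ Set.sdiff_subset)
    refine (tendsto_firstVar hK tH hd2).congr fun τ => ?_
    have h0 : firstVar (supportMap (K t)) (0 : C(Sph n, ℝ)) = 0 := by
      simpa using firstVar_smul (supportMap (K t)) 0 0
    simp only [slope_def_module, sub_self, h0, sub_zero, firstVar_smul, smul_eq_mul]
  have h2 := hasDerivWithinAt_firstVar hd hK pF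
  have h3 := hasDerivWithinAt_firstVar hd hK hK
  have h4 := hasDerivWithinAt_firstVar (M := ballBody n) hd hK fun v => by
    rw [supportMap_ballBody]; exact one_pos
  rw [mixedVar_self hK] at h3
  rw [supportMap_ballBody] at h4
  have e : ∀ τ, (∀ v, 0 < supportMap (K τ) v) → firstVar (supportMap (K τ)) (h' τ) =
      firstVar (supportMap (K τ)) (h' τ - h' t) + (firstVar (supportMap (K τ)) (supportMap F) -
        C * firstVar (supportMap (K τ)) (supportMap (K t)) -
        C' * firstVar (supportMap (K τ)) 1) := by
    intro τ hτ
    have : h' τ = (h' τ - h' t) + (supportMap F + ((-C) • supportMap (K t) +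
        (-C') • (1 : C(Sph n, ℝ)))) := by
      rw [hF, hz]
      ext u
      simp only [ContinuousMap.add_apply, ContinuousMap.sub_apply, ContinuousMap.mul_apply,
        ContinuousMap.smul_apply, ContinuousMap.one_apply, smul_eq_mul]
      ring
    conv_lhs => rw [this]
    rw [firstVar_add hτ, firstVar_add hτ, firstVar_add hτ, firstVar_smul, firstVar_smul]
    ring
  refine (h1.add ((h2.sub (h3.const_mul C)).sub (h4.const_mul C'))).congr_of_eventuallyEq ?_
    (e t hK)
  exact (eventually_pos hd.continuousWithinAt hK).mono e

/-! ### The derivative of the measure term -/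

theorem hasDerivWithinAt_integral_comp_mul {X : Type*} [TopologicalSpace X] [CompactSpace X]
    [Nonempty X] [MeasurableSpace X] [BorelSpace X] {m : Measure X}
    [IsFiniteMeasure m] {f f' : ℝ → ℝ} (hf : ∀ x, 0 < x → HasDerivAt f (f' x) x)
    (hf' : ContinuousOn f' (Set.Ioi 0)) {H G : ℝ → C(X, ℝ)} {H' G' : C(X, ℝ)} {s : Set ℝ} {t : ℝ}
    (hH : HasDerivWithinAt H H' s t) (hG : HasDerivWithinAt G G' s t) (hpos : ∀ v, 0 < H t v) :
    HasDerivWithinAt (fun τ => ∫ u, f (H τ u) * G τ u ∂m)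
      (∫ u, (f' (H t u) * H' u * G t u + f (H t u) * G' u) ∂m) s t := by
  obtain ⟨v₀, -, hv₀⟩ := isCompact_univ.exists_isMinOn (Set.univ_nonempty (α := X))
    (H t).continuous.continuousOn
  set c := H t v₀ with hc
  have hc0 : 0 < c := hpos v₀
  have hcv : ∀ u, c ≤ H t u := fun u => hv₀ (Set.mem_univ u)
  set I := Set.Icc (c / 2) (‖H t‖ + c / 2) with hI
  have hI0 : I ⊆ Set.Ioi 0 := fun x hx => (half_pos hc0).trans_le hx.1
  have hfc : ContinuousOn f (Set.Ioi 0) := fun x hx => (hf x hx).continuousAt.continuousWithinAt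
  obtain ⟨Λ, hΛ⟩ := isCompact_Icc.exists_bound_of_continuousOn (hf'.mono hI0)
  obtain ⟨M, hM⟩ := isCompact_Icc.exists_bound_of_continuousOn (hfc.mono hI0)
  have hmemt : ∀ u, H t u ∈ I := fun u => ⟨by linarith [hcv u],
    by linarith [(le_abs_self _).trans ((H t).norm_coe_le_norm u)]⟩
  have hΛ0 : 0 ≤ Λ := (norm_nonneg _).trans (hΛ _ (hmemt v₀))
  have lip : ∀ x ∈ I, ∀ y ∈ I, ‖f y - f x‖ ≤ Λ * ‖y - x‖ := fun x hx y hy =>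
    (convex_Icc _ _).norm_image_sub_le_of_norm_hasDerivWithin_le
      (fun w hw => (hf w (hI0 hw)).hasDerivWithinAt) hΛ hx hy
  set l := 𝓝[s \ {t}] t with hl
  have mono : l ≤ 𝓝[s] t := nhdsWithin_mono _ Set.sdiff_subset
  have tH : Tendsto H l (𝓝 (H t)) := hH.continuousWithinAt.mono_left mono
  have tG : Tendsto G l (𝓝 (G t)) := hG.continuousWithinAt.mono_left mono
  have sH := hasDerivWithinAt_iff_tendsto_slope.1 hH
  have sG := hasDerivWithinAt_iff_tendsto_slope.1 hG
  have ev : ∀ᶠ τ in l, ∀ u, H τ u ∈ I := by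
    filter_upwards [Metric.tendsto_nhds.1 tH _ (half_pos hc0)] with τ hτ u
    have h1 := (ContinuousMap.dist_apply_le_dist (f := H τ) (g := H t) u).trans_lt hτ
    rw [Real.dist_eq, abs_lt] at h1
    have h2 := (le_abs_self _).trans ((H t).norm_coe_le_norm u)
    exact ⟨by linarith [hcv u], by linarith⟩
  have evH : ∀ᶠ τ in l, ‖slope H t τ‖ ≤ ‖H'‖ + 1 :=
    (sH.norm.eventually_lt_const (lt_add_one _)).mono fun _ h => h.le
  have evG : ∀ᶠ τ in l, ‖slope G t τ‖ ≤ ‖G'‖ + 1 :=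
    (sG.norm.eventually_lt_const (lt_add_one _)).mono fun _ h => h.le
  have evG' : ∀ᶠ τ in l, ‖G τ‖ ≤ ‖G t‖ + 1 :=
    (tG.norm.eventually_lt_const (lt_add_one _)).mono fun _ h => h.le
  have cont : ∀ τ, (∀ u, H τ u ∈ I) → Continuous fun u => f (H τ u) * G τ u := fun τ hτ =>
    (hfc.comp_continuous (H τ).continuous fun u => hI0 (hτ u)).mul (G τ).continuous
  have int : ∀ τ, (∀ u, H τ u ∈ I) → Integrable (fun u => f (H τ u) * G τ u) m := fun τ hτ =>
    (cont τ hτ).integrable_of_hasCompactSupport (HasCompactSupport.of_compactSpace _)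
  have ptH : ∀ u, HasDerivWithinAt (fun τ => H τ u) (H' u) s t := fun u =>
    (ContinuousMap.evalCLM ℝ u : C(X, ℝ) →L[ℝ] ℝ).hasFDerivAt.comp_hasDerivWithinAt t hH
  have ptG : ∀ u, HasDerivWithinAt (fun τ => G τ u) (G' u) s t := fun u =>
    (ContinuousMap.evalCLM ℝ u : C(X, ℝ) →L[ℝ] ℝ).hasFDerivAt.comp_hasDerivWithinAt t hG
  rw [hasDerivWithinAt_iff_tendsto_slope]
  have main : Tendsto (fun τ => ∫ u, slope (fun τ => f (H τ u) * G τ u) t τ ∂m) l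
      (𝓝 (∫ u, (f' (H t u) * H' u * G t u + f (H t u) * G' u) ∂m)) := by
    refine tendsto_integral_filter_of_dominated_convergence
      (fun _ => Λ * (‖H'‖ + 1) * (‖G t‖ + 1) + M * (‖G'‖ + 1)) ?_ ?_ (integrable_const _) ?_
    · filter_upwards [ev] with τ hτ
      simp only [slope_def_module]
      exact Continuous.aestronglyMeasurable
        (by exact continuous_const.mul ((cont τ hτ).sub (cont t hmemt)))
    · filter_upwards [ev, evH, evG, evG'] with τ h1 h2 h3 h4
      refine Eventually.of_forall fun u => ?_
      have e : slope (fun τ => f (H τ u) * G τ u) t τ =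
          (τ - t)⁻¹ * (f (H τ u) - f (H t u)) * G τ u + f (H t u) * slope G t τ u := by
        simp only [slope_def_module, smul_eq_mul, ContinuousMap.smul_apply, ContinuousMap.sub_apply]
        ring
      have b1 : ‖(τ - t)⁻¹ * (f (H τ u) - f (H t u))‖ ≤ Λ * (‖H'‖ + 1) := by
        rw [norm_mul]
        calc ‖(τ - t)⁻¹‖ * ‖f (H τ u) - f (H t u)‖
            ≤ ‖(τ - t)⁻¹‖ * (Λ * ‖H τ u - H t u‖) := by
              gcongr; exact lip _ (hmemt u) _ (h1 u)
          _ = Λ * ‖slope H t τ u‖ := by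
              simp only [slope_def_module, ContinuousMap.smul_apply, ContinuousMap.sub_apply,
                smul_eq_mul, norm_mul]
              ring
          _ ≤ Λ * (‖H'‖ + 1) := by
              gcongr; exact ((slope H t τ).norm_coe_le_norm u).trans h2
      rw [e]
      refine (norm_add_le _ _).trans (add_le_add ?_ ?_)
      · rw [norm_mul]
        exact mul_le_mul b1 (((G τ).norm_coe_le_norm u).trans h4) (norm_nonneg _) (by positivity)
      · rw [norm_mul]
        exact mul_le_mul (hM _ (hmemt u)) (((slope G t τ).norm_coe_le_norm u).trans h3)
          (norm_nonneg _) ((norm_nonneg _).trans (hM _ (hmemt u)))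
    · refine Eventually.of_forall fun u => ?_
      exact hasDerivWithinAt_iff_tendsto_slope.1
        (((hf _ (hpos u)).comp_hasDerivWithinAt t (ptH u)).mul (ptG u))
  refine main.congr' ?_
  filter_upwards [ev] with τ hτ
  simp only [slope_def_module]
  rw [integral_smul, integral_sub (int τ hτ) (int t hmemt)]

theorem hasDerivWithinAt_integral_rpow {m : Measure (Sph n)} [IsFiniteMeasure m] (p : ℝ)
    {H : ℝ → C(Sph n, ℝ)} {H' : C(Sph n, ℝ)} {s : Set ℝ} {t : ℝ}
    (hH : HasDerivWithinAt H H' s t) (hpos : ∀ v, 0 < H t v) :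
    HasDerivWithinAt (fun τ => ∫ u, H τ u ^ p ∂m) (p * ∫ u, H' u * H t u ^ (p - 1) ∂m) s t := by
  have h := hasDerivWithinAt_integral_comp_mul (m := m) (f := fun x => x ^ p)
    (fun x hx => Real.hasDerivAt_rpow_const (Or.inl hx.ne'))
    (continuousOn_const.mul (continuousOn_id.rpow_const fun x hx => Or.inl (ne_of_gt hx))) hH
    (hasDerivWithinAt_const t s (1 : C(Sph n, ℝ))) hpos
  simp only [ContinuousMap.one_apply, ContinuousMap.zero_apply, mul_one, mul_zero, add_zero] at h
  rw [← integral_const_mul]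
  exact h.congr_deriv (by congr 1; funext u; ring)

theorem hasDerivWithinAt_integral_log {m : Measure (Sph n)} [IsFiniteMeasure m]
    {H : ℝ → C(Sph n, ℝ)} {H' : C(Sph n, ℝ)} {s : Set ℝ} {t : ℝ}
    (hH : HasDerivWithinAt H H' s t) (hpos : ∀ v, 0 < H t v) :
    HasDerivWithinAt (fun τ => ∫ u, Real.log (H τ u) ∂m) (∫ u, H' u * H t u ^ (-1 : ℝ) ∂m) s t := by
  have h := hasDerivWithinAt_integral_comp_mul (m := m) (f := Real.log)
    (fun x hx => Real.hasDerivAt_log hx.ne')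
    (continuousOn_inv₀.mono fun x hx => ne_of_gt hx) hH
    (hasDerivWithinAt_const t s (1 : C(Sph n, ℝ))) hpos
  simp only [ContinuousMap.one_apply, ContinuousMap.zero_apply, mul_one, mul_zero, add_zero] at h
  exact h.congr_deriv (by congr 1; funext u; rw [Real.rpow_neg_one, mul_comm])

theorem hasDerivWithinAt_integral_mul_rpow {m : Measure (Sph n)} [IsFiniteMeasure m] (q : ℝ)
    {H G : ℝ → C(Sph n, ℝ)} {H' G' : C(Sph n, ℝ)} {s : Set ℝ} {t : ℝ}
    (hH : HasDerivWithinAt H H' s t) (hG : HasDerivWithinAt G G' s t) (hpos : ∀ v, 0 < H t v) :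
    HasDerivWithinAt (fun τ => ∫ u, G τ u * H τ u ^ q ∂m)
      (q * (∫ u, G t u * H' u * H t u ^ (q - 1) ∂m) + ∫ u, G' u * H t u ^ q ∂m) s t := by
  have h := hasDerivWithinAt_integral_comp_mul (m := m) (f := fun x => x ^ q)
    (fun x hx => Real.hasDerivAt_rpow_const (Or.inl hx.ne'))
    (continuousOn_const.mul (continuousOn_id.rpow_const fun x hx => Or.inl (ne_of_gt hx))) hH
    hG hpos
  have c : ∀ r : ℝ, Continuous fun u => H t u ^ r := fun r =>
    (H t).continuous.rpow_const fun u => Or.inl (hpos u).ne'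
  have i : ∀ {g : Sph n → ℝ}, Continuous g → Integrable g m := fun hg =>
    hg.integrable_of_hasCompactSupport (HasCompactSupport.of_compactSpace _)
  rw [← integral_const_mul, ← integral_add
    (by exact i (continuous_const.mul (((G t).continuous.mul H'.continuous).mul (c _))))
    (by exact i (G'.continuous.mul (c _)))]
  have e : (fun τ => ∫ u, G τ u * H τ u ^ q ∂m) = fun τ => ∫ u, H τ u ^ q * G τ u ∂m := by
    funext τ; congr 1; funext u; ring
  rw [e]
  exact h.congr_deriv (by congr 1; funext u; ring)

/-! ### The first derivative of the functional -/

theorem integral_rpow_pos {m : Measure (Sph n)} [IsFiniteMeasure m] (hm : m ≠ 0) (p : ℝ)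
    {h : C(Sph n, ℝ)} (hh : ∀ v, 0 < h v) : 0 < ∫ u, h u ^ p ∂m := by
  have c : Continuous fun u => h u ^ p := h.continuous.rpow_const fun u => Or.inl (hh u).ne'
  rw [integral_pos_iff_support_of_nonneg (fun u => (Real.rpow_pos_of_pos (hh u) p).le)
    (c.integrable_of_hasCompactSupport (HasCompactSupport.of_compactSpace _))]
  have : Function.support (fun u => h u ^ p) = Set.univ :=
    Set.eq_univ_of_forall fun u => (Real.rpow_pos_of_pos (hh u) p).ne'
  rw [this]
  exact Measure.measure_univ_pos.2 hm

/-- For p = 0 the denominator is the total mass of a probability measure, so the logarithmic case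
has the same formula. -/
theorem hasDerivWithinAt_functionalF {p : ℝ} {m : Measure (Sph n)} [IsFiniteMeasure m]
    (hm : p = 0 → IsProbabilityMeasure m) (hm0 : m ≠ 0) {K : ℝ → ConvexBody (Eucl n)}
    {h' : C(Sph n, ℝ)} {s : Set ℝ} {t : ℝ}
    (hd : HasDerivWithinAt (fun τ => supportMap (K τ)) h' s t)
    (hK : ∀ v, 0 < supportMap (K t) v) :
    HasDerivWithinAt (fun τ => functionalF p m (K τ))
      ((∫ u, h' u * supportMap (K t) u ^ (p - 1) ∂m) / (∫ u, supportMap (K t) u ^ p ∂m) -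
        1 / ((n : ℝ) + 1) * (firstVar (supportMap (K t)) h' / wvol (supportMap (K t)))) s t := by
  have hI := integral_rpow_pos hm0 p hK
  have hV : HasDerivWithinAt (fun τ => 1 / ((n : ℝ) + 1) * Real.log (vol (K τ)))
      (1 / ((n : ℝ) + 1) * (firstVar (supportMap (K t)) h' / wvol (supportMap (K t)))) s t := by
    refine HasDerivWithinAt.const_mul _ (((hasDerivWithinAt_wvol hd hK).log
      (wvol_pos hK).ne').congr_of_eventuallyEq ?_ (by rw [vol_eq_wvol hK]))
    filter_upwards [eventually_pos hd.continuousWithinAt hK] with τ hτ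
    rw [vol_eq_wvol hτ]
  refine HasDerivWithinAt.sub ?_ hV
  by_cases hp : p = 0
  · have := hm hp
    simp only [hp, if_true, Real.rpow_zero, integral_const, probReal_univ, smul_eq_mul, mul_one,
      div_one, zero_sub]
    exact hasDerivWithinAt_integral_log hd hK
  · simp only [hp, if_false]
    have h := ((hasDerivWithinAt_integral_rpow (m := m) p hd hK).log hI.ne').const_mul (1 / p)
    exact h.congr_deriv (by field_simp)

end NonsmoothVariation

end

open NonsmoothVariation in
theorem mainTheorem7 (n : ℕ) (hn : 1 ≤ n) (p : ℝ)
    (m : Measure (Sph n)) [IsFiniteMeasure m] (hm : p = 0 → IsProbabilityMeasure m)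
    -- the family of convex bodies, parametrized by `[a, 1]` (for instance `a = 0` or `a = -1`),
    -- twice differentiable in `C(Sⁿ)`
    (a : ℝ) (ha : a ≤ 0) (K : ℝ → ConvexBody (Eucl n))
    (hK : ∀ t ∈ Set.Icc a 1, (interior (K t : Set (Eucl n))).Nonempty)
    (h' h'' : ℝ → C(Sph n, ℝ))
    (hd1 : ∀ t ∈ Set.Icc a 1,
      HasDerivWithinAt (fun s => supportMap (K s)) (h' t) (Set.Icc a 1) t)
    (hd2 : ∀ t ∈ Set.Icc a 1, HasDerivWithinAt h' (h'' t) (Set.Icc a 1) t)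
    -- the initial body: positive support function, critical
    (hpos : ∀ u, 0 < supportMap (K 0) u)
    (hcrit : IsCriticalPoint p m (K 0))
    -- the direction `h₀' = h₀ z`
    (z : Sph n → ℝ) (hz : IsQuasiPSH z) (hzgrad : ∃ C, LipschitzWith C z)
    (hh' : ∀ u, h' 0 u = supportMap (K 0) u * z u) :
    ∃ μ : Measure (Sph n),
      IsGradMeasure (K 0) z μ ∧ (∀ ν, IsGradMeasure (K 0) z ν → ν = μ) ∧
      (∀ᶠ t in 𝓝[Set.Icc a 1] 0,
        DifferentiableWithinAt ℝ (fun s => functionalF p m (K s)) (Set.Icc a 1) t) ∧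
      HasDerivWithinAt
        (fun t => derivWithin (fun s => functionalF p m (K s)) (Set.Icc a 1) t)
        ((p - 1 - n) / ((n + 1) * vol (K 0))
            * (∫ u, z u ^ 2 * supportMap (K 0) u ∂(surfaceAreaMeasure (K 0)))
          + (n + 1 - p) / ((n + 1) * vol (K 0)) ^ 2
            * (∫ u, h' 0 u ∂(surfaceAreaMeasure (K 0))) ^ 2
          + 1 / ((n + 1) * vol (K 0)) * (∫ u, supportMap (K 0) u ^ 2 ∂μ))
        (Set.Icc a 1) 0 := by
  obtain ⟨Λ, hΛ⟩ := hzgrad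
  let ζ : C(Sph n, ℝ) := ⟨z, hΛ.continuous⟩
  have hζ : IsQuasiPSH ζ := hz
  obtain ⟨μ, C, C', F, hμ, hF, pF, hsq⟩ := exists_gradMeasure_and_integral_sq hpos hζ
  have h0 : (0 : ℝ) ∈ Set.Icc a 1 := ⟨ha, zero_le_one⟩
  have huniq : UniqueDiffOn ℝ (Set.Icc a 1) := uniqueDiffOn_Icc (ha.trans_lt one_pos)
  have hz' : h' 0 = supportMap (K 0) * ζ := by ext u; exact hh' u
  set h := supportMap (K 0) with hh
  have hvol : vol (K 0) = wvol h := vol_eq_wvol hpos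
  have hS : ∀ g : C(Sph n, ℝ), ∫ u, g u ∂(surfaceAreaMeasure (K 0)) = firstVar h g :=
    fun g => integral_surfaceAreaMeasure hpos g
  have hV : 0 < wvol h := wvol_pos hpos
  have hN : (0 : ℝ) < (n : ℝ) + 1 := by positivity
  have crit : ∀ g : C(Sph n, ℝ), (∫ u, g u * h u ^ (p - 1) ∂m) / (∫ u, h u ^ p ∂m)
      = firstVar h g / (((n : ℝ) + 1) * wvol h) := fun g => by
    rw [← hS, ← hvol]; exact hcrit g
  -- With g = h the right side of the critical point equation is 1, whereas the left side vanishes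
  -- for m = 0.
  have hm0 : m ≠ 0 := by
    rintro rfl
    have h1 := crit h
    rw [firstVar_self hpos, div_self (by positivity)] at h1
    simp at h1
  have hI := integral_rpow_pos hm0 p hpos
  have hev : ∀ᶠ t in 𝓝[Set.Icc a 1] 0, t ∈ Set.Icc a 1 ∧ ∀ v, 0 < supportMap (K t) v :=
    (eventually_mem_nhdsWithin).and (eventually_pos (hd1 0 h0).continuousWithinAt hpos)
  refine ⟨μ, hμ, fun ν hν => hν.unique hpos hζ hμ, ?_, ?_⟩
  · filter_upwards [hev] with t ht
    exact (hasDerivWithinAt_functionalF hm hm0 (hd1 t ht.1) ht.2).differentiableWithinAt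
  have e1 : ∀ t, t ∈ Set.Icc a 1 ∧ (∀ v, 0 < supportMap (K t) v) →
      derivWithin (fun s => functionalF p m (K s)) (Set.Icc a 1) t =
      (∫ u, h' t u * supportMap (K t) u ^ (p - 1) ∂m) / (∫ u, supportMap (K t) u ^ p ∂m) -
        1 / ((n : ℝ) + 1) * (firstVar (supportMap (K t)) (h' t) / wvol (supportMap (K t))) :=
    fun t ht => (hasDerivWithinAt_functionalF hm hm0 (hd1 t ht.1) ht.2).derivWithin
      (huniq t ht.1)
  have dA := hasDerivWithinAt_integral_mul_rpow (m := m) (p - 1) (hd1 0 h0) (hd2 0 h0) hpos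
  have dI := hasDerivWithinAt_integral_rpow (m := m) p (hd1 0 h0) hpos
  have dB := hasDerivWithinAt_firstVar_deriv (hd1 0 h0) (hd2 0 h0) hpos hz' hF pF
  have dV := hasDerivWithinAt_wvol (hd1 0 h0) hpos
  have D := (dA.div dI hI.ne').sub ((dB.div dV hV.ne').const_mul (1 / ((n : ℝ) + 1)))
  refine (D.congr_of_eventuallyEq (hev.mono e1) (e1 0 ⟨h0, hpos⟩)).congr_deriv ?_
  -- Because h' = h z, the term (h')² h^{p-2} is the test function h z² against h^{p-1}, a form to
  -- which criticality applies.
  have i1 : ∫ u, h' 0 u * h' 0 u * h u ^ (p - 1 - 1) ∂m =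
      ∫ u, (h * (ζ * ζ)) u * h u ^ (p - 1) ∂m := by
    congr 1
    funext u
    rw [hz', Real.rpow_sub_one (hpos u).ne' (p - 1)]
    have := (hpos u).ne'
    simp only [ContinuousMap.mul_apply]
    field_simp
  have i2 : ∫ u, z u ^ 2 * h u ∂(surfaceAreaMeasure (K 0)) = firstVar h (h * (ζ * ζ)) := by
    rw [← hS]
    congr 1
    funext u
    simp only [ContinuousMap.mul_apply, ζ, ContinuousMap.coe_mk]
    ring
  -- Criticality in these three directions converts all integrals against m. The terms in h'' then
  -- cancel between the measure part and the volume part, and the coefficients p - 1 - n and n + 1 -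
  -- p are collected from both.
  have c1 := crit (h * (ζ * ζ))
  have c2 := crit (h' 0)
  have c3 := crit (h'' 0)
  rw [← i1] at c1
  rw [i2, hS, hvol, hsq, ← hz']
  rw [div_eq_iff hI.ne'] at c1 c2 c3
  simp only [← hh]
  rw [c1, c2, c3]
  field_simp
  ring
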